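/- Let $K$ be an algebraically closed field and let $A$ be a finite-dimensional basic $K$-algebra with a complete set of primitive orthogonal idempotents $(e_i)_{i\in Q_0}$, whose finite index set $Q_0$ carries a partial order $\leqslant$. Modules are left modules. Put $P(i)=Ae_i$, $S(i)=P(i)/\operatorname{rad}P(i)$, $I(i)=\operatorname{Hom}_K(e_iA,K)$ and $[M:S(i)]=\dim_K e_iM$. Let $\Delta(i)$ be the largest factor module of $P(i)$, and $\nabla(i)$ the largest submodule of $I(i)$, all of whose composition factors are of the form $S(j)$ with $j\leqslant i$. A module is $\Delta$-good (resp. $\nabla$-good) if it has a finite filtration whose subquotients are of the form $\Delta(j)$ (resp. $\nabla(j)$); $(M:\Delta(j))$ (resp. $(M:\nabla(j))$) is the number of subquotients isomorphic to $\Delta(j)$ (resp. $\nabla(j)$) in such a filtration. $(A,\leqslant)$ is quasi-hereditary if for all $i$ one has $[\Delta(i):S(i)]=1$ and $P(i)$ is $\Delta$-good with $(P(i):\Delta(i))=1$ and $(P(i):\Delta(j))=0$ for $j\not\geqslant i$. It is 1-quasi-hereditary if moreover: (1) $(Q_0,\leqslant)$ has a least element $1$ and a greatest element $n$; (2) $[\Delta(i):S(j)]=(P(j):\Delta(i))=1$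 for all $j\leqslant i$; (3) $\operatorname{soc}P(j)\cong\operatorname{top}I(j)\cong S(1)$ for all $j$; (4) for all $i$ there are an injective homomorphism $\Delta(i)\hookrightarrow\Delta(n)$ and a surjective homomorphism $\nabla(n)\twoheadrightarrow\nabla(i)$. Let $(A,\leqslant)$ be 1-quasi-hereditary. For $i\in Q_0$ let $T(i)$ be the indecomposable direct summand of the characteristic tilting module corresponding to $i$, that is, the indecomposable module (unique up to isomorphism) which is both $\Delta$-good and $\nabla$-good and satisfies $(T(i):\Delta(i))=(T(i):\nabla(i))=[T(i):S(i)]=1$ and $(T(i):\Delta(j))=(T(i):\nabla(j))=[T(i):S(j)]=0$ for all $j\not\leqslant i$. Let $T=\bigoplus_{i\in Q_0}T(i)$ and let $R(A)=\operatorname{End}_A(T)^{op}$ be the Ringel dual of $A$, with the idempotents given by the projections of $T$ onto the summands $T(i)$ and with the order on $Q_0$ opposite to $\leqslant$. Each $P(l)$ is isomorphic to exactly one submodule of $P(1)$ and is identified with it. Then the following are equivalent: (a) $R(A)$ is 1-quasi-hereditary (with respect to the opposite order); (b) $T(i)\cong P(1)\big/\sum_{l\in Q_0,\ l\not\leqslant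 i}P(l)$ for every $i\in Q_0$; (c) $T(i)$ is local (i.e. has exactly one maximal submodule) for every $i\in Q_0$. -/

import Mathlib

noncomputable section

namespace QHAlg

universe u v w x y

/-! ### Modules: socle, top, indecomposable and local modules, filtrations

All modules are left modules. -/

section General

variable (A : Type v) [Ring A] (M : Type w) [AddCommGroup M] [Module A M]

/-- The socle of a module: the sum of its simple submodules. -/
def soc : Submodule A M := sSup {N | IsSimpleModule A N}

/-- The top `M / rad M` of a module, where `rad M` is the intersection of the maximal
submodules of `M`. -/
abbrev Top : Type w := M ⧸ Module.jacobson A M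

/-- A nonzero module without a nontrivial decomposition as an internal direct sum. -/
def IsIndecomposable : Prop :=
  Nontrivial M ∧ ∀ N N' : Submodule A M, IsCompl N N' → N = ⊥ ∨ N' = ⊥

/-- A (finite dimensional) module is local if it has exactly one maximal submodule. -/
def IsLocalMod : Prop := ∃! N : Submodule A M, IsCoatom N

variable {A}

/-- A finite filtration `0 = F 0 ⊆ F 1 ⊆ ⋯ ⊆ F r = M` whose successive subquotients
`F (t + 1) / F t` are isomorphic to members `X (label t)` of the family `X`. -/
structure Filtration {ι : Type x} (X : ι → Type y) [∀ i, AddCommGroup (X i)]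
    [∀ i, Module A (X i)] (M : Type w) [AddCommGroup M] [Module A M] where
  /-- the number of steps -/
  r : ℕ
  /-- the submodules of the filtration -/
  F : Fin (r + 1) → Submodule A M
  /-- the index of the `t`-th subquotient -/
  label : Fin r → ι
  bot : F 0 = ⊥
  top : F (Fin.last r) = ⊤
  mono : ∀ t : Fin r, F t.castSucc ≤ F t.succ
  iso : ∀ t : Fin r,
    Nonempty ((F t.succ ⧸ (F t.castSucc).submoduleOf (F t.succ)) ≃ₗ[A] X (label t))

/-- `M` has a filtration with subquotients in the family `X`. -/
def IsGood {ι : Type x} (X : ι → Type y) [∀ i, AddCommGroup (X i)] [∀ i, Module A (X i)]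
    (M : Type w) [AddCommGroup M] [Module A M] : Prop :=
  Nonempty (Filtration (A := A) X M)

/-- `(M : X j) = c`: the module `M` has a filtration with subquotients in the family `X` in
which `X j` occurs exactly `c` times. -/
def HasMult {ι : Type x} (X : ι → Type y) [∀ i, AddCommGroup (X i)] [∀ i, Module A (X i)]
    (M : Type w) [AddCommGroup M] [Module A M] (j : ι) (c : ℕ) : Prop :=
  ∃ 𝓕 : Filtration (A := A) X M, Nat.card {t : Fin 𝓕.r // 𝓕.label t = j} = c

end General

/-! ### The standard dual `D(A) = Hom_K(A, K)` as a left `A`-module -/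

section Dual

variable (K : Type u) [Field K] (A : Type v) [Ring A] [Algebra K A]

/-- The `K`-dual of the algebra `A`, with left `A`-action `(a • f) x = f (x * a)`. -/
def KDual : Type (max u v) := A →ₗ[K] K

instance : AddCommGroup (KDual K A) := inferInstanceAs (AddCommGroup (A →ₗ[K] K))

instance : Module K (KDual K A) := inferInstanceAs (Module K (A →ₗ[K] K))

instance : FunLike (KDual K A) A K := inferInstanceAs (FunLike (A →ₗ[K] K) A K)

instance : SMul A (KDual K A) :=
  ⟨fun a f => LinearMap.comp (show A →ₗ[K] K from f) (LinearMap.mulRight K a)⟩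

variable {K A}

theorem KDual.smul_apply (a : A) (f : KDual K A) (x : A) : (a • f) x = f (x * a) := rfl

theorem KDual.add_apply (f g : KDual K A) (x : A) : (f + g) x = f x + g x := rfl

theorem KDual.zero_apply (x : A) : (0 : KDual K A) x = 0 := rfl

theorem KDual.ksmul_apply (c : K) (f : KDual K A) (x : A) : (c • f) x = c * f x := rfl

theorem KDual.map_add (f : KDual K A) (x y : A) : f (x + y) = f x + f y :=
  LinearMap.map_add (show A →ₗ[K] K from f) x y

theorem KDual.map_zero (f : KDual K A) : f 0 = 0 :=
  LinearMap.map_zero (show A →ₗ[K] K from f)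

theorem KDual.map_smul (f : KDual K A) (c : K) (x : A) : f (c • x) = c * f x :=
  LinearMap.map_smul (show A →ₗ[K] K from f) c x

theorem KDual.ext {f g : KDual K A} (h : ∀ x, f x = g x) : f = g :=
  LinearMap.ext (f := (show A →ₗ[K] K from f)) (g := (show A →ₗ[K] K from g)) h

instance : Module A (KDual K A) where
  one_smul f := KDual.ext fun x => by rw [KDual.smul_apply, mul_one]
  mul_smul a b f := KDual.ext fun x => by simp only [KDual.smul_apply, mul_assoc]
  smul_zero a := KDual.ext fun x => by simp only [KDual.smul_apply, KDual.zero_apply]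
  smul_add a f g := KDual.ext fun x => by simp only [KDual.smul_apply, KDual.add_apply]
  add_smul a b f := KDual.ext fun x => by
    simp only [KDual.smul_apply, KDual.add_apply, mul_add, KDual.map_add]
  zero_smul f := KDual.ext fun x => by
    simp only [KDual.smul_apply, KDual.zero_apply, mul_zero, KDual.map_zero]

instance : IsScalarTower K A (KDual K A) where
  smul_assoc c a f := KDual.ext fun x => by
    simp only [KDual.smul_apply, KDual.ksmul_apply, mul_smul_comm, KDual.map_smul]

end Dual

/-! ### Basic algebras and their distinguished modules

A finite dimensional basic algebra over an algebraically closed field `K` is given with a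
complete family `e : ι → A` of primitive orthogonal idempotents, indexed by the vertices of
its quiver. -/

section Algebra

variable (K : Type u) [Field K] {A : Type v} [Ring A] [Algebra K A] {ι : Type w} (e : ι → A)

/-- The Jordan-Hölder multiplicity `[M : S(j)] = dim_K (e_j M)`. -/
def jh (M : Type x) [AddCommGroup M] [Module K M] [Module A M] [IsScalarTower K A M]
    (j : ι) : ℕ :=
  Module.finrank K (LinearMap.range (Algebra.lsmul K K M (e j)))

/-- The projective module `P(i) = A e_i`. -/
abbrev P (i : ι) : Submodule A A := Submodule.span A {e i}

/-- The simple module `S(i) = P(i) / rad P(i)`. -/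
abbrev S (i : ι) : Type v := Top A (P e i)

/-- The injective module `I(i) = D(e_i A)`, realised inside `D(A)` as the set of the
functionals `f` with `f x = f (e_i x)` for all `x`. -/
def I (i : ι) : Submodule A (KDual K A) where
  carrier := {f | ∀ x, f x = f (e i * x)}
  zero_mem' := fun _ => rfl
  add_mem' := fun {f g} hf hg x => by
    rw [KDual.add_apply, KDual.add_apply, hf x, hg x]
  smul_mem' := fun a f hf x => by
    rw [KDual.smul_apply, KDual.smul_apply, hf (x * a), mul_assoc]

variable [PartialOrder ι]

/-- The smallest submodule `U` of `P(i)` such that `[P(i)/U : S(j)] = 0` for all `j ≰ i`. -/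
def stdKer (i : ι) : Submodule A (P e i) :=
  sInf {U | ∀ j, ¬ j ≤ i → jh K e (P e i ⧸ U) j = 0}

/-- The standard module `Δ(i)`: the largest factor module of `P(i)` such that
`[Δ(i) : S(j)] = 0` for all `j ≰ i`. -/
abbrev Std (i : ι) : Type v := P e i ⧸ stdKer K e i

/-- The costandard module `∇(i)`: the largest submodule of `I(i)` such that
`[∇(i) : S(j)] = 0` for all `j ≰ i`. -/
def Costd (i : ι) : Submodule A (I K e i) :=
  sSup {N | ∀ j, ¬ j ≤ i → jh K e N j = 0}

/-- `A` is a finite dimensional basic algebra and `e` is a complete family of primitive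
orthogonal idempotents of `A`. -/
structure IsBasic {ι : Type w} [Fintype ι] (e : ι → A) : Prop where
  finite : Module.Finite K A
  complete : CompleteOrthogonalIdempotents e
  primitive : ∀ i, IsIndecomposable A (P e i)
  basic : ∀ i j, Nonempty (P e i ≃ₗ[A] P e j) → i = j

/-- The basic algebra `A` is quasi-hereditary with respect to the partial order on `ι`. -/
structure IsQuasiHereditary [Fintype ι] : Prop extends IsBasic K e where
  std_self : ∀ i, jh K e (Std K e i) i = 1
  good : ∀ i, IsGood (A := A) (Std K e) (P e i)
  mult_zero : ∀ i j, ¬ i ≤ j → HasMult (A := A) (Std K e) (P e i) j 0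
  mult_self : ∀ i, HasMult (A := A) (Std K e) (P e i) i 1

/-- The basic algebra `A` is 1-quasi-hereditary with respect to the partial order on `ι`. -/
structure IsOneQuasiHereditary [Fintype ι] : Prop extends IsQuasiHereditary K e where
  exists_bot : ∃ b : ι, IsBot b
  exists_top : ∃ t : ι, IsTop t
  std_jh : ∀ i j, j ≤ i → jh K e (Std K e i) j = 1
  proj_mult : ∀ i j, j ≤ i → HasMult (A := A) (Std K e) (P e j) i 1
  soc_proj : ∀ b : ι, IsBot b → ∀ j, Nonempty (soc A (P e j) ≃ₗ[A] S e b)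
  top_inj : ∀ b : ι, IsBot b → ∀ j, Nonempty (Top A (I K e j) ≃ₗ[A] S e b)
  std_embed : ∀ t : ι, IsTop t → ∀ i,
    ∃ f : Std K e i →ₗ[A] Std K e t, Function.Injective f
  costd_onto : ∀ t : ι, IsTop t → ∀ i,
    ∃ f : Costd K e t →ₗ[A] Costd K e i, Function.Surjective f

/-- `M` is (isomorphic to) the direct summand `T(i)` of the characteristic tilting module:
an indecomposable module which is both `Δ`-good and `∇`-good, in which `Δ(i)`, `∇(i)` and
`S(i)` have multiplicity one and `Δ(j)`, `∇(j)`, `S(j)` do not occur for `j ≰ i`. -/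
structure IsTiltingSummand (i : ι) (M : Type x) [AddCommGroup M] [Module K M] [Module A M]
    [IsScalarTower K A M] : Prop where
  finite : Module.Finite K M
  indecomposable : IsIndecomposable A M
  std_good : IsGood (A := A) (Std K e) M
  costd_good : IsGood (A := A) (fun j => Costd K e j) M
  std_zero : ∀ j, ¬ j ≤ i → HasMult (A := A) (Std K e) M j 0
  costd_zero : ∀ j, ¬ j ≤ i → HasMult (A := A) (fun j => Costd K e j) M j 0
  jh_zero : ∀ j, ¬ j ≤ i → jh K e M j = 0
  std_self : HasMult (A := A) (Std K e) M i 1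
  costd_self : HasMult (A := A) (fun j => Costd K e j) M i 1
  jh_self : jh K e M i = 1

/-- The submodule `∑_{l ≰ i} P(l)` of `P(b)`: the sum of the submodules of `P(b)` which are
isomorphic to some `P(l)` with `l ≰ i`. (For a 1-quasi-hereditary algebra and the least
vertex `b`, each `P(l)` is isomorphic to exactly one submodule of `P(b)`.) -/
def sumProj (b i : ι) : Submodule A (P e b) :=
  sSup {N | ∃ l, ¬ l ≤ i ∧ Nonempty (N ≃ₗ[A] P e l)}

end Algebra

/-! ### The Ringel dual -/

section Ringel

variable (A : Type v) [Ring A] {ι : Type w} (T : ι → Type x) [∀ i, AddCommGroup (T i)]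
  [∀ i, Module A (T i)]

/-- The algebra `End_A(T)^op`, where `T = ⊕ T(i)` (a finite direct sum, realised as the
product of the `T(i)`). -/
abbrev RingelDual : Type (max w x) := (Module.End A (∀ i, T i))ᵐᵒᵖ

open Classical in
/-- The idempotents of `End_A(T)^op` given by the projections of `T` onto the summands
`T(i)`. They are indexed by `ι` with the opposite order. -/
def ringelIdem (i : ιᵒᵈ) : RingelDual A T :=
  MulOpposite.op
    ((LinearMap.single A T (OrderDual.ofDual i)).comp (LinearMap.proj (OrderDual.ofDual i)))

end Ringel

end QHAlg

end

noncomputable section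

namespace QHAlg

set_option linter.unusedSectionVars false

/-! ### The dimension of `e M` -/

section EDim

variable (K : Type*) [Field K] {A : Type*} [Ring A] [Algebra K A]

/-! The proof runs (a) ⇒ (c) ⇒ (b) ⇒ (a). Let b be the least and t the greatest vertex. Since Δ(j)
embeds in Δ(t) = P(t) and ∇(j) is a quotient of ∇(t) = I(t), condition (3) forces every simple
submodule of a Δ-good module and every simple quotient of a ∇-good module to be S(b). Hence T(i) has
no other simples in its socle and top. Moreover P(b) ≅ I(b) (`exists_proj_equiv_I`), and this module
is T(t) (`IsTiltingSummand.equiv_proj`).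

(c) ⇒ (b), `IsTiltingSummand.equiv_of_isLocalMod`: a local T(i) is generated by one element of e_b
T(i), so it is a quotient of P(b) / ∑_{l ≰ i} P(l), the largest quotient of P(b) with composition
factors S(j), j ≤ i. That module has dimension at most ∑_{j ≤ i} dim Δ(j), because P(b) contains
each Δ(j) once. On the other side each Δ(j) with j ≤ i occurs in T(i): there are nonzero maps T(i) →
∇(i) → ∇(j), and Hom(Δ(k), ∇(j)) = 0 for k ≠ j. So the surjection is an isomorphism.

(b) ⇒ (a): counting S(b) shows that ∇(b) occurs once in T(i), so T(i) is also a submodule of I(b)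
(`IsTiltingSummand.exists_embedding`). The images in e_b I(b) of the generators of the T(j), j ≤ i,
form a triangular basis of the part of e_b I(b) generating submodules supported at vertices ≤ i
(`exists_cyclicFamily`). Consequently Hom(T(k), T(i)) is spanned by the maps T(k) ↠ T(m) ↪ T(i) with
m ≤ i and m ≤ k (`CyclicFamily.exists_coeff`). Everything about R = R(A) is read off from this. Here
P_R(i) = ⊕_k Hom(T(k), T(i)), with R acting by precomposition, and I_R(j) is the dual of ε_j R = ⊕_k
Hom(T(j), T(k)), with R acting by postcomposition. Filtering maps into T(i) by the vertices at which
their image vanishes gives the standard filtration of P_R(i). The maps through T(b) give the socle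
of P_R(j), the top of I_R(j), and the maps required in condition (4).

(a) ⇒ (c), `isLocalMod_of_ringel`: a maximal submodule of T(j) is the kernel of a map g from T(j) to
the simple socle of T(t). In ε_j R such a g spans a right submodule, so the functionals vanishing at
g form a maximal submodule of I_R(j). As I_R(j) is local, all these g are proportional and have the
same kernel. -/

instance finite_submodule {M : Type*} [AddCommGroup M] [Module K M] [Module A M]
    [IsScalarTower K A M] [Module.Finite K M] (N : Submodule A M) : Module.Finite K N :=
  Module.Finite.of_injective (N.subtype.restrictScalars K) N.injective_subtype

/-- The dimension of `e M`. -/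
def edim (e : A) (M : Type*) [AddCommGroup M] [Module K M] [Module A M]
    [IsScalarTower K A M] : ℕ :=
  Module.finrank K (LinearMap.range (Algebra.lsmul K K M e))

variable {M M' : Type*} [AddCommGroup M] [Module K M] [Module A M] [IsScalarTower K A M]
  [AddCommGroup M'] [Module K M'] [Module A M'] [IsScalarTower K A M']

theorem jh_eq_edim {ι : Type*} (e : ι → A) (j : ι) : jh K e M j = edim K (e j) M := rfl

theorem edim_one : edim K (1 : A) M = Module.finrank K M := by
  unfold edim
  rw [map_one]
  exact (LinearEquiv.ofTop _ (LinearMap.range_eq_top.2 fun x => ⟨x, rfl⟩)).finrank_eq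

variable {K}

theorem mem_range_lsmul {e : A} (he : IsIdempotentElem e) {x : M} :
    x ∈ LinearMap.range (Algebra.lsmul K K M e) ↔ e • x = x := by
  constructor
  · rintro ⟨y, rfl⟩
    change e • e • y = e • y
    rw [← mul_smul, he.eq]
  · intro h
    exact ⟨x, h⟩

variable (K)

/-- The functor M ↦ eM is exact: eM maps onto e(M/N) with kernel eN. -/
theorem edim_add [Module.Finite K M] {e : A} (he : IsIdempotentElem e) (N : Submodule A M) :
    edim K e M = edim K e N + edim K e (M ⧸ N) := by
  have h := LinearMap.finrank_range_add_finrank_ker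
    ((N.mkQ.restrictScalars K).domRestrict (LinearMap.range (Algebra.lsmul K K M e)))
  have h1 : LinearMap.range ((N.mkQ.restrictScalars K).domRestrict
      (LinearMap.range (Algebra.lsmul K K M e)))
      = LinearMap.range (Algebra.lsmul K K (M ⧸ N) e) := by
    ext x
    rw [mem_range_lsmul he]
    constructor
    · rintro ⟨⟨y, hy⟩, rfl⟩
      rw [mem_range_lsmul he] at hy
      change e • N.mkQ y = N.mkQ y
      rw [← map_smul, hy]
    · intro hx
      obtain ⟨y, rfl⟩ := N.mkQ_surjective x
      refine ⟨⟨e • y, ⟨y, rfl⟩⟩, ?_⟩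
      change N.mkQ (e • y) = N.mkQ y
      rw [map_smul, hx]
  have h2 : Module.finrank K (LinearMap.ker ((N.mkQ.restrictScalars K).domRestrict
      (LinearMap.range (Algebra.lsmul K K M e))))
      = Module.finrank K (LinearMap.range (Algebra.lsmul K K N e)) := by
    rw [← LinearMap.finrank_range_of_inj (f := (LinearMap.ker
      ((N.mkQ.restrictScalars K).domRestrict
      (LinearMap.range (Algebra.lsmul K K M e)))).subtype) (Submodule.injective_subtype _)]
    rw [Submodule.range_subtype]
    rw [← Submodule.finrank_map_subtype_eq]
    have h3 := LinearMap.finrank_range_of_inj (f := ((N.subtype.restrictScalars K).domRestrict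
      (LinearMap.range (Algebra.lsmul K K N e)))) (by
        intro x y hxy
        exact Subtype.ext (Subtype.ext hxy))
    rw [← h3]
    have : Submodule.map (LinearMap.range (Algebra.lsmul K K M e)).subtype
        (LinearMap.ker ((N.mkQ.restrictScalars K).domRestrict
        (LinearMap.range (Algebra.lsmul K K M e)))) = 
        LinearMap.range ((N.subtype.restrictScalars K).domRestrict
          (LinearMap.range (Algebra.lsmul K K N e))) := by
      ext x
      constructor
      · rintro ⟨⟨y, hy⟩, hyk, rfl⟩
        have hyN : y ∈ N := (Submodule.Quotient.mk_eq_zero N).1 hyk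
        rw [mem_range_lsmul he] at hy
        exact ⟨⟨⟨y, hyN⟩, (mem_range_lsmul he).2 (Subtype.ext hy)⟩, rfl⟩
      · rintro ⟨⟨⟨y, hyN⟩, hy⟩, rfl⟩
        rw [mem_range_lsmul he] at hy
        have hy' : e • y = y := congrArg Subtype.val hy
        exact ⟨⟨y, (mem_range_lsmul he).2 hy'⟩, (Submodule.Quotient.mk_eq_zero N).2 hyN, rfl⟩
    rw [this]
  unfold edim
  rw [h1, h2] at h
  omega

theorem edim_eq_of_equiv (e : A) (f : M ≃ₗ[A] M') : edim K e M = edim K e M' := by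
  unfold edim
  have : LinearMap.range (Algebra.lsmul K K M' e) =
      (LinearMap.range (Algebra.lsmul K K M e)).map
        ((f.restrictScalars K : M ≃ₗ[K] M') : M →ₗ[K] M') := by
    ext x
    constructor
    · rintro ⟨y, rfl⟩
      refine ⟨e • f.symm y, ⟨_, rfl⟩, ?_⟩
      change f (e • f.symm y) = e • y
      rw [map_smul, f.apply_symm_apply]
    · rintro ⟨_, ⟨y, rfl⟩, rfl⟩
      exact ⟨f y, (map_smul f e y).symm⟩
  rw [this, LinearEquiv.finrank_map_eq]

theorem edim_eq_zero_iff [Module.Finite K M] (e : A) :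
    edim K e M = 0 ↔ ∀ x : M, e • x = 0 := by
  unfold edim
  rw [Submodule.finrank_eq_zero, LinearMap.range_eq_bot]
  exact LinearMap.ext_iff

theorem edim_le_of_surjective [Module.Finite K M] [Module.Finite K M'] {e : A}
    (he : IsIdempotentElem e) (f : M →ₗ[A] M') (hf : Function.Surjective f) :
    edim K e M' ≤ edim K e M := by
  rw [edim_add K he (LinearMap.ker f),
    edim_eq_of_equiv K e (LinearMap.quotKerEquivOfSurjective f hf)]
  exact Nat.le_add_left _ _

theorem edim_le_of_injective [Module.Finite K M] [Module.Finite K M'] {e : A}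
    (he : IsIdempotentElem e) (f : M →ₗ[A] M') (hf : Function.Injective f) :
    edim K e M ≤ edim K e M' := by
  rw [edim_add K he (LinearMap.range f), edim_eq_of_equiv K e (LinearEquiv.ofInjective f hf)]
  exact Nat.le_add_right _ _

/-- If `e M` is at most one-dimensional, two elements of `e M` are proportional. -/
theorem exists_smul_eq_of_edim_le_one [Module.Finite K M] {e : A} (he : IsIdempotentElem e)
    (h : edim K e M ≤ 1) {x y : M} (hx : e • x = x) (hy : e • y = y) (hx0 : x ≠ 0) :
    ∃ c : K, y = c • x := by
  have hpos : edim K e M = 1 := by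
    refine le_antisymm h (Nat.one_le_iff_ne_zero.2 fun h0 => hx0 ?_)
    rw [← hx]
    exact (edim_eq_zero_iff K e).1 h0 x
  obtain ⟨c, hc⟩ := (finrank_eq_one_iff_of_nonzero'
    (⟨x, (mem_range_lsmul he).2 hx⟩ : LinearMap.range (Algebra.lsmul K K M e))
    (fun h => hx0 (congrArg Subtype.val h))).1 hpos ⟨y, (mem_range_lsmul he).2 hy⟩
  exact ⟨c, (congrArg Subtype.val hc).symm⟩

theorem edim_eq_one_of [Module.Finite K M] {e : A} (he : IsIdempotentElem e) {x : M}
    (hx : e • x = x) (hx0 : x ≠ 0) (h : ∀ y : M, e • y = y → ∃ c : K, y = c • x) :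
    edim K e M = 1 := by
  refine (finrank_eq_one_iff_of_nonzero'
    (⟨x, (mem_range_lsmul he).2 hx⟩ : LinearMap.range (Algebra.lsmul K K M e))
    (fun h => hx0 (congrArg Subtype.val h))).2 ?_
  rintro ⟨y, hy⟩
  obtain ⟨c, hc⟩ := h y ((mem_range_lsmul he).1 hy)
  exact ⟨c, Subtype.ext hc.symm⟩

/-- A surjection with `dim M ≤ dim M'` is injective. -/
theorem injective_of_surjective_of_finrank_le [Module.Finite K M] [Module.Finite K M']
    (f : M →ₗ[A] M') (hf : Function.Surjective f)
    (h : Module.finrank K M ≤ Module.finrank K M') : Function.Injective f :=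
  (LinearMap.injective_iff_surjective_of_finrank_eq_finrank (f := f.restrictScalars K)
    (le_antisymm h ((f.restrictScalars K).finrank_le_finrank_of_surjective hf))).2 hf

end EDim

/-! ### Modules detected or generated by an idempotent -/

section Detect

variable {A : Type*} [Ring A] (e : A) (M : Type*) [AddCommGroup M] [Module A M]

/-- Every nonzero submodule `N` of `M` satisfies `e N ≠ 0`. -/
def IsDetectedBy : Prop := ∀ x : M, x ≠ 0 → ∃ a : A, (e * a) • x ≠ 0

/-- `M` is generated by `e M`. -/
def IsGeneratedBy : Prop := Submodule.span A {x : M | e • x = x} = ⊤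

variable {e M} {M' : Type*} [AddCommGroup M'] [Module A M']

theorem IsDetectedBy.of_injective (h : IsDetectedBy e M') (f : M →ₗ[A] M')
    (hf : Function.Injective f) : IsDetectedBy e M := by
  intro x hx
  obtain ⟨a, ha⟩ := h (f x) (fun h0 => hx (hf (h0.trans (map_zero f).symm)))
  refine ⟨a, fun h0 => ha ?_⟩
  rw [← map_smul, h0, map_zero]

theorem IsGeneratedBy.of_surjective (h : IsGeneratedBy e M) (f : M →ₗ[A] M')
    (hf : Function.Surjective f) : IsGeneratedBy e M' := by
  unfold IsGeneratedBy at *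
  rw [eq_top_iff, ← LinearMap.range_eq_top.2 hf, LinearMap.range_eq_map, ← h,
    Submodule.map_span, Submodule.span_le]
  rintro _ ⟨x, hx, rfl⟩
  refine Submodule.subset_span ?_
  change e • f x = f x
  rw [← map_smul, hx]

theorem IsGeneratedBy.eq_zero (h : IsGeneratedBy e M) (f : M →ₗ[A] M')
    (hf : ∀ x, e • x = x → f x = 0) : f = 0 := by
  refine LinearMap.ext fun x => ?_
  have hx : x ∈ Submodule.span A {x : M | e • x = x} := by
    rw [show Submodule.span A {x : M | e • x = x} = ⊤ from h]; trivial
  have : Submodule.span A {x : M | e • x = x} ≤ LinearMap.ker f :=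
    Submodule.span_le.2 fun y hy => hf y hy
  exact this hx

end Detect

/-! ### Factorisation through surjections -/

section Factor

variable {A : Type*} [Ring A] {M N Q : Type*} [AddCommGroup M] [Module A M] [AddCommGroup N]
  [Module A N] [AddCommGroup Q] [Module A Q]

theorem exists_factor_of_surjective (p : M →ₗ[A] Q) (hp : Function.Surjective p)
    (f : M →ₗ[A] N) (h : ∀ x, p x = 0 → f x = 0) : ∃ g : Q →ₗ[A] N, ∀ x, g (p x) = f x := by
  refine ⟨((LinearMap.ker p).liftQ f fun x hx => h x hx).comp
    (LinearMap.quotKerEquivOfSurjective p hp).symm.toLinearMap, fun x => ?_⟩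
  have : (LinearMap.quotKerEquivOfSurjective p hp).symm (p x) = (LinearMap.ker p).mkQ x := by
    rw [LinearEquiv.symm_apply_eq]; rfl
  rw [LinearMap.comp_apply, LinearEquiv.coe_coe, this]
  exact Submodule.liftQ_apply _ _ _

end Factor

/-! ### Filtrations -/

theorem fin_exists_step {r : ℕ} (p : Fin (r + 1) → Prop) (h0 : p 0) (h1 : ¬ p (Fin.last r)) :
    ∃ t : Fin r, p t.castSucc ∧ ¬ p t.succ := by
  by_contra! h
  exact h1 (Fin.induction (motive := p) h0 (fun t ht => h t ht) (Fin.last r))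

theorem fin_telescope {r : ℕ} (f : Fin (r + 1) → ℕ) (g : Fin r → ℕ)
    (h : ∀ t : Fin r, f t.succ = f t.castSucc + g t) : f (Fin.last r) = f 0 + ∑ t, g t := by
  induction r with
  | zero => simp
  | succ r ih =>
    have := ih (fun t => f t.castSucc) (fun t => g t.castSucc) (fun t => h t.castSucc)
    rw [Fin.sum_univ_castSucc, ← Fin.succ_last, h, this, Fin.castSucc_zero]
    ring

theorem fin_telescope_le {r : ℕ} (f : Fin (r + 1) → ℕ) (g : Fin r → ℕ)
    (h : ∀ t : Fin r, f t.succ ≤ f t.castSucc + g t) : f (Fin.last r) ≤ f 0 + ∑ t, g t := by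
  induction r with
  | zero => simp
  | succ r ih =>
    have := ih (fun t => f t.castSucc) (fun t => g t.castSucc) (fun t => h t.castSucc)
    rw [Fin.sum_univ_castSucc, ← Fin.succ_last]
    have := h (Fin.last r)
    simp only [Fin.castSucc_zero] at *
    omega

section Filtration

variable {A : Type*} [Ring A] {ι : Type*} {X : ι → Type*} [∀ i, AddCommGroup (X i)]
  [∀ i, Module A (X i)] {M : Type*} [AddCommGroup M] [Module A M]

theorem Filtration.exists_proj (𝓕 : Filtration (A := A) X M) (t : Fin 𝓕.r) :
    ∃ p : 𝓕.F t.succ →ₗ[A] X (𝓕.label t), Function.Surjective p ∧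
      ∀ x, p x = 0 ↔ x.1 ∈ 𝓕.F t.castSucc := by
  obtain ⟨φ⟩ := 𝓕.iso t
  refine ⟨φ.toLinearMap.comp (Submodule.mkQ _), φ.surjective.comp (Submodule.mkQ_surjective _),
    fun x => ?_⟩
  change φ (Submodule.mkQ _ x) = 0 ↔ _
  rw [LinearEquiv.map_eq_zero_iff]
  change Submodule.Quotient.mk x = _ ↔ _
  rw [Submodule.Quotient.mk_eq_zero]
  exact Iff.rfl

theorem Filtration.exists_step_mem (𝓕 : Filtration (A := A) X M) {x : M} (hx : x ≠ 0) :
    ∃ t : Fin 𝓕.r, x ∉ 𝓕.F t.castSucc ∧ x ∈ 𝓕.F t.succ := by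
  obtain ⟨t, h1, h2⟩ := fin_exists_step (fun t => x ∉ 𝓕.F t) (by rw [𝓕.bot]; simpa using hx)
    (by rw [𝓕.top]; simp)
  exact ⟨t, h1, not_not.1 h2⟩

theorem Filtration.isDetectedBy (𝓕 : Filtration (A := A) X M) {e : A}
    (h : ∀ t, IsDetectedBy e (X (𝓕.label t))) : IsDetectedBy e M := by
  intro x hx
  obtain ⟨t, h1, h2⟩ := 𝓕.exists_step_mem hx
  obtain ⟨p, -, hp⟩ := 𝓕.exists_proj t
  obtain ⟨a, ha⟩ := h t (p ⟨x, h2⟩) (fun h0 => h1 ((hp _).1 h0))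
  refine ⟨a, fun h0 => ha ?_⟩
  rw [← map_smul, (Subtype.ext h0 : (e * a) • (⟨x, h2⟩ : 𝓕.F t.succ) = 0), map_zero]

theorem Filtration.isGeneratedBy (𝓕 : Filtration (A := A) X M) {e : A} (he : IsIdempotentElem e)
    (h : ∀ t, IsGeneratedBy e (X (𝓕.label t))) : IsGeneratedBy e M := by
  have key : ∀ t, 𝓕.F t ≤ Submodule.span A {x : M | e • x = x} := by
    intro t
    induction t using Fin.induction with
    | zero => rw [𝓕.bot]; exact bot_le
    | succ t ih =>
      intro x hx
      obtain ⟨p, hps, hp⟩ := 𝓕.exists_proj t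
      have h1 : Submodule.span A {y : X (𝓕.label t) | e • y = y} ≤
          ((Submodule.span A {x : M | e • x = x}).submoduleOf (𝓕.F t.succ)).map p := by
        refine Submodule.span_le.2 fun y hy => ?_
        obtain ⟨z, rfl⟩ := hps y
        refine ⟨e • z, Submodule.subset_span ?_, ?_⟩
        · change e • e • z.1 = e • z.1
          rw [← mul_smul, he.eq]
        · rw [map_smul]; exact hy
      rw [show Submodule.span A {y : X (𝓕.label t) | e • y = y} = ⊤ from h t] at h1
      obtain ⟨z, hz, hzx⟩ := h1 (show p ⟨x, hx⟩ ∈ ⊤ from trivial)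
      have h2 : x - z.1 ∈ 𝓕.F t.castSucc := (hp (⟨x, hx⟩ - z)).1 (by
        rw [map_sub, hzx, sub_self])
      have h3 := Submodule.add_mem _ (ih h2) hz
      simpa using h3
  rw [IsGeneratedBy, eq_top_iff, ← 𝓕.top]
  exact key _

/-- A nonzero homomorphism to a filtered module, from a cyclic module, induces a nonzero
homomorphism to some subquotient. -/
theorem Filtration.exists_ne_zero_of_cyclic (𝓕 : Filtration (A := A) X M) {N : Type*}
    [AddCommGroup N] [Module A N] {g : N} (hg : Submodule.span A {g} = ⊤) (f : N →ₗ[A] M)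
    (hf : f ≠ 0) : ∃ (t : Fin 𝓕.r) (f' : N →ₗ[A] X (𝓕.label t)), f' ≠ 0 := by
  have hfg : f g ≠ 0 := by
    intro h0
    refine hf (LinearMap.ext fun x => ?_)
    obtain ⟨a, rfl⟩ := Submodule.mem_span_singleton.1 (show x ∈ Submodule.span A {g} by
      rw [hg]; trivial)
    rw [map_smul, h0, smul_zero, LinearMap.zero_apply]
  -- The filtration step at which f g first appears contains the whole image, because g generates N.
  obtain ⟨t, h1, h2⟩ := 𝓕.exists_step_mem hfg
  obtain ⟨p, -, hp⟩ := 𝓕.exists_proj t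
  have h3 : ∀ x, f x ∈ 𝓕.F t.succ := by
    intro x
    obtain ⟨a, rfl⟩ := Submodule.mem_span_singleton.1 (show x ∈ Submodule.span A {g} by
      rw [hg]; trivial)
    rw [map_smul]
    exact Submodule.smul_mem _ _ h2
  refine ⟨t, p.comp (f.codRestrict _ h3), fun h0 => h1 ?_⟩
  have := LinearMap.congr_fun h0 g
  exact (hp _).1 this

/-- A nonzero homomorphism from a filtered module induces a nonzero homomorphism from some
subquotient. -/
theorem Filtration.exists_ne_zero_of_ne_zero (𝓕 : Filtration (A := A) X M) {N : Type*}
    [AddCommGroup N] [Module A N] (f : M →ₗ[A] N) (hf : f ≠ 0) :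
    ∃ (t : Fin 𝓕.r) (f' : X (𝓕.label t) →ₗ[A] N), f' ≠ 0 := by
  obtain ⟨t, h1, h2⟩ := fin_exists_step (fun t => 𝓕.F t ≤ LinearMap.ker f)
    (by rw [𝓕.bot]; exact bot_le)
    (by rw [𝓕.top, top_le_iff, LinearMap.ker_eq_top]; exact hf)
  obtain ⟨p, hps, hp⟩ := 𝓕.exists_proj t
  obtain ⟨g, hg⟩ := exists_factor_of_surjective p hps (f.comp (𝓕.F t.succ).subtype)
    (fun x hx => h1 ((hp x).1 hx))
  refine ⟨t, g, fun h0 => h2 fun x hx => ?_⟩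
  have := hg ⟨x, hx⟩
  rw [h0] at this
  exact this.symm

variable (K : Type*) [Field K] [Algebra K A] [∀ i, Module K (X i)]
  [∀ i, IsScalarTower K A (X i)] [Module K M] [IsScalarTower K A M]

theorem edim_step [Module.Finite K M] {e : A} (he : IsIdempotentElem e) {N N' : Submodule A M}
    (h : N ≤ N') {Q : Type*} [AddCommGroup Q] [Module A Q] [Module K Q] [IsScalarTower K A Q]
    (p : N' →ₗ[A] Q) (hps : Function.Surjective p) (hp : ∀ x, p x = 0 ↔ x.1 ∈ N) :
    edim K e N' = edim K e N + edim K e Q := by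
  rw [edim_add K he (LinearMap.ker p),
    edim_eq_of_equiv K e (LinearMap.quotKerEquivOfSurjective p hps)]
  have : LinearMap.ker p = N.submoduleOf N' := by
    ext x
    rw [LinearMap.mem_ker, hp]
    exact Iff.rfl
  rw [this, edim_eq_of_equiv K e (Submodule.submoduleOfEquivOfLe h)]

theorem Filtration.edim_eq [Module.Finite K M] (𝓕 : Filtration (A := A) X M) {e : A}
    (he : IsIdempotentElem e) : edim K e M = ∑ t, edim K e (X (𝓕.label t)) := by
  have := fin_telescope (fun t => edim K e (𝓕.F t)) (fun t => edim K e (X (𝓕.label t)))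
    (fun t => by
      obtain ⟨p, hps, hp⟩ := 𝓕.exists_proj t
      exact edim_step K he (𝓕.mono t) p hps hp)
  rw [congrArg (fun N : Submodule A M => edim K e N) 𝓕.top,
    congrArg (fun N : Submodule A M => edim K e N) 𝓕.bot] at this
  rw [← edim_eq_of_equiv K e (Submodule.topEquiv : (⊤ : Submodule A M) ≃ₗ[A] M), this,
    (edim_eq_zero_iff K e).2 (fun x => Subsingleton.elim _ _), zero_add]

/-- The number of occurrences of a label in a filtration. -/
def Filtration.count (𝓕 : Filtration (A := A) X M) (j : ι) : ℕ :=
  Nat.card {t : Fin 𝓕.r // 𝓕.label t = j}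

theorem Filtration.sum_label [Fintype ι] (𝓕 : Filtration (A := A) X M) (f : ι → ℕ) :
    ∑ t, f (𝓕.label t) = ∑ j, 𝓕.count j * f j := by
  classical
  rw [← Finset.sum_fiberwise' Finset.univ 𝓕.label f]
  refine Finset.sum_congr rfl fun j _ => ?_
  rw [Finset.sum_const, smul_eq_mul, Filtration.count, Nat.card_eq_fintype_card,
    Fintype.card_subtype]

theorem Filtration.count_ne_zero_iff (𝓕 : Filtration (A := A) X M) (j : ι) :
    𝓕.count j ≠ 0 ↔ ∃ t, 𝓕.label t = j := by
  rw [Filtration.count, Nat.card_ne_zero, nonempty_subtype]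
  exact and_iff_left inferInstance

theorem Filtration.edim_eq' [Fintype ι] [Module.Finite K M] (𝓕 : Filtration (A := A) X M) {e : A}
    (he : IsIdempotentElem e) : edim K e M = ∑ j, 𝓕.count j * edim K e (X j) := by
  rw [𝓕.edim_eq K he, 𝓕.sum_label (fun j => edim K e (X j))]

/-- A quotient of a filtered module in which some of the subquotients die. -/
theorem Filtration.edim_quotient_le [Module.Finite K M] (𝓕 : Filtration (A := A) X M) {e : A}
    (he : IsIdempotentElem e) (U : Submodule A M) (s : Fin 𝓕.r → Prop) [DecidablePred s]
    (h : ∀ t, ¬ s t → 𝓕.F t.succ ≤ 𝓕.F t.castSucc ⊔ U) :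
    edim K e (M ⧸ U) ≤ ∑ t, if s t then edim K e (X (𝓕.label t)) else 0 := by
  -- The images of the F t filter M / U. Step t of this filtration is a quotient of X (label t), and
  -- it collapses when `¬ s t`.
  have := fin_telescope_le (fun t => edim K e ((𝓕.F t).map U.mkQ))
    (fun t => if s t then edim K e (X (𝓕.label t)) else 0) (fun t => by
      obtain ⟨p, hps, hp⟩ := 𝓕.exists_proj t
      have hle : (𝓕.F t.castSucc).map U.mkQ ≤ (𝓕.F t.succ).map U.mkQ :=
        Submodule.map_mono (𝓕.mono t)
      by_cases hs : s t
      · simp only [hs, if_true]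
        have h1 := edim_step (K := K) he hle
          (Submodule.mkQ (((𝓕.F t.castSucc).map U.mkQ).submoduleOf ((𝓕.F t.succ).map U.mkQ)))
          (Submodule.mkQ_surjective _) (fun x => by
            change Submodule.Quotient.mk x = _ ↔ _
            rw [Submodule.Quotient.mk_eq_zero]
            exact Iff.rfl)
        rw [h1]
        refine Nat.add_le_add_left ?_ _
        let q : 𝓕.F t.succ →ₗ[A] ((𝓕.F t.succ).map U.mkQ) :=
          (U.mkQ.comp (𝓕.F t.succ).subtype).codRestrict _
            (fun x => Submodule.mem_map_of_mem x.2)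
        obtain ⟨g, hg⟩ := exists_factor_of_surjective p hps ((Submodule.mkQ
          (((𝓕.F t.castSucc).map U.mkQ).submoduleOf ((𝓕.F t.succ).map U.mkQ))).comp q)
          (fun x hx => (Submodule.Quotient.mk_eq_zero _).2
            (Submodule.mem_map_of_mem ((hp x).1 hx)))
        have : Module.Finite K (X (𝓕.label t)) :=
          Module.Finite.of_surjective (p.restrictScalars K) hps
        refine edim_le_of_surjective K he g fun y => ?_
        obtain ⟨⟨y, z, hz, rfl⟩, rfl⟩ := Submodule.mkQ_surjective _ y
        exact ⟨p ⟨z, hz⟩, hg ⟨z, hz⟩⟩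
      · simp only [hs, if_false, add_zero]
        refine edim_le_of_injective K he (Submodule.inclusion ?_) (Submodule.inclusion_injective _)
        refine (Submodule.map_mono (h t hs)).trans ?_
        rw [Submodule.map_sup, sup_le_iff]
        refine ⟨le_rfl, ?_⟩
        rintro _ ⟨x, hx, rfl⟩
        rw [show U.mkQ x = 0 from (Submodule.Quotient.mk_eq_zero U).2 hx]
        exact Submodule.zero_mem _)
  rw [congrArg (fun N : Submodule A M => edim K e (N.map U.mkQ)) 𝓕.top,
    congrArg (fun N : Submodule A M => edim K e (N.map U.mkQ)) 𝓕.bot] at this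
  have hbot : edim K e ((⊥ : Submodule A M).map U.mkQ) = 0 :=
    (edim_eq_zero_iff K e).2 fun x => by
      obtain ⟨y, hy, hyx⟩ := x.2
      have h0 : x = 0 := Subtype.ext (by
        rw [← hyx, (Submodule.mem_bot A).1 hy, map_zero]; rfl)
      rw [h0, smul_zero]
  rw [hbot, zero_add] at this
  refine le_trans (le_of_eq ?_) this
  rw [congrArg (fun N : Submodule A (M ⧸ U) => edim K e N)
    ((Submodule.map_top U.mkQ).trans (Submodule.range_mkQ U))]
  exact (edim_eq_of_equiv K e Submodule.topEquiv).symm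

end Filtration

/-! ### Local modules and primitive idempotents -/

section Local

variable {A : Type*} [Ring A] {M M' : Type*} [AddCommGroup M] [Module A M] [AddCommGroup M']
  [Module A M']

theorem IsLocalMod.exists_coatom [Module.Finite A M] (h : IsLocalMod A M) :
    ∃ J : Submodule A M, IsCoatom J ∧ ∀ N : Submodule A M, N ≠ ⊤ → N ≤ J := by
  obtain ⟨J, hJ, hu⟩ := h
  refine ⟨J, hJ, fun N hN => ?_⟩
  obtain ⟨J', hJ', hle⟩ := (eq_top_or_exists_le_coatom N).resolve_left hN
  exact hu J' hJ' ▸ hle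

theorem IsLocalMod.of_surjective [Module.Finite A M'] [Nontrivial M'] (h : IsLocalMod A M)
    (f : M →ₗ[A] M') (hf : Function.Surjective f) : IsLocalMod A M' := by
  obtain ⟨J, hJ, hu⟩ := h
  obtain ⟨N, hN, -⟩ := (eq_top_or_exists_le_coatom (⊥ : Submodule A M')).resolve_left bot_ne_top
  refine ⟨N, hN, fun N' hN' => Submodule.comap_injective_of_surjective hf ?_⟩
  rw [hu _ ((Submodule.isCoatom_comap_iff hf).2 hN), hu _ ((Submodule.isCoatom_comap_iff hf).2 hN')]

theorem IsLocalMod.jacobson_eq {J : Submodule A M} (h : IsLocalMod A M) (hJ : IsCoatom J) :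
    Module.jacobson A M = J := by
  refine le_antisymm (sInf_le hJ) (le_sInf fun N hN => ?_)
  exact (h.unique hJ hN).le

theorem isCoatom_ker_of_isSimpleModule [IsSimpleModule A M'] (f : M →ₗ[A] M') (hf : f ≠ 0) :
    IsCoatom (LinearMap.ker f) := by
  rw [← isSimpleModule_iff_isCoatom]
  exact IsSimpleModule.congr
    (LinearMap.quotKerEquivOfSurjective f (LinearMap.surjective_of_ne_zero hf))

theorem IsLocalMod.top_equiv [IsSimpleModule A M'] (h : IsLocalMod A M) (f : M →ₗ[A] M')
    (hf : f ≠ 0) : Nonempty (Top A M ≃ₗ[A] M') := by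
  have := h.jacobson_eq (isCoatom_ker_of_isSimpleModule f hf)
  exact ⟨(Submodule.quotEquivOfEq _ _ this).trans
    (LinearMap.quotKerEquivOfSurjective f (LinearMap.surjective_of_ne_zero hf))⟩

theorem IsLocalMod.isSimpleModule_top (h : IsLocalMod A M) : IsSimpleModule A (Top A M) := by
  obtain ⟨J, hJ, -⟩ := id h
  rw [isSimpleModule_iff_isCoatom, h.jacobson_eq hJ]
  exact hJ

theorem isLocalMod_of_isSimpleModule_top (h : IsSimpleModule A (Top A M)) : IsLocalMod A M := by
  rw [isSimpleModule_iff_isCoatom] at h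
  refine ⟨_, h, fun N hN => ?_⟩
  have hle : Module.jacobson A M ≤ N := sInf_le hN
  by_contra hne
  exact hN.1 (h.2 N (lt_of_le_of_ne hle (Ne.symm hne)))

/-- A local module generated by `e M` is generated by one element of `e M`. -/
theorem IsLocalMod.exists_generator [Module.Finite A M] {e : A} (h : IsLocalMod A M)
    (hg : IsGeneratedBy e M) : ∃ x : M, e • x = x ∧ Submodule.span A {x} = ⊤ := by
  obtain ⟨J, hJ, hu⟩ := h.exists_coatom
  by_contra! hcon
  refine hJ.1 (top_le_iff.1 ?_)
  rw [← show Submodule.span A {x : M | e • x = x} = ⊤ from hg, Submodule.span_le]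
  intro x hx
  exact hu _ (hcon x hx) (Submodule.mem_span_singleton_self x)

end Local

section Primitive

variable (K : Type*) [Field K] {A : Type*} [Ring A] [Algebra K A]

/-- Fitting's lemma: M is the direct sum of the kernel and the range of a high power of f. -/
theorem bijective_or_nilpotent {M : Type*} [AddCommGroup M] [Module K M] [Module A M]
    [IsScalarTower K A M] [Module.Finite K M] (h : IsIndecomposable A M) (f : Module.End A M) :
    Function.Bijective f ∨ IsNilpotent f := by
  have : IsNoetherian A M := isNoetherian_of_tower K inferInstance
  have : IsArtinian A M := isArtinian_of_tower K inferInstance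
  obtain ⟨k, hk⟩ := Filter.eventually_atTop.1 f.eventually_isCompl_ker_pow_range_pow
  have hc := hk (k + 1) (Nat.le_succ k)
  rcases h.2 _ _ hc with h0 | h0
  · left
    have hr : LinearMap.range (f ^ (k + 1)) = ⊤ := by
      have := hc.sup_eq_top
      rwa [h0, bot_sup_eq] at this
    rw [LinearMap.ker_eq_bot] at h0
    rw [LinearMap.range_eq_top] at hr
    constructor
    · rw [pow_succ, Module.End.mul_eq_comp, LinearMap.coe_comp] at h0
      exact h0.of_comp
    · rw [pow_succ', Module.End.mul_eq_comp, LinearMap.coe_comp] at hr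
      exact hr.of_comp
  · right
    exact ⟨k + 1, LinearMap.range_eq_bot.1 h0⟩

variable {K} {e f : A} {M : Type*} [AddCommGroup M] [Module A M]

theorem mul_eq_of_mem_span (he : IsIdempotentElem e) {x : A} (hx : x ∈ Submodule.span A {e}) :
    x * e = x := by
  obtain ⟨a, rfl⟩ := Submodule.mem_span_singleton.1 hx
  rw [smul_eq_mul, mul_assoc, he.eq]

/-- The homomorphism `A e → M` which sends `e` to `e y`. -/
def projMap (e : A) (y : M) : Submodule.span A {e} →ₗ[A] M :=
  (LinearMap.toSpanSingleton A M y).comp (Submodule.span A {e}).subtype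

theorem projMap_apply (y : M) (x : Submodule.span A {e}) : projMap e y x = x.1 • y := rfl

theorem span_gen (e : A) : Submodule.span A
    {(⟨e, Submodule.mem_span_singleton_self e⟩ : Submodule.span A {e})} = ⊤ := by
  rw [eq_top_iff]
  rintro ⟨x, hx⟩ -
  obtain ⟨a, rfl⟩ := Submodule.mem_span_singleton.1 hx
  exact Submodule.mem_span_singleton.2 ⟨a, rfl⟩

theorem projMap_range {y : M} (hy : e • y = y) :
    LinearMap.range (projMap e y) = Submodule.span A {y} := by
  rw [LinearMap.range_eq_map, ← span_gen e, Submodule.map_span, Set.image_singleton,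
    projMap_apply, hy]

variable (K)

/-- With two distinct maximal submodules, e = n + n' splits the identity of Ae into right
multiplications by n and n'. Neither is onto, so by Fitting both are nilpotent, whereas 1 minus a
nilpotent is a unit. -/
theorem isLocalMod_of_indecomposable [Module.Finite K A] (he : IsIdempotentElem e)
    (h : IsIndecomposable A (Submodule.span A {e})) : IsLocalMod A (Submodule.span A {e}) := by
  have : Module.Finite A (Submodule.span A {e}) := Module.Finite.of_restrictScalars_finite K A _
  have := h.1
  obtain ⟨N, hN, -⟩ := (eq_top_or_exists_le_coatom
    (⊥ : Submodule A (Submodule.span A {e}))).resolve_left bot_ne_top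
  refine ⟨N, hN, fun N' hN' => ?_⟩
  by_contra hne
  have hsup : N ⊔ N' = ⊤ := hN.2 _ (lt_of_le_of_ne le_sup_left fun h0 => by
    rw [left_eq_sup] at h0
    rcases lt_or_eq_of_le h0 with h1 | h1
    · exact hN.1 (hN'.2 _ h1)
    · exact hne h1)
  obtain ⟨n, hn, n', hn', hsum⟩ := Submodule.mem_sup.1 (hsup ▸ Submodule.mem_top :
    (⟨e, Submodule.mem_span_singleton_self e⟩ : Submodule.span A {e}) ∈ N ⊔ N')
  have hsum1 : projMap e n + projMap e n' = (1 : Module.End A (Submodule.span A {e})) := by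
    refine LinearMap.ext fun x => ?_
    rw [LinearMap.add_apply, projMap_apply, projMap_apply, ← smul_add, hsum]
    exact Subtype.ext (mul_eq_of_mem_span he x.2)
  have hnil : ∀ (N : Submodule A (Submodule.span A {e})), IsCoatom N → ∀ n ∈ N,
      IsNilpotent (show Module.End A (Submodule.span A {e}) from projMap e n) := by
    intro N hN n hn
    refine (bijective_or_nilpotent K h _).resolve_left fun hb => hN.1 ?_
    rw [eq_top_iff]
    rintro x -
    obtain ⟨y, rfl⟩ := hb.2 x
    exact N.smul_mem _ hn
  have h1 := hnil N hN n hn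
  have h2 := hnil N' hN' n' hn'
  have h3 : IsUnit (show Module.End A (Submodule.span A {e}) from projMap e n') := by
    rw [show (show Module.End A (Submodule.span A {e}) from projMap e n') =
      1 - (show Module.End A (Submodule.span A {e}) from projMap e n) from
      eq_sub_of_add_eq' hsum1]
    exact h1.isUnit_one_sub
  have : Nontrivial (Module.End A (Submodule.span A {e})) := inferInstance
  obtain ⟨k, hk⟩ := h2
  have := h3.pow k
  rw [hk] at this
  exact not_isUnit_zero this

theorem top_equiv_of_smul_ne_zero [Module.Finite K A] (he : IsIdempotentElem e)
    (h : IsIndecomposable A (Submodule.span A {e})) [IsSimpleModule A M] {x : M}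
    (hx : e • x ≠ 0) : Nonempty (Top A (Submodule.span A {e}) ≃ₗ[A] M) :=
  (isLocalMod_of_indecomposable K he h).top_equiv (projMap e x) fun h0 => hx
    (LinearMap.congr_fun h0 ⟨e, Submodule.mem_span_singleton_self e⟩)

/-- Both modules are projective covers of the same simple module. Elements a, b of A exchanging ex
and fy give maps between Ae and Af whose composites preserve evaluation at a nonzero vector. The
composites are therefore not nilpotent, so they are bijective. -/
theorem projective_equiv_of_simple [Module.Finite K A] (he : IsIdempotentElem e)
    (hf : IsIdempotentElem f) (hpe : IsIndecomposable A (Submodule.span A {e}))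
    (hpf : IsIndecomposable A (Submodule.span A {f})) [IsSimpleModule A M] {x y : M}
    (hx : e • x ≠ 0) (hy : f • y ≠ 0) :
    Nonempty (Submodule.span A {e} ≃ₗ[A] Submodule.span A {f}) := by
  have key : ∀ e' f' : A, IsIdempotentElem e' → IsIdempotentElem f' →
      IsIndecomposable A (Submodule.span A {e'}) → ∀ (a b : A) (x' y' : M), e' • x' = x' →
      f' • y' = y' → x' ≠ 0 → a • x' = y' → b • y' = x' →
      ∀ (ha : f' * a * e' ∈ Submodule.span A {e'}) (hb : e' * b * f' ∈ Submodule.span A {f'}),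
      Function.Bijective ((projMap f' (⟨f' * a * e', ha⟩ : Submodule.span A {e'})).comp
        (projMap e' (⟨e' * b * f', hb⟩ : Submodule.span A {f'}))) := by
    intro e' f' he' hf' hp a b x' y' hx hy hx0 hab hba ha hb
    set ψ : Module.End A (Submodule.span A {e'}) :=
      (projMap f' (⟨f' * a * e', ha⟩ : Submodule.span A {e'})).comp
        (projMap e' (⟨e' * b * f', hb⟩ : Submodule.span A {f'})) with hψ
    refine (bijective_or_nilpotent K hp ψ).resolve_right ?_
    rintro ⟨k, hk⟩
    have hev : ∀ z, projMap e' x' (ψ z) = projMap e' x' z := by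
      intro z
      change ((z.1 * (e' * b * f')) * (f' * a * e')) • x' = z.1 • x'
      simp only [mul_smul, hx, hab, hy, hba]
    have hev' : ∀ k z, projMap e' x' ((ψ ^ k) z) = projMap e' x' z := by
      intro k
      induction k with
      | zero => intro z; rfl
      | succ k ih => intro z; rw [pow_succ', Module.End.mul_apply, hev, ih]
    have := hev' k ⟨e', Submodule.mem_span_singleton_self e'⟩
    rw [hk, LinearMap.zero_apply, map_zero, projMap_apply, hx] at this
    exact hx0 this.symm
  have hx1 : e • e • x = e • x := by rw [← mul_smul, he.eq]
  have hy1 : f • f • y = f • y := by rw [← mul_smul, hf.eq]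
  obtain ⟨a, ha⟩ := (IsSimpleModule.toSpanSingleton_surjective A hx) (f • y)
  obtain ⟨b, hb⟩ := (IsSimpleModule.toSpanSingleton_surjective A hy) (e • x)
  have hae : f * a * e ∈ Submodule.span A {e} := Submodule.mem_span_singleton.2 ⟨f * a, rfl⟩
  have hbf : e * b * f ∈ Submodule.span A {f} := Submodule.mem_span_singleton.2 ⟨e * b, rfl⟩
  have h1 := key e f he hf hpe a b (e • x) (f • y) hx1 hy1 hx ha hb hae hbf
  have h2 := key f e hf he hpf b a (f • y) (e • x) hy1 hx1 hy hb ha hbf hae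
  rw [LinearMap.coe_comp] at h1 h2
  exact ⟨LinearEquiv.ofBijective _ ⟨h1.1.of_comp, h2.2.of_comp⟩⟩

end Primitive

/-! ### The injective modules `I(i)` -/

section Injective

variable (K : Type*) [Field K] {A : Type*} [Ring A] [Algebra K A] {ι : Type*} {e : ι → A}

instance [Module.Finite K A] : Module.Finite K (KDual K A) :=
  inferInstanceAs (Module.Finite K (A →ₗ[K] K))

variable {K} {M : Type*} [AddCommGroup M] [Module K M] [Module A M] [IsScalarTower K A M]

/-- The homomorphism `M → I(i)` given by a linear form on `M`. -/
def toI {i : ι} (he : IsIdempotentElem (e i)) (ψ : M →ₗ[K] K) : M →ₗ[A] I K e i where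
  toFun m := ⟨show A →ₗ[K] K from
    ψ ∘ₗ ((LinearMap.toSpanSingleton A M m).restrictScalars K ∘ₗ LinearMap.mulLeft K (e i)),
    fun x => by
      change ψ ((e i * x) • m) = ψ ((e i * (e i * x)) • m)
      rw [← mul_assoc, he.eq]⟩
  map_add' m m' := Subtype.ext (KDual.ext fun x => by
    change ψ ((e i * x) • (m + m')) = ψ ((e i * x) • m) + ψ ((e i * x) • m')
    rw [smul_add, map_add])
  map_smul' a m := Subtype.ext (KDual.ext fun x => by
    change ψ ((e i * x) • a • m) = ψ ((e i * (x * a)) • m)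
    rw [← mul_smul, mul_assoc])

theorem toI_apply {i : ι} (he : IsIdempotentElem (e i)) (ψ : M →ₗ[K] K) (m : M) (a : A) :
    (toI he ψ m).1 a = ψ ((e i * a) • m) := rfl

-- A map M → I(i) is determined by the linear form m ↦ (f m)(1) on e_i M; this is Hom_A(M, I(i)) =
-- D(e_i M).
omit [Module K M] [IsScalarTower K A M] in
theorem I_apply {i : ι} (f : M →ₗ[A] I K e i) (m : M) (a : A) :
    (f m).1 a = (f ((e i * a) • m)).1 1 := by
  rw [map_smul]
  change _ = (f m).1 (1 * (e i * a))
  rw [one_mul]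
  exact (f m).2 a

/-- The linear form on `M` corresponding to a homomorphism `M → I(i)`. -/
def formOfI {i : ι} (f : M →ₗ[A] I K e i) : M →ₗ[K] K where
  toFun m := (f m).1 1
  map_add' m m' := by rw [map_add]; rfl
  map_smul' c m := by
    rw [← algebraMap_smul A c m, map_smul, algebraMap_smul]
    rfl

/-- Injectivity of I(i): as maps into I(i) are linear forms, a K-linear retraction of g suffices to
extend them. -/
theorem I_extend {i : ι} (he : IsIdempotentElem (e i)) {N : Type*} [AddCommGroup N] [Module K N]
    [Module A N] [IsScalarTower K A N] (g : N →ₗ[A] M) (hg : Function.Injective g)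
    (f : N →ₗ[A] I K e i) : ∃ F : M →ₗ[A] I K e i, ∀ n, F (g n) = f n := by
  obtain ⟨s, hs⟩ := LinearMap.exists_leftInverse_of_injective (g.restrictScalars K)
    (LinearMap.ker_eq_bot.2 hg)
  refine ⟨toI he (formOfI f ∘ₗ s), fun n => Subtype.ext (KDual.ext fun a => ?_)⟩
  rw [toI_apply, I_apply f]
  change (f (s ((e i * a) • g n))).1 1 = _
  rw [← map_smul g]
  have : s (g ((e i * a) • n)) = (e i * a) • n := LinearMap.congr_fun hs _
  rw [this]

theorem I_isDetectedBy (i : ι) : IsDetectedBy (e i) (I K e i) := by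
  intro f hf
  by_contra! h
  refine hf (Subtype.ext (KDual.ext fun a => ?_))
  have h1 := congrArg (fun g : I K e i => g.1 1) (h a)
  change f.1 (1 * (e i * a)) = 0 at h1
  rw [one_mul] at h1
  rw [f.2 a, h1]
  rfl

theorem exists_toI_ne_zero {i : ι} (he : IsIdempotentElem (e i)) {m : M} (hm : e i • m ≠ 0) :
    ∃ f : M →ₗ[A] I K e i, f m ≠ 0 := by
  obtain ⟨ψ, hψ⟩ := Module.Projective.exists_dual_ne_zero K hm
  refine ⟨toI he ψ, fun h0 => hψ ?_⟩
  have h1 : (toI he ψ m).1 1 = 0 := by rw [h0]; rfl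
  rwa [toI_apply, mul_one] at h1

end Injective

/-! ### Standard and costandard modules -/

section Std

variable (K : Type*) [Field K] {A : Type*} [Ring A] [Algebra K A] {ι : Type*}
  {e : ι → A}

/-- The generator `e_i` of `P(i)`. -/
def projGen (e : ι → A) (i : ι) : P e i := ⟨e i, Submodule.mem_span_singleton_self (e i)⟩

theorem span_projGen (i : ι) : Submodule.span A {projGen e i} = ⊤ := span_gen (e i)

theorem smul_projGen {i : ι} (he : IsIdempotentElem (e i)) (x : P e i) : x.1 • projGen e i = x :=
  Subtype.ext (mul_eq_of_mem_span he x.2)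

variable [PartialOrder ι] [Module.Finite K A]

theorem jh_quotient_eq_zero_iff {M : Type*} [AddCommGroup M] [Module K M] [Module A M]
    [IsScalarTower K A M] [Module.Finite K M] (U : Submodule A M) (j : ι) :
    jh K e (M ⧸ U) j = 0 ↔ ∀ x : M, e j • x ∈ U := by
  rw [jh_eq_edim, edim_eq_zero_iff]
  constructor
  · intro h x
    exact (Submodule.Quotient.mk_eq_zero U).1 (h (Submodule.Quotient.mk x))
  · intro h x
    obtain ⟨x, rfl⟩ := U.mkQ_surjective x
    exact (Submodule.Quotient.mk_eq_zero U).2 (h x)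

/-- Explicit generators of the kernel, from which the universal property of Δ(i) in `exists_std_map`
follows. -/
theorem stdKer_eq (i : ι) :
    stdKer K e i = Submodule.span A {y | ∃ l, ¬ l ≤ i ∧ ∃ x : P e i, y = e l • x} := by
  apply le_antisymm
  · refine sInf_le fun j hj => ?_
    rw [jh_quotient_eq_zero_iff]
    exact fun x => Submodule.subset_span ⟨j, hj, x, rfl⟩
  · refine le_sInf fun U hU => Submodule.span_le.2 ?_
    rintro _ ⟨l, hl, x, rfl⟩
    exact (jh_quotient_eq_zero_iff K U l).1 (hU l hl) x

theorem smul_mem_stdKer {i l : ι} (hl : ¬ l ≤ i) (x : P e i) : e l • x ∈ stdKer K e i := by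
  rw [stdKer_eq]
  exact Submodule.subset_span ⟨l, hl, x, rfl⟩

/-- The canonical generator of `Δ(i)`. -/
def stdGen (e : ι → A) (i : ι) : Std K e i := (stdKer K e i).mkQ (projGen e i)

theorem span_stdGen (i : ι) : Submodule.span A {stdGen K e i} = ⊤ := by
  rw [stdGen, ← Set.image_singleton, ← Submodule.map_span, span_projGen, Submodule.map_top,
    Submodule.range_mkQ]

theorem smul_stdGen {i : ι} (he : IsIdempotentElem (e i)) :
    e i • stdGen K e i = stdGen K e i := by
  rw [stdGen, ← map_smul]
  exact congrArg _ (Subtype.ext he)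

theorem mk_eq_smul_stdGen {i : ι} (he : IsIdempotentElem (e i)) (x : P e i) :
    (stdKer K e i).mkQ x = x.1 • stdGen K e i := by
  rw [stdGen, ← map_smul, smul_projGen he]

theorem std_smul_eq_zero {i l : ι} (hl : ¬ l ≤ i) (x : Std K e i) : e l • x = 0 := by
  obtain ⟨x, rfl⟩ := Submodule.mkQ_surjective _ x
  rw [← map_smul]
  exact (Submodule.Quotient.mk_eq_zero _).2 (smul_mem_stdKer K hl x)

theorem exists_std_map {i : ι} {M : Type*} [AddCommGroup M] [Module A M] {y : M}
    (hy : e i • y = y) (h : ∀ l, ¬ l ≤ i → ∀ a : A, e l • a • y = 0) :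
    ∃ f : Std K e i →ₗ[A] M, f (stdGen K e i) = y := by
  refine ⟨(stdKer K e i).liftQ (projMap (e i) y) ?_, ?_⟩
  · rw [stdKer_eq, Submodule.span_le]
    rintro _ ⟨l, hl, x, rfl⟩
    change (e l * x.1) • y = 0
    rw [mul_smul, h l hl]
  · exact (Submodule.liftQ_apply _ _ _).trans hy

theorem std_map_ne_zero {i : ι} {M : Type*} [AddCommGroup M] [Module A M]
    {f : Std K e i →ₗ[A] M} (hf : f ≠ 0) : f (stdGen K e i) ≠ 0 := by
  intro h0
  refine hf (LinearMap.ext fun x => ?_)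
  obtain ⟨a, rfl⟩ := Submodule.mem_span_singleton.1
    (show x ∈ Submodule.span A {stdGen K e i} by rw [span_stdGen]; trivial)
  rw [map_smul, h0, smul_zero, LinearMap.zero_apply]

theorem mem_costd {i : ι} {f : I K e i} :
    f ∈ Costd K e i ↔ ∀ l, ¬ l ≤ i → ∀ a : A, e l • a • f = 0 := by
  constructor
  · intro hf
    let V : Submodule A (I K e i) :=
      { carrier := {f | ∀ l, ¬ l ≤ i → ∀ a : A, e l • a • f = 0}
        zero_mem' := fun l _ a => by rw [smul_zero, smul_zero]
        add_mem' := fun {x y} hx hy l hl a => by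
          rw [smul_add, smul_add, hx l hl, hy l hl, add_zero]
        smul_mem' := fun c x hx l hl a => by rw [← mul_smul a c x, hx l hl] }
    have : Costd K e i ≤ V := by
      refine sSup_le fun N hN f hf l hl a => ?_
      exact congrArg Subtype.val
        ((edim_eq_zero_iff K (e l)).1 (hN l hl) (a • (⟨f, hf⟩ : N)))
    exact this hf
  · intro hf
    have hle : Submodule.span A {f} ≤ Costd K e i := by
      refine le_sSup fun l hl => (edim_eq_zero_iff K (e l)).2 ?_
      rintro ⟨x, hx⟩
      obtain ⟨a, rfl⟩ := Submodule.mem_span_singleton.1 hx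
      exact Subtype.ext (hf l hl a)
    exact hle (Submodule.mem_span_singleton_self f)

theorem costd_smul_eq_zero {i l : ι} (hl : ¬ l ≤ i) (x : Costd K e i) : e l • x = 0 := by
  have := (mem_costd K).1 x.2 l hl 1
  rw [one_smul] at this
  exact Subtype.ext this

theorem exists_costd_map {i : ι} {M : Type*} [AddCommGroup M] [Module A M]
    (f : M →ₗ[A] I K e i) (h : ∀ l, ¬ l ≤ i → ∀ x : M, e l • f x = 0) :
    ∃ g : M →ₗ[A] Costd K e i, ∀ x, (g x).1 = f x :=
  ⟨f.codRestrict _ fun x => (mem_costd K).2 fun l hl a => by rw [← map_smul]; exact h l hl _,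
    fun _ => rfl⟩

theorem costd_isDetectedBy (i : ι) : IsDetectedBy (e i) (Costd K e i) :=
  (I_isDetectedBy i).of_injective (Costd K e i).subtype (Submodule.injective_subtype _)

/-- The image of the generator lies in e_i ∇(j), so i ≤ j. It generates a submodule that meets e_j
∇(j), the socle part, and this comes from e_j Δ(i), so j ≤ i. -/
theorem eq_of_std_costd_map {i j : ι} (he : IsIdempotentElem (e i))
    {f : Std K e i →ₗ[A] Costd K e j} (hf : f ≠ 0) : i = j := by
  have h0 := std_map_ne_zero K hf
  have h1 : e i • f (stdGen K e i) = f (stdGen K e i) := by rw [← map_smul, smul_stdGen K he]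
  have hij : i ≤ j := by
    by_contra h
    exact h0 (by rw [← h1, costd_smul_eq_zero K h])
  obtain ⟨a, ha⟩ := costd_isDetectedBy K j _ h0
  rw [← map_smul, mul_smul] at ha
  refine le_antisymm hij ?_
  by_contra h
  exact ha (by rw [std_smul_eq_zero K h, map_zero])

end Std

/-! ### Quasi-hereditary algebras -/

section QuasiHereditary

variable {K : Type*} [Field K] {A : Type*} [Ring A] [Algebra K A] [Module.Finite K A] {ι : Type*}
  [Fintype ι] [PartialOrder ι] {e : ι → A}

theorem IsBasic.idem (h : IsBasic K e) (i : ι) : IsIdempotentElem (e i) := h.complete.idem i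

theorem IsBasic.sum_smul (h : IsBasic K e) {M : Type*} [AddCommGroup M] [Module A M] (x : M) :
    ∑ i, e i • x = x := by
  rw [← Finset.sum_smul, h.complete.complete, one_smul]

theorem jh_std_eq_zero {i j : ι} (h : ¬ j ≤ i) : edim K (e j) (Std K e i) = 0 :=
  (edim_eq_zero_iff K _).2 (std_smul_eq_zero K h)

/-- Take m maximal among the labels with different counts and compare dim e_m M: only Δ(x) with x ≥
m contribute, and Δ(m) contributes 1. -/
theorem Filtration.count_unique (hA : IsQuasiHereditary K e) {M : Type*} [AddCommGroup M]
    [Module K M] [Module A M] [IsScalarTower K A M] [Module.Finite K M]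
    (𝓕 𝓖 : Filtration (A := A) (Std K e) M) (j : ι) : 𝓕.count j = 𝓖.count j := by
  classical
  by_contra hne
  obtain ⟨m, hm⟩ := (Set.toFinite {j | 𝓕.count j ≠ 𝓖.count j}).exists_maximal ⟨j, hne⟩
  have h1 := (𝓕.edim_eq' K (hA.idem m)).symm.trans (𝓖.edim_eq' K (hA.idem m))
  rw [← Finset.add_sum_erase _ _ (Finset.mem_univ m), ← Finset.add_sum_erase _ _
    (Finset.mem_univ m)] at h1
  have h2 : ∑ x ∈ Finset.univ.erase m, 𝓕.count x * edim K (e m) (Std K e x) =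
      ∑ x ∈ Finset.univ.erase m, 𝓖.count x * edim K (e m) (Std K e x) := by
    refine Finset.sum_congr rfl fun x hx => ?_
    by_cases hmx : m ≤ x
    · congr 1
      by_contra hcon
      exact Finset.ne_of_mem_erase hx (le_antisymm (hm.2 hcon hmx) hmx)
    · rw [jh_std_eq_zero hmx, mul_zero, mul_zero]
  rw [h2, show edim K (e m) (Std K e m) = 1 from hA.std_self m] at h1
  have := hm.1
  simp only [Set.mem_ofPred_eq] at this
  omega

theorem count_proj_eq_zero (hA : IsQuasiHereditary K e) {i j : ι} (h : ¬ i ≤ j)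
    (𝓕 : Filtration (A := A) (Std K e) (P e i)) : 𝓕.count j = 0 := by
  obtain ⟨𝓖, h𝓖⟩ := hA.mult_zero i j h
  rw [𝓕.count_unique hA 𝓖]
  exact h𝓖

theorem le_label_proj (hA : IsQuasiHereditary K e) {i : ι}
    (𝓕 : Filtration (A := A) (Std K e) (P e i)) (t : Fin 𝓕.r) : i ≤ 𝓕.label t := by
  by_contra h
  exact (𝓕.count_ne_zero_iff _).2 ⟨t, rfl⟩ (count_proj_eq_zero hA h 𝓕)

/-- By definition the kernel of P(i) → Δ(i) is generated by the e_l P(i) with l ≰ i. The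
Δ-filtration of P(i), whose labels are all ≥ i, shows that those with l > i suffice: a factor Δ(i)
is killed by e_l, and a factor Δ(l) with l > i is generated by e_l. The vanishing of Ext¹(Δ(i),
∇(j)) rests on this. -/
theorem stdKer_le (hA : IsQuasiHereditary K e) (i : ι) :
    stdKer K e i ≤ Submodule.span A {y | ∃ l, i < l ∧ ∃ x ∈ stdKer K e i, y = e l • x} := by
  obtain ⟨𝓕⟩ := hA.good i
  set V := Submodule.span A {y | ∃ l, i < l ∧ ∃ x ∈ stdKer K e i, y = e l • x} with hV
  have hmem : ∀ {l}, i < l → ∀ x : P e i, e l • x ∈ V := by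
    intro l hl x
    refine Submodule.subset_span ⟨l, hl, e l • x, smul_mem_stdKer K hl.not_ge x, ?_⟩
    rw [← mul_smul, (hA.idem l).eq]
  have key : ∀ t, ∀ x ∈ 𝓕.F t, ∀ l, ¬ l ≤ i → e l • x ∈ V := by
    intro t
    induction t using Fin.induction with
    | zero =>
      intro x hx l _
      rw [𝓕.bot, Submodule.mem_bot] at hx
      rw [hx, smul_zero]
      exact V.zero_mem
    | succ t ih =>
      intro x hx l hl
      obtain ⟨p, hps, hp⟩ := 𝓕.exists_proj t
      rcases eq_or_lt_of_le (le_label_proj hA 𝓕 t) with h | h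
      · have h1 : e l • x ∈ 𝓕.F t.castSucc := by
          refine (hp (e l • ⟨x, hx⟩)).1 ?_
          rw [map_smul]
          exact std_smul_eq_zero K (h ▸ hl) _
        have h2 := ih _ h1 l hl
        rwa [← mul_smul, (hA.idem l).eq] at h2
      · obtain ⟨y, hy⟩ := hps (stdGen K e _)
        obtain ⟨a, ha⟩ := Submodule.mem_span_singleton.1
          (show p ⟨x, hx⟩ ∈ Submodule.span A {stdGen K e (𝓕.label t)} by
            rw [span_stdGen]; trivial)
        have h1 : x - a • e (𝓕.label t) • y.1 ∈ 𝓕.F t.castSucc := by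
          refine (hp (⟨x, hx⟩ - a • e (𝓕.label t) • y)).1 ?_
          rw [map_sub, map_smul, map_smul, hy, smul_stdGen K (hA.idem _), ha, sub_self]
        have h2 := V.add_mem (ih _ h1 l hl)
          (V.smul_mem (e l) (V.smul_mem a (hmem h y.1)))
        rwa [smul_sub, sub_add_cancel] at h2
  refine (stdKer_eq K i).le.trans (Submodule.span_le.2 ?_)
  rintro _ ⟨l, hl, x, rfl⟩
  exact key (Fin.last _) x (by rw [𝓕.top]; trivial) l hl

/-- `Ext¹(Δ(i), ∇(j)) = 0`: homomorphisms to `∇(j)` extend along submodules with quotient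
`Δ(i)`. -/
theorem exists_extension (hA : IsQuasiHereditary K e) {M : Type*} [AddCommGroup M] [Module K M]
    [Module A M] [IsScalarTower K A M] {i j : ι} (N : Submodule A M)
    (p : M →ₗ[A] Std K e i) (hps : Function.Surjective p) (hp : ∀ x, p x = 0 ↔ x ∈ N)
    (g : N →ₗ[A] Costd K e j) : ∃ G : M →ₗ[A] Costd K e j, ∀ x : N, G x = g x := by
  by_cases hij : i ≤ j
  -- For i ≤ j, extend into the injective I(j). For l ≰ j one has e_l Δ(i) = 0, hence e_l M ⊆ N, and
  -- the extension stays inside ∇(j).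
  · obtain ⟨G, hG⟩ := I_extend (hA.idem j) N.subtype (Submodule.injective_subtype _)
      ((Costd K e j).subtype.comp g)
    obtain ⟨G', hG'⟩ := exists_costd_map K G (fun l hl x => by
      have hx : e l • x ∈ N := (hp _).1 (by
        rw [map_smul, std_smul_eq_zero K fun h => hl (h.trans hij)])
      have h1 : g ⟨e l • x, hx⟩ = 0 := by
        have h2 : (⟨e l • x, hx⟩ : N) = e l • ⟨e l • x, hx⟩ := Subtype.ext (by
          change e l • x = e l • e l • x
          rw [← mul_smul, (hA.idem l).eq])
        rw [h2, map_smul, costd_smul_eq_zero K hl]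
      rw [← map_smul]
      exact (hG ⟨e l • x, hx⟩).trans (congrArg Subtype.val h1))
    exact ⟨G', fun x => Subtype.ext ((hG' x).trans (hG x))⟩
  -- For i ≰ j, M is a quotient of N ⊕ P(i). The map (g, 0) descends to M because g kills the image
  -- of `stdKer`, which is generated by vectors of e_l with l > i, hence l ≰ j.
  · obtain ⟨y, hy⟩ := hps (stdGen K e i)
    have hpy : ∀ a : P e i, p (a.1 • y) = (stdKer K e i).mkQ a := fun a => by
      rw [map_smul, hy, ← mk_eq_smul_stdGen K (hA.idem i)]
    have hN : ∀ a ∈ stdKer K e i, a.1 • y ∈ N := fun a ha => (hp _).1 (by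
      rw [hpy]; exact (Submodule.Quotient.mk_eq_zero _).2 ha)
    have hg : ∀ a (ha : a ∈ stdKer K e i), g ⟨a.1 • y, hN a ha⟩ = 0 := by
      let q : stdKer K e i →ₗ[A] N :=
        ((projMap (e i) y).comp (stdKer K e i).subtype).codRestrict N fun a => hN a.1 a.2
      have : stdKer K e i ≤ (LinearMap.ker (g.comp q)).map (stdKer K e i).subtype := by
        refine (stdKer_le hA i).trans (Submodule.span_le.2 ?_)
        rintro _ ⟨l, hl, x, hx, rfl⟩
        refine ⟨e l • ⟨x, hx⟩, ?_, rfl⟩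
        change (g.comp q) (e l • ⟨x, hx⟩) = 0
        rw [map_smul]
        exact costd_smul_eq_zero K (fun h => hij (hl.le.trans h)) _
      intro a ha
      obtain ⟨a', ha', rfl⟩ := this ha
      exact ha'
    let s : (N × P e i) →ₗ[A] M := LinearMap.coprod N.subtype (projMap (e i) y)
    have hs : Function.Surjective s := by
      intro x
      obtain ⟨a, ha⟩ := Submodule.mkQ_surjective _ (p x)
      refine ⟨(⟨x - a.1 • y, (hp _).1 ?_⟩, a), ?_⟩
      · rw [map_sub, hpy, ha, sub_self]
      · exact sub_add_cancel _ _
    obtain ⟨G, hG⟩ := exists_factor_of_surjective s hs (g.comp (LinearMap.fst A N (P e i))) (by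
      rintro ⟨n, a⟩ hna
      have h1 : n.1 + a.1 • y = 0 := hna
      have ha : a ∈ stdKer K e i := by
        rw [← Submodule.Quotient.mk_eq_zero]
        change (stdKer K e i).mkQ a = 0
        rw [← hpy, hp, eq_neg_of_add_eq_zero_right h1]
        exact N.neg_mem n.2
      have h2 := hg a ha
      rw [← neg_eq_zero, ← map_neg] at h2
      change g n = 0
      rw [← h2]
      congr 1
      exact Subtype.ext (eq_neg_of_add_eq_zero_left h1))
    refine ⟨G, fun x => ?_⟩
    have := hG (x, 0)
    rw [show s (x, 0) = x.1 by simp [s]] at this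
    exact this

theorem exists_std_costd_ne_zero (hA : IsQuasiHereditary K e) (i : ι) :
    ∃ f : Std K e i →ₗ[A] Costd K e i, f ≠ 0 := by
  have h0 : stdGen K e i ≠ 0 := by
    intro h0
    have h1 : edim K (e i) (Std K e i) = 0 := (edim_eq_zero_iff K _).2 fun x => by
      obtain ⟨a, rfl⟩ := Submodule.mem_span_singleton.1
        (show x ∈ Submodule.span A {stdGen K e i} by rw [span_stdGen]; trivial)
      rw [h0, smul_zero, smul_zero]
    rw [show edim K (e i) (Std K e i) = 1 from hA.std_self i] at h1
    exact one_ne_zero h1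
  obtain ⟨f, hf⟩ := exists_toI_ne_zero (K := K) (hA.idem i) (m := stdGen K e i)
    (by rwa [smul_stdGen K (hA.idem i)])
  obtain ⟨g, hg⟩ := exists_costd_map K f (fun l hl x => by
    rw [← map_smul, std_smul_eq_zero K hl, map_zero])
  refine ⟨g, fun h => hf ?_⟩
  rw [← hg, h]
  rfl

/-- If `Δ(j)` occurs in a `Δ`-filtration of `M`, there is a nonzero homomorphism `M → ∇(j)`. -/
theorem exists_costd_map_ne_zero (hA : IsQuasiHereditary K e) {M : Type*} [AddCommGroup M]
    [Module K M] [Module A M] [IsScalarTower K A M] (𝓕 : Filtration (A := A) (Std K e) M)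
    (s : Fin 𝓕.r) : ∃ f : M →ₗ[A] Costd K e (𝓕.label s), f ≠ 0 := by
  -- At step s the nonzero map Δ → ∇ is available; the later steps only require extending it.
  have key : ∀ t : Fin (𝓕.r + 1), s.castSucc < t →
      ∃ f : 𝓕.F t →ₗ[A] Costd K e (𝓕.label s), f ≠ 0 := by
    intro t
    induction t using Fin.induction with
    | zero => exact fun h => absurd h (Fin.not_lt_zero _)
    | succ t ih =>
      intro hst
      obtain ⟨p, hps, hp⟩ := 𝓕.exists_proj t
      rcases eq_or_lt_of_le (Fin.le_castSucc_iff.2 hst) with h | h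
      · obtain rfl := Fin.castSucc_injective _ h
        obtain ⟨f, hf⟩ := exists_std_costd_ne_zero hA (𝓕.label s)
        refine ⟨f.comp p, fun h0 => hf (LinearMap.ext fun x => ?_)⟩
        obtain ⟨y, rfl⟩ := hps x
        exact LinearMap.congr_fun h0 y
      · obtain ⟨f, hf⟩ := ih h
        obtain ⟨G, hG⟩ := exists_extension hA ((𝓕.F t.castSucc).submoduleOf (𝓕.F t.succ)) p hps
          hp (f.comp (Submodule.submoduleOfEquivOfLe (𝓕.mono t)).toLinearMap)
        refine ⟨G, fun h0 => hf (LinearMap.ext fun x => ?_)⟩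
        obtain ⟨y, rfl⟩ := (Submodule.submoduleOfEquivOfLe (𝓕.mono t)).surjective x
        have := hG y
        rw [h0] at this
        exact this.symm
  obtain ⟨f, hf⟩ := key (Fin.last _) (Fin.castSucc_lt_last s)
  have htop : 𝓕.F (Fin.last _) = ⊤ := 𝓕.top
  refine ⟨f.comp ((LinearMap.id : M →ₗ[A] M).codRestrict _ fun x => by rw [htop]; trivial),
    fun h0 => hf (LinearMap.ext fun x => LinearMap.congr_fun h0 x.1)⟩

theorem proj_map_eq_zero {M : Type*} [AddCommGroup M] [Module A M] {i : ι}
    (f : P e i →ₗ[A] M) (hf : f (projGen e i) = 0) : f = 0 := by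
  refine LinearMap.ext fun x => ?_
  obtain ⟨a, rfl⟩ := Submodule.mem_span_singleton.1
    (show x ∈ Submodule.span A {projGen e i} by rw [span_projGen]; trivial)
  rw [map_smul, hf, smul_zero, LinearMap.zero_apply]

end QuasiHereditary

/-! ### Generators of simple socles -/

section SocGen

variable (K : Type*) [Field K] {A : Type*} [Ring A] [Algebra K A] {ι : Type*} (e : ι → A) (b : ι)

/-- The element `s` of `e_b M` spans a one-dimensional submodule of `M` which is contained in
every nonzero submodule. -/
structure IsSocGen {M : Type*} [AddCommGroup M] [Module K M] [Module A M] (s : M) : Prop where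
  ne_zero : s ≠ 0
  smul_self : e b • s = s
  exists_smul : ∀ a : A, ∃ c : K, a • s = c • s
  essential : ∀ x : M, x ≠ 0 → ∃ a : A, a • x = s

variable {K e b} {M M' : Type*} [AddCommGroup M] [Module K M] [Module A M] [IsScalarTower K A M]
  [AddCommGroup M'] [Module K M'] [Module A M'] [IsScalarTower K A M'] {s : M}

theorem IsSocGen.isDetectedBy (h : IsSocGen K e b s) : IsDetectedBy (e b) M := by
  intro x hx
  obtain ⟨a, ha⟩ := h.essential x hx
  exact ⟨a, by rw [mul_smul, ha, h.smul_self]; exact h.ne_zero⟩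

theorem IsSocGen.injective (h : IsSocGen K e b s) (f : M →ₗ[A] M') (hf : f s ≠ 0) :
    Function.Injective f := by
  rw [injective_iff_map_eq_zero]
  intro x hx
  by_contra hx0
  obtain ⟨a, ha⟩ := h.essential x hx0
  exact hf (by rw [← ha, map_smul, hx, smul_zero])

theorem IsSocGen.exists_embedding (h : IsSocGen K e b s) (he : IsIdempotentElem (e b)) :
    ∃ f : M →ₗ[A] I K e b, Function.Injective f := by
  obtain ⟨f, hf⟩ := exists_toI_ne_zero (K := K) he (m := s) (by rw [h.smul_self]; exact h.ne_zero)
  exact ⟨f, h.injective f hf⟩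

theorem IsSocGen.map_equiv (h : IsSocGen K e b s) (f : M ≃ₗ[A] M') : IsSocGen K e b (f s) where
  ne_zero := by rw [Ne, LinearEquiv.map_eq_zero_iff]; exact h.ne_zero
  smul_self := by rw [← map_smul, h.smul_self]
  exists_smul a := by
    obtain ⟨c, hc⟩ := h.exists_smul a
    refine ⟨c, ?_⟩
    rw [← map_smul, hc, ← algebraMap_smul A c s, map_smul, algebraMap_smul]
  essential x hx := by
    obtain ⟨a, ha⟩ := h.essential (f.symm x) (by rwa [Ne, LinearEquiv.map_eq_zero_iff])
    refine ⟨a, ?_⟩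
    rw [← ha, map_smul, f.apply_symm_apply]

end SocGen

/-! ### 1-quasi-hereditary algebras -/

section OneQuasiHereditary

variable {K : Type*} [Field K] {A : Type*} [Ring A] [Algebra K A] [Module.Finite K A] {ι : Type*}
  [Fintype ι] [PartialOrder ι] {e : ι → A}

/-- Basicness in the form used below: a simple module is supported at a single vertex. -/
theorem IsBasic.eq_of_simple (hA : IsBasic K e) {X : Type*} [AddCommGroup X] [Module A X]
    [IsSimpleModule A X] {i j : ι} {x y : X} (hx : e i • x ≠ 0) (hy : e j • y ≠ 0) : i = j :=
  hA.basic i j (projective_equiv_of_simple K (hA.idem i) (hA.idem j) (hA.primitive i)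
    (hA.primitive j) hx hy)

theorem IsBasic.isLocalMod_proj (hA : IsBasic K e) (i : ι) : IsLocalMod A (P e i) :=
  isLocalMod_of_indecomposable K (hA.idem i) (hA.primitive i)

theorem IsBasic.isSimpleModule_S (hA : IsBasic K e) (i : ι) : IsSimpleModule A (S e i) :=
  (hA.isLocalMod_proj i).isSimpleModule_top

theorem IsBasic.exists_smul_S_ne_zero (hA : IsBasic K e) (i : ι) :
    ∃ x : S e i, e i • x ≠ 0 := by
  have hS := hA.isSimpleModule_S i
  have := hS.nontrivial
  refine ⟨(Module.jacobson A (P e i)).mkQ (projGen e i), fun h0 => ?_⟩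
  rw [← map_smul, show e i • projGen e i = projGen e i from smul_projGen (hA.idem i) (projGen e i)]
    at h0
  have : (Module.jacobson A (P e i)).mkQ = 0 := proj_map_eq_zero _ h0
  obtain ⟨x, hx⟩ := exists_ne (0 : S e i)
  obtain ⟨y, rfl⟩ := Submodule.mkQ_surjective _ x
  exact hx (by rw [this]; rfl)

theorem IsBasic.isGeneratedBy_of_top (hA : IsBasic K e) {M : Type*} [AddCommGroup M] [Module A M]
    [Module.Finite A M] {i : ι} (h : Nonempty (Top A M ≃ₗ[A] S e i)) :
    IsLocalMod A M ∧ IsGeneratedBy (e i) M := by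
  obtain ⟨φ⟩ := h
  have := hA.isSimpleModule_S i
  have hloc : IsLocalMod A M := isLocalMod_of_isSimpleModule_top (IsSimpleModule.congr φ)
  refine ⟨hloc, ?_⟩
  by_contra hne
  obtain ⟨J, hJ, hu⟩ := hloc.exists_coatom
  have hle := hu _ hne
  rw [← hloc.jacobson_eq hJ] at hle
  obtain ⟨x, hx⟩ := hA.exists_smul_S_ne_zero i
  obtain ⟨y, hy⟩ := Submodule.mkQ_surjective _ (φ.symm x)
  apply hx
  rw [← φ.apply_symm_apply x, ← hy, ← map_smul, ← map_smul]
  have : (Module.jacobson A M).mkQ (e i • y) = 0 :=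
    (Submodule.Quotient.mk_eq_zero _).2 (hle (Submodule.subset_span (by
      change e i • e i • y = e i • y
      rw [← mul_smul, (hA.idem i).eq])))
  rw [this, map_zero]

/-- Here X is a quotient of Δ(b), so [Δ(b) : S(b)] = 1 makes e_b X a line; the other idempotents
kill X. -/
theorem simple_bot (hA : IsQuasiHereditary K e) {b : ι} {X : Type*}
    [AddCommGroup X] [Module K X] [Module A X] [IsScalarTower K A X] [IsSimpleModule A X] {y : X}
    (hy : e b • y ≠ 0) (a : A) : ∃ c : K, a • e b • y = c • e b • y := by
  have hy1 : e b • e b • y = e b • y := by rw [← mul_smul, (hA.idem b).eq]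
  have h0 : ∀ l, l ≠ b → ∀ x : X, e l • x = 0 := fun l hl x => by
    by_contra h
    exact hl (hA.eq_of_simple h hy)
  obtain ⟨f, hf⟩ := exists_std_map K hy1 (fun l hl a => h0 l (fun h => hl h.le) _)
  have hfs : Function.Surjective f := LinearMap.surjective_of_ne_zero fun h => hy (by
    rw [← hf, h]; rfl)
  have : Module.Finite K X := Module.Finite.of_surjective (f.restrictScalars K) hfs
  refine exists_smul_eq_of_edim_le_one K (hA.idem b) ?_ hy1 ?_ hy
  · exact (edim_le_of_surjective K (hA.idem b) f hfs).trans (hA.std_self b).le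
  · rw [← hA.sum_smul (e b • a • e b • y)]
    conv_rhs => rw [← hA.sum_smul (a • e b • y)]
    refine Finset.sum_congr rfl fun l _ => ?_
    by_cases hl : l = b
    · rw [hl, ← mul_smul, (hA.idem b).eq]
    · rw [h0 l hl, h0 l hl]

theorem exists_isSocGen_proj (hA : IsOneQuasiHereditary K e) {b : ι} (hb : IsBot b) (j : ι) :
    ∃ s : P e j, IsSocGen K e b s := by
  have hS := hA.isSimpleModule_S b
  obtain ⟨φ⟩ := hA.soc_proj b hb j
  have hsoc : IsSimpleModule A (soc A (P e j)) := IsSimpleModule.congr φ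
  obtain ⟨x, hx⟩ := hA.exists_smul_S_ne_zero b
  set y : soc A (P e j) := φ.symm x with hy
  have hy0 : e b • y ≠ 0 := by
    rw [hy, ← map_smul, Ne, LinearEquiv.map_eq_zero_iff]
    exact hx
  have hsmul := simple_bot (X := soc A (P e j)) hA.toIsQuasiHereditary hy0
  refine ⟨(e b • y).1, fun h => hy0 (Subtype.ext h), ?_, fun a => ?_, fun z hz => ?_⟩
  · change e b • e b • y.1 = e b • y.1
    rw [← mul_smul, (hA.idem b).eq]
  · obtain ⟨c, hc⟩ := hsmul a
    exact ⟨c, congrArg Subtype.val hc⟩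
  · have : IsArtinian A (P e j) := isArtinian_of_tower K inferInstance
    obtain ⟨N, hN, hNz⟩ := (eq_bot_or_exists_atom_le (Submodule.span A {z})).resolve_left
      (fun h => hz (Submodule.span_singleton_eq_bot.1 h))
    have hNs : N ≤ soc A (P e j) := le_sSup (isSimpleModule_iff_isAtom.2 hN)
    have hNeq : N = soc A (P e j) :=
      ((isSimpleModule_iff_isAtom.1 hsoc).le_iff.1 hNs).resolve_left hN.1
    rw [hNeq] at hNz
    exact Submodule.mem_span_singleton.1 (hNz (e b • y).2)

theorem stdKer_top {t : ι} (ht : IsTop t) : stdKer K e t = ⊥ := by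
  rw [stdKer_eq, Submodule.span_eq_bot]
  rintro _ ⟨l, hl, -⟩
  exact absurd (ht l) hl

/-- Δ(i) embeds in Δ(t) = P(t), whose socle is S(b). -/
theorem std_isDetectedBy (hA : IsOneQuasiHereditary K e) {b : ι} (hb : IsBot b) (i : ι) :
    IsDetectedBy (e b) (Std K e i) := by
  obtain ⟨t, ht⟩ := hA.exists_top
  obtain ⟨f, hf⟩ := hA.std_embed t ht i
  obtain ⟨s, hs⟩ := exists_isSocGen_proj hA hb t
  let φ := Submodule.quotEquivOfEqBot _ (stdKer_top (K := K) (e := e) ht)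
  exact hs.isDetectedBy.of_injective (φ.toLinearMap.comp f) (φ.injective.comp hf)

theorem I_isGeneratedBy (hA : IsOneQuasiHereditary K e) {b : ι} (hb : IsBot b) (i : ι) :
    IsLocalMod A (I K e i) ∧ IsGeneratedBy (e b) (I K e i) := by
  have : Module.Finite A (I K e i) := Module.Finite.of_restrictScalars_finite K A _
  exact hA.isGeneratedBy_of_top (hA.top_inj b hb i)

theorem costd_top {t : ι} (ht : IsTop t) : Costd K e t = ⊤ := by
  rw [eq_top_iff]
  rintro x -
  exact (mem_costd K).2 fun l hl => absurd (ht l) hl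

/-- ∇(i) is a quotient of ∇(t) = I(t), whose top is S(b). -/
theorem costd_isGeneratedBy (hA : IsOneQuasiHereditary K e) {b : ι} (hb : IsBot b) (i : ι) :
    IsGeneratedBy (e b) (Costd K e i) := by
  obtain ⟨t, ht⟩ := hA.exists_top
  obtain ⟨f, hf⟩ := hA.costd_onto t ht i
  exact (I_isGeneratedBy hA hb t).2.of_surjective
    (f.comp (LinearEquiv.ofTop _ (costd_top ht)).symm.toLinearMap)
    (hf.comp (LinearEquiv.surjective _))

/-- The socle of P(b) is S(b), so P(b) embeds in I(b). The top of I(b) is S(b), so P(b) maps onto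
I(b). Equal dimensions make the surjection bijective. -/
theorem exists_proj_equiv_I (hA : IsOneQuasiHereditary K e) {b : ι} (hb : IsBot b) :
    Nonempty (P e b ≃ₗ[A] I K e b) := by
  have : Module.Finite A (I K e b) := Module.Finite.of_restrictScalars_finite K A _
  obtain ⟨s, hs⟩ := exists_isSocGen_proj hA hb b
  obtain ⟨f, hf⟩ := hs.exists_embedding (hA.idem b)
  obtain ⟨y, hy, hyt⟩ := (I_isGeneratedBy hA hb b).1.exists_generator (I_isGeneratedBy hA hb b).2
  have hg : Function.Surjective (projMap (e b) y) := by
    rw [← LinearMap.range_eq_top, projMap_range hy, hyt]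
  exact ⟨LinearEquiv.ofBijective (projMap (e b) y) ⟨injective_of_surjective_of_finrank_le K _ hg
    ((f.restrictScalars K).finrank_le_finrank_of_injective hf), hg⟩⟩

theorem count_proj_eq_one (hA : IsOneQuasiHereditary K e) {i j : ι} (h : i ≤ j)
    (𝓕 : Filtration (A := A) (Std K e) (P e i)) : 𝓕.count j = 1 := by
  obtain ⟨𝓖, h𝓖⟩ := hA.proj_mult j i h
  rw [𝓕.count_unique hA.toIsQuasiHereditary 𝓖]
  exact h𝓖

open Classical in
theorem edim_std (hA : IsOneQuasiHereditary K e) (i j : ι) :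
    edim K (e j) (Std K e i) = if j ≤ i then 1 else 0 := by
  split_ifs with h
  · exact hA.std_jh i j h
  · exact jh_std_eq_zero h

open Classical in
theorem edim_proj (hA : IsOneQuasiHereditary K e) (i k : ι) :
    edim K (e k) (P e i) = ∑ j, if i ≤ j ∧ k ≤ j then 1 else 0 := by
  obtain ⟨𝓕⟩ := hA.good i
  rw [𝓕.edim_eq' K (hA.idem k)]
  refine Finset.sum_congr rfl fun j _ => ?_
  rw [edim_std hA]
  by_cases hij : i ≤ j
  · rw [count_proj_eq_one hA hij]
    simp [hij]
  · rw [count_proj_eq_zero hA.toIsQuasiHereditary hij]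
    simp [hij]

theorem edim_proj_top (hA : IsOneQuasiHereditary K e) {t : ι} (ht : IsTop t) (i : ι) :
    edim K (e t) (P e i) = 1 := by
  classical
  rw [edim_proj hA, Finset.sum_eq_single t]
  · simp [ht i]
  · intro j _ hj
    rw [if_neg]
    exact fun h => hj (le_antisymm (ht j) h.2)
  · simp

/-- Half of BGG reciprocity: Δ(i) occurs in P(k), so there is a nonzero map P(k) → ∇(i), that is, a
nonzero vector of e_k ∇(i). -/
theorem costd_exists_smul_ne_zero (hA : IsOneQuasiHereditary K e) {k i : ι} (h : k ≤ i) :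
    ∃ x : Costd K e i, e k • x ≠ 0 := by
  obtain ⟨𝓕⟩ := hA.good k
  obtain ⟨s, hs⟩ := (𝓕.count_ne_zero_iff i).1 (by rw [count_proj_eq_one hA h]; exact one_ne_zero)
  subst hs
  obtain ⟨f, hf⟩ := exists_costd_map_ne_zero hA.toIsQuasiHereditary 𝓕 s
  refine ⟨f (projGen e k), fun h0 => hf (proj_map_eq_zero f ?_)⟩
  rw [← h0, ← map_smul]
  congr 1
  exact (smul_projGen (hA.idem k) (projGen e k)).symm

/-- e_k I(t) is dual to e_t A e_k = e_t P(k), which is one-dimensional. -/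
theorem I_top_proportional (hA : IsOneQuasiHereditary K e) {t : ι} (ht : IsTop t) {k : ι}
    {x y : I K e t} (hx : e k • x = x) (hy : e k • y = y) (hy0 : y ≠ 0) :
    ∃ c : K, x = c • y := by
  have happ : ∀ z : I K e t, e k • z = z → ∀ a, z.1 a = z.1 (e t * (a * e k)) := by
    intro z hz a
    conv_lhs => rw [← hz]
    change z.1 (a * e k) = _
    exact z.2 _
  obtain ⟨a0, ha0⟩ : ∃ a, y.1 a ≠ 0 := by
    by_contra! h
    exact hy0 (Subtype.ext (KDual.ext h))
  have hmem : ∀ a, e t * (a * e k) ∈ P e k := fun a =>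
    Submodule.mem_span_singleton.2 ⟨e t * a, mul_assoc _ _ _⟩
  have hidem : ∀ a, e t • (⟨e t * (a * e k), hmem a⟩ : P e k) = ⟨e t * (a * e k), hmem a⟩ :=
    fun a => Subtype.ext (by
      change e t * (e t * (a * e k)) = _
      rw [← mul_assoc, (hA.idem t).eq])
  rw [happ y hy] at ha0
  have hz0 : (⟨e t * (a0 * e k), hmem a0⟩ : P e k) ≠ 0 := fun h0 => ha0 (by
    rw [show e t * (a0 * e k) = 0 from congrArg Subtype.val h0, KDual.map_zero])
  refine ⟨x.1 (e t * (a0 * e k)) / y.1 (e t * (a0 * e k)), Subtype.ext (KDual.ext fun a => ?_)⟩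
  obtain ⟨c, hc⟩ := exists_smul_eq_of_edim_le_one K (hA.idem t) (edim_proj_top hA ht k).le
    (hidem a0) (hidem a) hz0
  have hc' : e t * (a * e k) = c • (e t * (a0 * e k)) := congrArg Subtype.val hc
  change x.1 a = _ * y.1 a
  rw [happ x hx, happ y hy a, hc', KDual.map_smul, KDual.map_smul]
  field_simp

/-- Both modules are quotients of I(t), where each e_k I(t) is at most a line. A line with k ≤ i
survives in ∇(i), and one with k ≰ i dies in ∇(j), so I(t) → ∇(j) factors through ∇(i). -/
theorem exists_costd_costd_ne_zero (hA : IsOneQuasiHereditary K e) {i j : ι} (h : j ≤ i) :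
    ∃ f : Costd K e i →ₗ[A] Costd K e j, f ≠ 0 := by
  obtain ⟨t, ht⟩ := hA.exists_top
  obtain ⟨f, hf⟩ := hA.costd_onto t ht i
  obtain ⟨g, hg⟩ := hA.costd_onto t ht j
  obtain ⟨q, hq⟩ := exists_factor_of_surjective f hf g (by
    intro x hx
    rw [← hA.sum_smul x, map_sum]
    refine Finset.sum_eq_zero fun k _ => ?_
    by_cases hk : k ≤ i
    · have hx0 : e k • x = 0 := by
        obtain ⟨y, hy⟩ := costd_exists_smul_ne_zero hA hk
        obtain ⟨y, rfl⟩ := hf y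
        rw [← map_smul] at hy
        obtain ⟨c, hc⟩ := I_top_proportional hA ht (x := (e k • x).1) (y := (e k • y).1) (k := k)
          (by change e k • e k • x.1 = e k • x.1; rw [← mul_smul, (hA.idem k).eq])
          (by change e k • e k • y.1 = e k • y.1; rw [← mul_smul, (hA.idem k).eq])
          (fun h0 => hy (by rw [(Subtype.ext h0 : e k • y = 0), map_zero]))
        have hc' : e k • x = c • e k • y := Subtype.ext hc
        have h1 := congrArg f hc'
        rw [map_smul, hx, smul_zero, ← algebraMap_smul A c (e k • y), map_smul,
          algebraMap_smul] at h1
        rw [hc', (smul_eq_zero.1 h1.symm).resolve_right hy, zero_smul]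
      rw [hx0, map_zero]
    · rw [map_smul, costd_smul_eq_zero K fun h' => hk (h'.trans h)])
  refine ⟨q, fun h0 => ?_⟩
  obtain ⟨y, hy⟩ := costd_exists_smul_ne_zero hA (le_refl j)
  obtain ⟨x, rfl⟩ := hg y
  rw [← hq, h0] at hy
  exact hy (smul_zero _)

/-- Inside Δ(t) the space e_j Δ(t) is a line, so a nonzero vector of e_j Δ(i) is proportional to the
generator of Δ(j) and satisfies the same relations. -/
theorem exists_std_std_ne_zero (hA : IsOneQuasiHereditary K e) {i j : ι} (h : j ≤ i) :
    ∃ f : Std K e j →ₗ[A] Std K e i, f ≠ 0 := by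
  obtain ⟨t, ht⟩ := hA.exists_top
  obtain ⟨f, hf⟩ := hA.std_embed t ht i
  obtain ⟨g, hg⟩ := hA.std_embed t ht j
  obtain ⟨y, hy⟩ : ∃ y : Std K e i, e j • y ≠ 0 := by
    by_contra! hcon
    have h1 := (edim_eq_zero_iff K (e j)).2 hcon
    rw [show edim K (e j) (Std K e i) = 1 from hA.std_jh i j h] at h1
    exact one_ne_zero h1
  have hg0 : g (stdGen K e j) ≠ 0 := std_map_ne_zero K fun h0 => by
    obtain ⟨y, hy⟩ : ∃ y : Std K e j, e j • y ≠ 0 := by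
      by_contra! hcon
      have h1 := (edim_eq_zero_iff K (e j)).2 hcon
      rw [show edim K (e j) (Std K e j) = 1 from hA.std_self j] at h1
      exact one_ne_zero h1
    refine hy (hg ?_)
    rw [h0]; rfl
  obtain ⟨c, hc⟩ := exists_smul_eq_of_edim_le_one K (hA.idem j) (hA.std_jh t j (ht j)).le
    (x := g (stdGen K e j)) (y := f (e j • y)) (by rw [← map_smul, smul_stdGen K (hA.idem j)])
    (by rw [← map_smul, ← mul_smul, (hA.idem j).eq]) hg0
  obtain ⟨q, hq⟩ := exists_std_map K (y := e j • y) (by rw [← mul_smul, (hA.idem j).eq])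
    (fun l hl a => hf (by
      rw [map_smul, map_smul, hc, smul_comm a c, smul_comm (e l) c, ← map_smul, ← map_smul,
        std_smul_eq_zero K hl, map_zero, smul_zero, map_zero]))
  refine ⟨q, fun h0 => hy ?_⟩
  rw [← hq, h0]; rfl

end OneQuasiHereditary

/-! ### Tilting modules over 1-quasi-hereditary algebras -/

section Tilting

variable {K : Type*} [Field K] {A : Type*} [Ring A] [Algebra K A] [Module.Finite K A] {ι : Type*}
  [Fintype ι] [PartialOrder ι] {e : ι → A}

/-- This identifies P(b) / ∑_{l ≰ i} P(l) as the largest quotient of P(b) supported at vertices ≤ i.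
-/
theorem sumProj_eq (hA : IsOneQuasiHereditary K e) {b : ι} (hb : IsBot b) (i : ι) :
    sumProj e b i = Submodule.span A {y | ∃ l, ¬ l ≤ i ∧ ∃ x : P e b, y = e l • x} := by
  classical
  apply le_antisymm
  · refine sSup_le ?_
    rintro N ⟨l, hl, ⟨φ⟩⟩ x hx
    have h1 : (⟨x, hx⟩ : N) = (φ ⟨x, hx⟩).1 • e l • φ.symm (projGen e l) := by
      rw [← map_smul, ← map_smul, show e l • projGen e l = projGen e l from
        smul_projGen (hA.idem l) (projGen e l), smul_projGen (hA.idem l), φ.symm_apply_apply]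
    rw [show x = (φ ⟨x, hx⟩).1 • e l • (φ.symm (projGen e l)).1 from congrArg Subtype.val h1]
    exact Submodule.smul_mem _ _ (Submodule.subset_span ⟨l, hl, _, rfl⟩)
  · refine Submodule.span_le.2 ?_
    rintro _ ⟨l, hl, x, rfl⟩
    obtain ⟨s, hs⟩ := exists_isSocGen_proj hA hb l
    obtain ⟨f, hf⟩ := hs.exists_embedding (hA.idem b)
    obtain ⟨φ⟩ := exists_proj_equiv_I hA hb
    set g := φ.symm.toLinearMap.comp f with hg
    have hgi : Function.Injective g := φ.symm.injective.comp hf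
    have hle : LinearMap.range g ≤ sumProj e b i :=
      le_sSup ⟨l, hl, ⟨(LinearEquiv.ofInjective g hgi).symm⟩⟩
    apply hle
    -- The copy of P(l) inside P(b) ≅ I(b) contains all of e_l P(b), because dim e_l P(l) = #{j ≥ l}
    -- = dim e_l P(b).
    have h1 := edim_add K (hA.idem l) (LinearMap.range g)
    rw [← edim_eq_of_equiv K (e l) (LinearEquiv.ofInjective g hgi), edim_proj hA, edim_proj hA,
      Finset.sum_congr rfl (fun j _ => show (if b ≤ j ∧ l ≤ j then 1 else 0) =
        (if l ≤ j ∧ l ≤ j then 1 else 0) by simp [hb j])] at h1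
    have h2 : edim K (e l) (P e b ⧸ LinearMap.range g) = 0 := by omega
    rw [← jh_eq_edim, jh_quotient_eq_zero_iff] at h2
    exact h2 x

theorem smul_mem_sumProj (hA : IsOneQuasiHereditary K e) {b : ι} (hb : IsBot b) {i l : ι}
    (hl : ¬ l ≤ i) (x : P e b) : e l • x ∈ sumProj e b i := by
  rw [sumProj_eq hA hb]
  exact Submodule.subset_span ⟨l, hl, x, rfl⟩

/-- The universal property of `P(b) / ∑_{l ≰ i} P(l)`. -/
theorem exists_map_of_sumProj (hA : IsOneQuasiHereditary K e) {b : ι} (hb : IsBot b) {i : ι}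
    {M : Type*} [AddCommGroup M] [Module A M] {y : M} (hy : e b • y = y)
    (h : ∀ l, ¬ l ≤ i → ∀ a : A, e l • a • y = 0) :
    ∃ f : (P e b ⧸ sumProj e b i) →ₗ[A] M, f ((sumProj e b i).mkQ (projGen e b)) = y := by
  refine ⟨(sumProj e b i).liftQ (projMap (e b) y) ?_, (Submodule.liftQ_apply _ _ _).trans hy⟩
  rw [sumProj_eq hA hb, Submodule.span_le]
  rintro _ ⟨l, hl, x, rfl⟩
  change (e l * x.1) • y = 0
  rw [mul_smul, h l hl]

-- P(b) has each Δ(j) exactly once as a factor. A factor Δ(j) with j ≰ i is generated by a vector of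
-- e_j, so it dies in the quotient.
open Classical in
theorem edim_quotient_sumProj_le (hA : IsOneQuasiHereditary K e) {b : ι} (hb : IsBot b) (i : ι)
    {f : A} (hf : IsIdempotentElem f) : edim K f (P e b ⧸ sumProj e b i) ≤
      ∑ j, if j ≤ i then edim K f (Std K e j) else 0 := by
  obtain ⟨𝓕⟩ := hA.good b
  refine (𝓕.edim_quotient_le K hf (sumProj e b i) (fun t => 𝓕.label t ≤ i) ?_).trans ?_
  · intro t ht x hx
    obtain ⟨p, hps, hp⟩ := 𝓕.exists_proj t
    obtain ⟨y, hy⟩ := hps (stdGen K e _)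
    obtain ⟨a, ha⟩ := Submodule.mem_span_singleton.1
      (show p ⟨x, hx⟩ ∈ Submodule.span A {stdGen K e (𝓕.label t)} by rw [span_stdGen]; trivial)
    have h1 : x - a • e (𝓕.label t) • y.1 ∈ 𝓕.F t.castSucc := by
      refine (hp (⟨x, hx⟩ - a • e (𝓕.label t) • y)).1 ?_
      rw [map_sub, map_smul, map_smul, hy, smul_stdGen K (hA.idem _), ha, sub_self]
    rw [← sub_add_cancel x (a • e (𝓕.label t) • y.1)]
    exact Submodule.add_mem_sup h1 (Submodule.smul_mem _ _ (smul_mem_sumProj hA hb ht _))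
  · rw [𝓕.sum_label (fun j => if j ≤ i then edim K f (Std K e j) else 0)]
    refine Finset.sum_le_sum fun j _ => ?_
    rw [count_proj_eq_one hA (hb j), one_mul]

variable {i : ι} {M : Type*} [AddCommGroup M] [Module K M] [Module A M] [IsScalarTower K A M]

theorem IsTiltingSummand.smul_eq_zero (hM : IsTiltingSummand K e i M) {l : ι} (hl : ¬ l ≤ i)
    (x : M) : e l • x = 0 :=
  have := hM.finite
  (edim_eq_zero_iff K (e l)).1 (hM.jh_zero l hl) x

theorem IsTiltingSummand.isDetectedBy (hA : IsOneQuasiHereditary K e) {b : ι} (hb : IsBot b)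
    (hM : IsTiltingSummand K e i M) : IsDetectedBy (e b) M := by
  obtain ⟨𝓕⟩ := hM.std_good
  exact 𝓕.isDetectedBy fun t => std_isDetectedBy hA hb _

theorem IsTiltingSummand.isGeneratedBy (hA : IsOneQuasiHereditary K e) {b : ι} (hb : IsBot b)
    (hM : IsTiltingSummand K e i M) : IsGeneratedBy (e b) M := by
  obtain ⟨𝓕⟩ := hM.costd_good
  exact 𝓕.isGeneratedBy (hA.idem b) fun t => costd_isGeneratedBy hA hb _

/-- Since M is supported at vertices ≤ i, a preimage in e_i F of the generator of the factor Δ(i)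
satisfies the relations of Δ(i), so the projection onto that factor splits. -/
theorem IsTiltingSummand.exists_std_embedding (hA : IsOneQuasiHereditary K e)
    (hM : IsTiltingSummand K e i M) : ∃ f : Std K e i →ₗ[A] M, Function.Injective f := by
  obtain ⟨𝓕, h𝓕⟩ := hM.std_self
  obtain ⟨t, rfl⟩ := (𝓕.count_ne_zero_iff i).1 (by
    rw [show 𝓕.count i = 1 from h𝓕]; exact one_ne_zero)
  obtain ⟨p, hps, hp⟩ := 𝓕.exists_proj t
  obtain ⟨y, hy⟩ := hps (stdGen K e _)
  obtain ⟨f, hf⟩ := exists_std_map K (y := e (𝓕.label t) • y) (by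
    rw [← mul_smul, (hA.idem _).eq]) (fun l hl a => Subtype.ext (hM.smul_eq_zero hl _))
  refine ⟨(𝓕.F t.succ).subtype.comp f, (Submodule.injective_subtype _).comp
    (Function.LeftInverse.injective (g := p) fun x => ?_)⟩
  obtain ⟨a, rfl⟩ := Submodule.mem_span_singleton.1
    (show x ∈ Submodule.span A {stdGen K e (𝓕.label t)} by rw [span_stdGen]; trivial)
  rw [map_smul, hf, map_smul, map_smul, hy, smul_stdGen K (hA.idem _)]

theorem Filtration.exists_map_to_I (hA : IsOneQuasiHereditary K e) {j : ι} (𝓖 : Filtration (A := A) (fun j => Costd K e j) M)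
    (t : Fin 𝓖.r) (ht : 𝓖.label t = j) : ∃ (p : 𝓖.F t.succ →ₗ[A] Costd K e j)
      (f : M →ₗ[A] I K e j), Function.Surjective p ∧ (∀ x, p x = 0 ↔ x.1 ∈ 𝓖.F t.castSucc) ∧
      ∀ x : 𝓖.F t.succ, f x = (p x).1 := by
  subst ht
  obtain ⟨p, hps, hp⟩ := 𝓖.exists_proj t
  obtain ⟨f, hf⟩ := I_extend (hA.idem _) (𝓖.F t.succ).subtype (Submodule.injective_subtype _)
    ((Costd K e (𝓖.label t)).subtype.comp p)
  exact ⟨p, f, hps, hp, hf⟩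

/-- The projection of a filtration step onto ∇(i) extends to M → I(i); the support of M keeps its
image inside ∇(i). -/
theorem IsTiltingSummand.exists_costd_surjection (hA : IsOneQuasiHereditary K e)
    (hM : IsTiltingSummand K e i M) : ∃ f : M →ₗ[A] Costd K e i, Function.Surjective f := by
  obtain ⟨𝓖, h𝓖⟩ := hM.costd_self
  obtain ⟨t, ht⟩ := (𝓖.count_ne_zero_iff i).1 (by
    rw [show 𝓖.count i = 1 from h𝓖]; exact one_ne_zero)
  obtain ⟨p, f, hps, hp, hf⟩ := 𝓖.exists_map_to_I hA t ht
  obtain ⟨g, hg⟩ := exists_costd_map K f (fun l hl x => by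
    rw [← map_smul, hM.smul_eq_zero hl, map_zero])
  refine ⟨g, fun y => ?_⟩
  obtain ⟨x, rfl⟩ := hps y
  exact ⟨x, Subtype.ext ((hg x).trans (hf x))⟩

/-- The composite M ↠ ∇(i) → ∇(j) is nonzero, so it is nonzero on some factor Δ(k), which forces k =
j. -/
theorem IsTiltingSummand.std_count_ne_zero (hA : IsOneQuasiHereditary K e)
    (hM : IsTiltingSummand K e i M) (𝓕 : Filtration (A := A) (Std K e) M) {j : ι} (h : j ≤ i) :
    𝓕.count j ≠ 0 := by
  obtain ⟨f, hf⟩ := hM.exists_costd_surjection hA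
  obtain ⟨g, hg⟩ := exists_costd_costd_ne_zero hA h
  obtain ⟨t, q, hq⟩ := 𝓕.exists_ne_zero_of_ne_zero (g.comp f) (fun h0 => hg (LinearMap.ext
    fun x => by obtain ⟨y, rfl⟩ := hf x; exact LinearMap.congr_fun h0 y))
  exact (𝓕.count_ne_zero_iff j).2 ⟨t, eq_of_std_costd_map K (hA.idem _) hq⟩

theorem IsTiltingSummand.costd_count_ne_zero (hA : IsOneQuasiHereditary K e)
    (hM : IsTiltingSummand K e i M) (𝓖 : Filtration (A := A) (fun j => Costd K e j) M) {j : ι}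
    (h : j ≤ i) : 𝓖.count j ≠ 0 := by
  obtain ⟨f, hf⟩ := hM.exists_std_embedding hA
  obtain ⟨g, hg⟩ := exists_std_std_ne_zero hA h
  obtain ⟨t, q, hq⟩ := 𝓖.exists_ne_zero_of_cyclic (span_stdGen K j) (f.comp g) (fun h0 => hg
    (LinearMap.ext fun x => hf (by
      rw [LinearMap.zero_apply, map_zero]; exact LinearMap.congr_fun h0 x)))
  exact (𝓖.count_ne_zero_iff j).2 ⟨t, (eq_of_std_costd_map K (hA.idem _) hq).symm⟩

open Classical in
theorem IsTiltingSummand.le_edim (hA : IsOneQuasiHereditary K e)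
    (hM : IsTiltingSummand K e i M) {f : A} (hf : IsIdempotentElem f) :
    ∑ j, (if j ≤ i then edim K f (Std K e j) else 0) ≤ edim K f M := by
  have := hM.finite
  obtain ⟨𝓕⟩ := hM.std_good
  rw [𝓕.edim_eq' K hf]
  refine Finset.sum_le_sum fun j _ => ?_
  split_ifs with h
  · exact Nat.le_mul_of_pos_left _ (Nat.pos_of_ne_zero (hM.std_count_ne_zero hA 𝓕 h))
  · exact Nat.zero_le _

/-- Locality makes M a quotient of P(b) / ∑_{l ≰ i} P(l); the upper bound for the dimension of that
module and the lower bound for M coincide. -/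
theorem IsTiltingSummand.equiv_of_isLocalMod (hA : IsOneQuasiHereditary K e) {b : ι}
    (hb : IsBot b) (hM : IsTiltingSummand K e i M) (h : IsLocalMod A M) :
    Nonempty (M ≃ₗ[A] (P e b ⧸ sumProj e b i)) := by
  have := hM.finite
  have : Module.Finite A M := Module.Finite.of_restrictScalars_finite K A _
  obtain ⟨x, hx, hxt⟩ := h.exists_generator (hM.isGeneratedBy hA hb)
  obtain ⟨f, hf⟩ := exists_map_of_sumProj hA hb hx (fun l hl a => hM.smul_eq_zero hl _)
  have hfs : Function.Surjective f := by
    rw [← LinearMap.range_eq_top, eq_top_iff, ← hxt, Submodule.span_singleton_le_iff_mem]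
    exact ⟨_, hf⟩
  refine ⟨(LinearEquiv.ofBijective f ⟨injective_of_surjective_of_finrank_le K f hfs ?_,
    hfs⟩).symm⟩
  rw [← edim_one K (A := A), ← edim_one K (A := A)]
  exact (edim_quotient_sumProj_le hA hb i IsIdempotentElem.one).trans
    (hM.le_edim hA IsIdempotentElem.one)

/-- P(b) splits off from M. Some x in e_b M generates a submodule meeting e_t M, and a map M → I(b)
≅ P(b) can be chosen nonzero there. This gives α : P(b) → M and β : M → P(b) with β ∘ α bijective,
and M is indecomposable. -/
theorem IsTiltingSummand.equiv_proj (hA : IsOneQuasiHereditary K e) {b : ι} (hb : IsBot b)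
    {t : ι} (ht : IsTop t) (hM : IsTiltingSummand K e t M) : Nonempty (P e b ≃ₗ[A] M) := by
  have := hM.finite
  obtain ⟨φ⟩ := exists_proj_equiv_I hA hb
  obtain ⟨z, hz⟩ : ∃ z : M, e t • z ≠ 0 := by
    by_contra! hcon
    have h1 := (edim_eq_zero_iff K (e t)).2 hcon
    rw [show edim K (e t) M = 1 from hM.jh_self] at h1
    exact one_ne_zero h1
  obtain ⟨x, hx, a, ha⟩ : ∃ x : M, e b • x = x ∧ ∃ a : A, e t • a • x ≠ 0 := by
    by_contra! hcon
    have hz' : z ∈ Submodule.span A {x : M | e b • x = x} := by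
      rw [show Submodule.span A {x : M | e b • x = x} = ⊤ from hM.isGeneratedBy hA hb]; trivial
    refine hz ?_
    have : ∀ a : A, e t • a • z = 0 := by
      clear hz
      induction hz' using Submodule.span_induction with
      | mem x hx => exact hcon x hx
      | zero => intro a; rw [smul_zero, smul_zero]
      | add x y _ _ hx hy => intro a; rw [smul_add, smul_add, hx, hy, add_zero]
      | smul c x _ hx => intro a; rw [← mul_smul a c x, hx]
    rw [← this 1, one_smul]
  obtain ⟨c, hc⟩ := hM.isDetectedBy hA hb (e t • a • x) ha
  rw [mul_smul] at hc
  obtain ⟨g, hg⟩ := exists_toI_ne_zero (K := K) (hA.idem b) hc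
  have hg' : g (e t • a • x) ≠ 0 := fun h0 => hg (by rw [map_smul, h0, smul_zero])
  let α : P e b →ₗ[A] M := projMap (e b) x
  let β : M →ₗ[A] P e b := φ.symm.toLinearMap.comp g
  have hα : α (e t • a • projGen e b) = e t • a • x := by
    rw [map_smul, map_smul]
    exact congrArg (fun y => e t • a • y) hx
  have hβ : β (e t • a • x) ≠ 0 := fun h0 => hg' (φ.symm.map_eq_zero_iff.1 h0)
  have hw0 : e t • a • projGen e b ≠ 0 := fun h0 => ha (by rw [← hα, h0, map_zero])
  obtain ⟨k, hk⟩ := exists_smul_eq_of_edim_le_one K (hA.idem t) (edim_proj_top hA ht b).le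
    (x := e t • a • projGen e b) (y := β (α (e t • a • projGen e b)))
    (by rw [← mul_smul, (hA.idem t).eq])
    (by rw [← map_smul, ← map_smul, ← mul_smul (e t) (e t), (hA.idem t).eq]) hw0
  have hk0 : k ≠ 0 := by
    rintro rfl
    rw [zero_smul, hα] at hk
    exact hβ hk
  -- The composite acts on the line e_t P(b) by the nonzero scalar k, so it is not nilpotent.
  have hbij : Function.Bijective (β.comp α) := by
    refine (bijective_or_nilpotent K (hA.primitive b) (β.comp α)).resolve_right ?_
    rintro ⟨m, hm⟩
    have hpow : ∀ m : ℕ, ((β.comp α : Module.End A (P e b)) ^ m) (e t • a • projGen e b) =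
        k ^ m • (e t • a • projGen e b) := by
      intro m
      induction m with
      | zero => simp
      | succ m ih =>
        rw [pow_succ, Module.End.mul_apply, LinearMap.comp_apply, hk, ← algebraMap_smul A k,
          map_smul, ih, algebraMap_smul, ← mul_smul, pow_succ']
    have := hpow m
    rw [hm, LinearMap.zero_apply] at this
    exact (smul_ne_zero (pow_ne_zero m hk0) hw0) this.symm
  have hαi : Function.Injective α := by
    have := hbij.1
    rw [LinearMap.coe_comp] at this
    exact this.of_comp
  refine ⟨LinearEquiv.ofBijective α ⟨hαi, ?_⟩⟩
  have hcompl : IsCompl (LinearMap.range α) (LinearMap.ker β) := by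
    constructor
    · rw [Submodule.disjoint_def]
      rintro _ ⟨y, rfl⟩ hy
      have : (β.comp α) y = (β.comp α) 0 := by rw [map_zero]; exact hy
      rw [hbij.1 this, map_zero]
    · rw [codisjoint_iff, eq_top_iff]
      rintro y -
      obtain ⟨w, hw⟩ := hbij.2 (β y)
      rw [← add_sub_cancel (α w) y]
      refine Submodule.add_mem_sup ⟨w, rfl⟩ ?_
      rw [LinearMap.mem_ker, map_sub, ← hw]
      exact sub_self _
  rcases hM.indecomposable.2 _ _ hcompl with h0 | h0
  · exfalso
    refine ha ?_
    rw [← hα]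
    have : α (e t • a • projGen e b) ∈ LinearMap.range α := ⟨_, rfl⟩
    rwa [h0, Submodule.mem_bot] at this
  · rw [← LinearMap.range_eq_top]
    have := hcompl.sup_eq_top
    rwa [h0, sup_bot_eq] at this

end Tilting

/-! ### Local tilting modules -/

section LocalTilting

variable {K : Type*} [Field K] {A : Type*} [Ring A] [Algebra K A] [Module.Finite K A] {ι : Type*}
  [Fintype ι] [PartialOrder ι] {e : ι → A}

open Classical in
theorem IsTiltingSummand.edim_bot (hA : IsOneQuasiHereditary K e) {b : ι} (hb : IsBot b) {i : ι}
    {M : Type*} [AddCommGroup M] [Module K M] [Module A M] [IsScalarTower K A M]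
    (hM : IsTiltingSummand K e i M) (h : Nonempty (M ≃ₗ[A] (P e b ⧸ sumProj e b i))) :
    edim K (e b) M = ∑ j, if j ≤ i then 1 else 0 := by
  have h1 : ∑ j, (if j ≤ i then edim K (e b) (Std K e j) else 0) = ∑ j, if j ≤ i then 1 else 0 :=
    Finset.sum_congr rfl fun j _ => by rw [edim_std hA, if_pos (hb j)]
  obtain ⟨φ⟩ := h
  refine le_antisymm ?_ ?_
  · rw [edim_eq_of_equiv K (e b) φ, ← h1]
    exact edim_quotient_sumProj_le hA hb i (hA.idem b)
  · rw [← h1]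
    exact hM.le_edim hA (hA.idem b)

/-- As dim e_b M = #{j ≤ i} and every ∇(j), j ≤ i, contributes at least 1, the factor ∇(b) occurs
exactly once. Its projection extends to f : M → I(b). A simple submodule of M is S(b), and the socle
of ∇(j) is S(j), so it first appears at the step labelled b, where f does not kill it. -/
theorem IsTiltingSummand.exists_embedding (hA : IsOneQuasiHereditary K e) {b : ι} (hb : IsBot b)
    {i : ι} {M : Type*} [AddCommGroup M] [Module K M] [Module A M] [IsScalarTower K A M]
    (hM : IsTiltingSummand K e i M) (h : Nonempty (M ≃ₗ[A] (P e b ⧸ sumProj e b i))) :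
    ∃ f : M →ₗ[A] I K e b, Function.Injective f := by
  classical
  have := hM.finite
  obtain ⟨𝓖⟩ := hM.costd_good
  have hle : ∀ j ∈ Finset.univ, (if j ≤ i then 1 else 0) ≤
      𝓖.count j * edim K (e b) (Costd K e j) := by
    intro j _
    split_ifs with hj
    · refine Nat.mul_pos (Nat.pos_of_ne_zero (hM.costd_count_ne_zero hA 𝓖 hj))
        (Nat.pos_of_ne_zero fun h0 => ?_)
      obtain ⟨x, hx⟩ := costd_exists_smul_ne_zero hA (hb j)
      exact hx ((edim_eq_zero_iff K (e b)).1 h0 x)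
    · exact Nat.zero_le _
  have hsum := (hM.edim_bot hA hb h).symm.trans (𝓖.edim_eq' K (hA.idem b))
  have hcount := (Finset.sum_eq_sum_iff_of_le hle).1 hsum b (Finset.mem_univ b)
  rw [if_pos (hb i)] at hcount
  have hcount1 : 𝓖.count b = 1 := Nat.eq_one_of_mul_eq_one_right hcount.symm
  obtain ⟨hsub, ⟨t, ht⟩⟩ := Nat.card_eq_one_iff_unique.1 hcount1
  obtain ⟨p, f, hps, hp, hf⟩ := 𝓖.exists_map_to_I hA t ht
  refine ⟨f, (injective_iff_map_eq_zero f).2 fun x hx => ?_⟩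
  by_contra hx0
  have : IsArtinian A M := isArtinian_of_tower K inferInstance
  obtain ⟨S, hS, hSx⟩ := (eq_bot_or_exists_atom_le (Submodule.span A {x})).resolve_left
    (fun h => hx0 (Submodule.span_singleton_eq_bot.1 h))
  have hSs : IsSimpleModule A S := isSimpleModule_iff_isAtom.2 hS
  have hSf : S ≤ LinearMap.ker f := hSx.trans (by
    rw [Submodule.span_singleton_le_iff_mem]; exact hx)
  have hdet := (hM.isDetectedBy hA hb).of_injective S.subtype S.injective_subtype
  have := hSs.nontrivial
  obtain ⟨y, hy0⟩ := exists_ne (0 : S)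
  obtain ⟨a, ha⟩ := hdet y hy0
  rw [mul_smul] at ha
  obtain ⟨s, hs1, hs2⟩ := 𝓖.exists_step_mem (x := y.1) fun h => hy0 (Subtype.ext h)
  obtain ⟨q, hq⟩ := 𝓖.exists_proj s
  have hq0 : q ⟨y.1, hs2⟩ ≠ 0 := fun h0 => hs1 ((hq.2 _).1 h0)
  obtain ⟨c, hc⟩ := costd_isDetectedBy K (𝓖.label s) _ hq0
  have hl : e (𝓖.label s) • c • y ≠ 0 := by
    intro h0
    apply hc
    have h1 : e (𝓖.label s) • c • y.1 = 0 := congrArg Subtype.val h0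
    rw [← map_smul, mul_smul, show e (𝓖.label s) • c • (⟨y.1, hs2⟩ : 𝓖.F s.succ) = 0 from
      Subtype.ext h1, map_zero]
  have hlb := hA.eq_of_simple hl ha
  have hst : (⟨s, hlb⟩ : {t // 𝓖.label t = b}) = ⟨t, ht⟩ := hsub.elim _ _
  obtain rfl : s = t := congrArg Subtype.val hst
  refine hs1 ((hp ⟨y.1, hs2⟩).1 (Subtype.ext ?_))
  rw [← hf]
  exact hSf y.2

variable (K e) in
/-- A family of modules `T(i)` which are at the same time quotients of `P(b)` and submodules of
`I(b)`, and the images `θ(i)` of whose generators `x(i)` form a triangular basis of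
`e_b I(b)`. -/
structure CyclicFamily (b : ι) (T : ι → Type*) [∀ i, AddCommGroup (T i)] [∀ i, Module K (T i)]
    [∀ i, Module A (T i)] where
  /-- the generator of `T(i)` -/
  x : ∀ i, T i
  /-- the embedding of `T(i)` -/
  u : ∀ i, T i →ₗ[A] I K e b
  idem : ∀ i, e b • x i = x i
  span : ∀ i, Submodule.span A {x i} = ⊤
  lift : ∀ i k (y : T k), e b • y = y → (∀ l, ¬ l ≤ i → ∀ a : A, e l • a • y = 0) →
    ∃ f : T i →ₗ[A] T k, f (x i) = y
  inj : ∀ i, Function.Injective (u i)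
  supp : ∀ i l, ¬ l ≤ i → ∀ y : T i, e l • y = 0
  self : ∀ i, ∃ y : T i, e i • y ≠ 0
  coord : ∀ i (y : I K e b), e b • y = y → (∀ l, ¬ l ≤ i → ∀ a : A, e l • a • y = 0) →
    ∃ c : ι → K, (∀ j, ¬ j ≤ i → c j = 0) ∧ y = ∑ j, c j • u j (x j)
  mem : ∀ i j, j ≤ i → u j (x j) ∈ LinearMap.range (u i)

/-- The triangularity argument. -/
theorem coeff_eq_zero_of_sum_eq_zero {V : Type*} [AddCommGroup V] [Module K V] [Module A V]
    [IsScalarTower K A V] (θ : ι → V) (hsupp : ∀ i l, ¬ l ≤ i → ∀ a : A, e l • a • θ i = 0)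
    (hself : ∀ i, ∃ a : A, e i • a • θ i ≠ 0) {c : ι → K} (Q : ι → Prop)
    (h : ∀ l, Q l → ∀ a : A, e l • a • ∑ j, c j • θ j = 0)
    (hQ : ∀ l m, Q l → l ≤ m → Q m) (l : ι) (hl : Q l) : c l = 0 := by
  classical
  by_contra hne
  -- Apply e_m a for a maximal m: the terms with j > m have coefficient zero, those with m ≰ j are
  -- killed by e_m, and only θ(m) is left.
  obtain ⟨m, hm⟩ := (Set.toFinite {j | Q j ∧ c j ≠ 0}).exists_maximal ⟨l, hl, hne⟩
  obtain ⟨a, ha⟩ := hself m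
  have h1 := h m hm.1.1 a
  rw [Finset.smul_sum, Finset.smul_sum, Finset.sum_eq_single m] at h1
  · rw [smul_comm a, smul_comm (e m)] at h1
    exact hm.1.2 ((smul_eq_zero.1 h1).resolve_right ha)
  · intro j _ hj
    rw [smul_comm a, smul_comm (e m)]
    by_cases hmj : m ≤ j
    · have : c j = 0 := by
        by_contra hcj
        exact hj (le_antisymm (hm.2 ⟨hQ m j hm.1.1 hmj, hcj⟩ hmj) hmj)
      rw [this, zero_smul]
    · rw [hsupp j m hmj, smul_zero]
  · exact fun h => absurd (Finset.mem_univ m) h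

open Classical in
theorem sum_dite_smul {V : Type*} [AddCommGroup V] [Module K V] (p : ι → Prop)
    (g : {j // p j} → K) (θ : ι → V) :
    ∑ k, (if hk : p k then g ⟨k, hk⟩ else 0) • θ k = ∑ j : {j // p j}, g j • θ j := by
  rw [← Fintype.sum_subtype_add_sum_subtype p, Finset.sum_eq_zero (s := Finset.univ (α := {x // ¬ p x}))
    (fun k _ => by rw [dif_neg k.2, zero_smul]), add_zero]
  exact Finset.sum_congr rfl fun k _ => by rw [dif_pos k.2]

/-- The evaluation of homomorphisms `M → I(i)` at an element. -/
def evalI (K : Type*) [Field K] {A : Type*} [Ring A] [Algebra K A] {ι : Type*} (e : ι → A) (i : ι)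
    {M : Type*} [AddCommGroup M] [Module A M] (x : M) : (M →ₗ[A] I K e i) →ₗ[K] I K e i where
  toFun f := f x
  map_add' _ _ := rfl
  map_smul' _ _ := rfl

/-- Hom(M, I(i)) embeds in the dual of e_i M. -/
theorem finrank_range_eval_le {i : ι} {M : Type*} [AddCommGroup M]
    [Module K M] [Module A M] [IsScalarTower K A M] [Module.Finite K M] (x : M) :
    Module.finrank K (LinearMap.range (evalI K e i x)) ≤ edim K (e i) M := by
  let Φ : (M →ₗ[A] I K e i) →ₗ[K]
      Module.Dual K (LinearMap.range (Algebra.lsmul K K M (e i))) :=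
    { toFun f := formOfI f ∘ₗ Submodule.subtype _
      map_add' _ _ := rfl
      map_smul' _ _ := rfl }
  have hΦ : Function.Injective Φ := by
    rw [injective_iff_map_eq_zero]
    intro f hf
    refine LinearMap.ext fun m => Subtype.ext (KDual.ext fun a => ?_)
    rw [I_apply, mul_smul]
    exact LinearMap.congr_fun hf ⟨e i • a • m, ⟨a • m, rfl⟩⟩
  have : Module.Finite K (M →ₗ[A] I K e i) := Module.Finite.of_injective Φ hΦ
  refine (LinearMap.finrank_range_le _).trans ((LinearMap.finrank_le_finrank_of_injective hΦ).trans ?_)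
  rw [Subspace.dual_finrank_eq]
  rfl

/-- Y(i) is the space of vectors in e_b I(b) generating submodules supported at vertices ≤ i. It
contains W(i), the image of e_b T(i), whose dimension is #{j ≤ i}. Proving W(i) = Y(i) makes Y(i)
independent of the chosen embeddings and lets T(j) sit inside T(i) for j ≤ i. -/
theorem exists_cyclicFamily (hA : IsOneQuasiHereditary K e) {b : ι} (hb : IsBot b)
    {T : ι → Type*} [∀ i, AddCommGroup (T i)] [∀ i, Module K (T i)] [∀ i, Module A (T i)]
    [∀ i, IsScalarTower K A (T i)] (hT : ∀ i, IsTiltingSummand K e i (T i))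
    (h : ∀ i, Nonempty (T i ≃ₗ[A] (P e b ⧸ sumProj e b i))) :
    Nonempty (CyclicFamily K e b T) := by
  classical
  have hfin : ∀ i, Module.Finite K (T i) := fun i => (hT i).finite
  have φ : ∀ i, T i ≃ₗ[A] (P e b ⧸ sumProj e b i) := fun i => (h i).some
  choose u hu using fun i => (hT i).exists_embedding hA hb (h i)
  let x : ∀ i, T i := fun i => (φ i).symm ((sumProj e b i).mkQ (projGen e b))
  have hgen : e b • projGen e b = projGen e b := smul_projGen (hA.idem b) (projGen e b)
  have hidem : ∀ i, e b • x i = x i := fun i => by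
    rw [← map_smul, ← map_smul, hgen]
  have hspan : ∀ i, Submodule.span A {x i} = ⊤ := fun i => by
    have : Submodule.span A {x i} = ((⊤ : Submodule A (P e b)).map (sumProj e b i).mkQ).map
        (φ i).symm.toLinearMap := by
      rw [← span_projGen, Submodule.map_span, Submodule.map_span, Set.image_singleton,
        Set.image_singleton]
      rfl
    rw [this, Submodule.map_top, Submodule.range_mkQ, Submodule.map_top, LinearEquiv.range]
  have hsupp : ∀ i l, ¬ l ≤ i → ∀ y : T i, e l • y = 0 := fun i l hl y => (hT i).smul_eq_zero hl y
  have hself : ∀ i, ∃ y : T i, e i • y ≠ 0 := fun i => by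
    by_contra! hcon
    have h1 := (edim_eq_zero_iff K (e i)).2 hcon
    rw [show edim K (e i) (T i) = 1 from (hT i).jh_self] at h1
    exact one_ne_zero h1
  let Y : ι → Submodule K (I K e b) := fun i =>
    { carrier := {y | e b • y = y ∧ ∀ l, ¬ l ≤ i → ∀ a : A, e l • a • y = 0}
      zero_mem' := ⟨smul_zero _, fun l _ a => by rw [smul_zero, smul_zero]⟩
      add_mem' := fun {y z} hy hz => ⟨by rw [smul_add, hy.1, hz.1], fun l hl a => by
        rw [smul_add, smul_add, hy.2 l hl, hz.2 l hl, add_zero]⟩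
      smul_mem' := fun c y hy => ⟨by rw [smul_comm, hy.1], fun l hl a => by
        rw [smul_comm a c, smul_comm (e l) c, hy.2 l hl, smul_zero]⟩ }
  let W : ∀ i, Submodule K (I K e b) := fun i =>
    (LinearMap.range (Algebra.lsmul K K (T i) (e b))).map ((u i).restrictScalars K)
  have hWY : ∀ i, W i ≤ Y i := by
    rintro i _ ⟨_, ⟨y, rfl⟩, rfl⟩
    refine ⟨?_, fun l hl a => ?_⟩
    · change e b • u i (e b • y) = u i (e b • y)
      rw [← map_smul, ← mul_smul, (hA.idem b).eq]
    · change e l • a • u i (e b • y) = 0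
      rw [← map_smul, ← map_smul, hsupp i l hl, map_zero]
  have hWd : ∀ i, Module.finrank K (W i) = ∑ j, if j ≤ i then 1 else 0 := fun i => by
    rw [← (hT i).edim_bot hA hb (h i)]
    exact (Submodule.equivMapOfInjective ((u i).restrictScalars K) (hu i) _).finrank_eq.symm
  -- By the universal property each y in Y(i) is the value at x(i) of a map T(i) → I(b), and such
  -- values span at most dim e_b T(i) dimensions.
  have hYd : ∀ i, Module.finrank K (Y i) ≤ ∑ j, if j ≤ i then 1 else 0 := fun i => by
    rw [← (hT i).edim_bot hA hb (h i)]
    refine (Submodule.finrank_mono ?_).trans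
      (finrank_range_eval_le (K := K) (x i))
    rintro y ⟨hy, hl⟩
    obtain ⟨f, hf⟩ := exists_map_of_sumProj hA hb hy hl
    refine ⟨f.comp (φ i).toLinearMap, ?_⟩
    rw [← hf]
    exact congrArg f ((φ i).apply_symm_apply _)
  have hWY' : ∀ i, W i = Y i := fun i =>
    Submodule.eq_of_le_of_finrank_le (hWY i) ((hYd i).trans (hWd i).ge)
  have hθY : ∀ i j, j ≤ i → u j (x j) ∈ Y i := fun i j hj =>
    ⟨by rw [← map_smul, hidem], fun l hl a => by
      rw [← map_smul, ← map_smul, hsupp j l (fun h => hl (h.trans hj)), map_zero]⟩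
  have hmem : ∀ i j, j ≤ i → u j (x j) ∈ LinearMap.range (u i) := fun i j hj => by
    have := hθY i j hj
    rw [← hWY' i] at this
    obtain ⟨y, -, hy⟩ := this
    exact ⟨y, hy⟩
  have hselfθ : ∀ i, ∃ a : A, e i • a • u i (x i) ≠ 0 := fun i => by
    obtain ⟨y, hy⟩ := hself i
    obtain ⟨a, rfl⟩ := Submodule.mem_span_singleton.1
      (show y ∈ Submodule.span A {x i} by rw [hspan]; trivial)
    refine ⟨a, fun h0 => hy (hu i ?_)⟩
    rw [map_smul, map_smul, h0, map_zero]
  have hsuppθ : ∀ i l, ¬ l ≤ i → ∀ a : A, e l • a • u i (x i) = 0 := fun i => (hθY i i le_rfl).2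
  have hcoord : ∀ i, ∀ y ∈ Y i, ∃ c : ι → K, (∀ j, ¬ j ≤ i → c j = 0) ∧
      y = ∑ j, c j • u j (x j) := by
    intro i
    -- The θ(j) with j ≤ i are independent by triangularity, and there are dim Y(i) of them.
    let v : {j // j ≤ i} → Y i := fun j => ⟨u j (x j), hθY i j j.2⟩
    have hli : LinearIndependent K v := by
      rw [Fintype.linearIndependent_iff]
      intro g hg j
      have h1 : ∑ k, (if hk : k ≤ i then g ⟨k, hk⟩ else 0) • u k (x k) = 0 := by
        have h2 := congrArg Subtype.val hg
        rw [Submodule.coe_sum] at h2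
        rw [sum_dite_smul]
        exact h2
      have h2 := coeff_eq_zero_of_sum_eq_zero (e := e) (fun k => u k (x k)) hsuppθ hselfθ
        (fun _ => True) (fun l _ a => by rw [h1, smul_zero, smul_zero]) (fun _ _ _ _ => trivial)
        j.1 trivial
      rwa [dif_pos j.2] at h2
    have hcard : Fintype.card {j // j ≤ i} = Module.finrank K (Y i) := by
      rw [← hWY' i, hWd, Fintype.card_subtype, Finset.card_filter]
    intro y hy
    have hy' : (⟨y, hy⟩ : Y i) ∈ Submodule.span K (Set.range v) := by
      rw [hli.span_eq_top_of_card_eq_finrank' hcard]; trivial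
    obtain ⟨g, hg⟩ := (Submodule.mem_span_range_iff_exists_fun K).1 hy'
    refine ⟨fun k => if hk : k ≤ i then g ⟨k, hk⟩ else 0, fun j hj => dif_neg hj, ?_⟩
    rw [sum_dite_smul]
    have h2 := congrArg Subtype.val hg
    rw [Submodule.coe_sum] at h2
    exact h2.symm
  exact ⟨⟨x, u, hidem, hspan, fun i k y hy hl => by
    obtain ⟨f, hf⟩ := exists_map_of_sumProj hA hb hy hl
    refine ⟨f.comp (φ i).toLinearMap, ?_⟩
    rw [← hf]
    exact congrArg f ((φ i).apply_symm_apply _), hu, hsupp, hself,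
    fun i y hy hl => hcoord i y ⟨hy, hl⟩, hmem⟩⟩

end LocalTilting

/-! ### Endomorphism rings of direct sums -/

section RingelBasics

variable (K : Type*) [Field K] {A : Type*} [Ring A] [Algebra K A] {ι : Type*}
  (T : ι → Type*) [∀ i, AddCommGroup (T i)] [∀ i, Module K (T i)] [∀ i, Module A (T i)]
  [∀ i, IsScalarTower K A (T i)]

theorem finite_ringelDual [Fintype ι] [∀ i, Module.Finite K (T i)] :
    Module.Finite K (RingelDual A T) := by
  have : Module.Finite K (Module.End A (∀ i, T i)) :=
    Module.Finite.of_injective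
      (LinearMap.restrictScalarsₗ K A (∀ i, T i) (∀ i, T i) K)
      (LinearMap.restrictScalars_injective K)
  exact Module.Finite.equiv (MulOpposite.opLinearEquiv K)

open Classical in
/-- The element of the Ringel dual given by a homomorphism `T(k) → T(i)`. -/
def elem (k i : ι) : (T k →ₗ[A] T i) →ₗ[K] RingelDual A T where
  toFun f := MulOpposite.op ((LinearMap.single A T i).comp (f.comp (LinearMap.proj k)))
  map_add' f g := by
    rw [← MulOpposite.op_add, LinearMap.add_comp, LinearMap.comp_add]
  map_smul' c f := by
    rw [RingHom.id_apply, ← MulOpposite.op_smul]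
    congr 1
    refine LinearMap.ext fun v => ?_
    change LinearMap.single A T i (c • f (v k)) = c • LinearMap.single A T i (f (v k))
    rw [← algebraMap_smul A c, map_smul, algebraMap_smul]

variable {T}

open Classical in
/-- The component `T(k) → T(i)` of an element of the Ringel dual. -/
def cmp (x : RingelDual A T) (k i : ι) : T k →ₗ[A] T i :=
  (LinearMap.proj i).comp (x.unop.comp (LinearMap.single A T k))

open Classical in
theorem elem_unop_apply {k i : ι} (f : T k →ₗ[A] T i) (v : ∀ i, T i) :
    (elem K T k i f).unop v = LinearMap.single A T i (f (v k)) := rfl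

theorem elem_unop_apply_self {k i : ι} (f : T k →ₗ[A] T i) (v : ∀ i, T i) :
    (elem K T k i f).unop v i = f (v k) := by
  classical
  exact Pi.single_eq_same (M := T) i (f (v k))

theorem elem_injective (k i : ι) : Function.Injective (elem (A := A) K T k i) := by
  classical
  intro f g h
  refine LinearMap.ext fun y => ?_
  have h1 := congrArg (fun r : RingelDual A T => r.unop (LinearMap.single A T k y) i) h
  rw [elem_unop_apply_self, elem_unop_apply_self] at h1
  simpa using h1

theorem elem_mul_elem {k i j : ι} (f : T k →ₗ[A] T i) (g : T i →ₗ[A] T j) :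
    elem K T k i f * elem K T i j g = elem K T k j (g.comp f) := by
  classical
  refine MulOpposite.unop_injective (LinearMap.ext fun v => ?_)
  change (elem K T i j g).unop ((elem K T k i f).unop v) = _
  rw [elem_unop_apply, elem_unop_apply_self, elem_unop_apply]
  rfl

theorem isIdempotentElem_ringelIdem (i : ιᵒᵈ) : IsIdempotentElem (ringelIdem A T i) := by
  classical
  refine MulOpposite.unop_injective (LinearMap.ext fun v => ?_)
  change (ringelIdem A T i).unop ((ringelIdem A T i).unop v) = _
  exact congrArg (LinearMap.single A T (OrderDual.ofDual i))
    (Pi.single_eq_same (OrderDual.ofDual i) _)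

theorem ringelIdem_complete [Fintype ι] : CompleteOrthogonalIdempotents (ringelIdem A T) where
  idem := isIdempotentElem_ringelIdem
  ortho i j hij := by
    refine MulOpposite.unop_injective (LinearMap.ext fun v => ?_)
    funext k
    have h : OrderDual.ofDual j ≠ OrderDual.ofDual i := fun h => hij h.symm
    change (ringelIdem A T j).unop ((ringelIdem A T i).unop v) k = 0
    classical
    have h1 : (ringelIdem A T i).unop v (OrderDual.ofDual j) = 0 := Pi.single_eq_of_ne h _
    have h2 : (ringelIdem A T j).unop ((ringelIdem A T i).unop v) =
      LinearMap.single A T (OrderDual.ofDual j) ((ringelIdem A T i).unop v (OrderDual.ofDual j)) := rfl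
    rw [h2, h1, map_zero]
    rfl
  complete := by
    classical
    refine MulOpposite.unop_injective (LinearMap.ext fun v => ?_)
    rw [Finset.unop_sum, LinearMap.sum_apply]
    funext k
    rw [Finset.sum_apply, Finset.sum_eq_single (OrderDual.toDual k)]
    · exact Pi.single_eq_same (M := T) k (v k)
    · intro i _ hi
      exact Pi.single_eq_of_ne (M := T) (fun h => hi (congrArg OrderDual.toDual h).symm)
        (v (OrderDual.ofDual i))
    · exact fun h => absurd (Finset.mem_univ _) h

end RingelBasics

/-! ### Rings of matrices of homomorphisms -/

section HomRing

/-- The ring `R` consists of the matrices of homomorphisms between the modules `T(i)`, with the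
opposite of the usual multiplication, and the `ε(i)` are the diagonal idempotents. -/
structure HomRing (K : Type*) [Field K] {A : Type*} [Ring A] [Algebra K A] {ι : Type*} [Fintype ι]
    (T : ι → Type*) [∀ i, AddCommGroup (T i)] [∀ i, Module K (T i)] [∀ i, Module A (T i)]
    [∀ i, IsScalarTower K A (T i)] {R : Type*} [Ring R] [Algebra K R] (ε : ιᵒᵈ → R) where
  /-- the matrix with one entry -/
  el : ∀ k i : ι, (T k →ₗ[A] T i) →ₗ[K] R
  /-- the entries of a matrix -/
  cmp : R → ∀ k i : ι, T k →ₗ[A] T i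
  el_injective : ∀ k i, Function.Injective (el k i)
  el_mul : ∀ {k i j : ι} (f : T k →ₗ[A] T i) (g : T i →ₗ[A] T j),
    el k i f * el i j g = el k j (g.comp f)
  el_id : ∀ i, el i i LinearMap.id = ε (OrderDual.toDual i)
  idem_mul_idem : ∀ (x : R) (k i : ι),
    ε (OrderDual.toDual k) * x * ε (OrderDual.toDual i) = el k i (cmp x k i)
  complete : CompleteOrthogonalIdempotents ε

/-- The Ringel dual is a ring of matrices of homomorphisms. -/
def ringelHomRing (K : Type*) [Field K] {A : Type*} [Ring A] [Algebra K A] {ι : Type*} [Fintype ι]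
    (T : ι → Type*) [∀ i, AddCommGroup (T i)] [∀ i, Module K (T i)] [∀ i, Module A (T i)]
    [∀ i, IsScalarTower K A (T i)] : HomRing (A := A) K T (ringelIdem A T) where
  el := elem K T
  cmp := cmp
  el_injective := elem_injective K
  el_mul := elem_mul_elem K
  el_id _ := rfl
  idem_mul_idem _ _ _ := rfl
  complete := ringelIdem_complete

variable {K : Type*} [Field K] {A : Type*} [Ring A] [Algebra K A] {ι : Type*} [Fintype ι]
  {T : ι → Type*} [∀ i, AddCommGroup (T i)] [∀ i, Module K (T i)] [∀ i, Module A (T i)]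
  [∀ i, IsScalarTower K A (T i)] {R : Type*} [Ring R] [Algebra K R] {ε : ιᵒᵈ → R}

theorem HomRing.idem_mul_el (H : HomRing (A := A) K T ε) {k i : ι} (f : T k →ₗ[A] T i) :
    ε (OrderDual.toDual k) * H.el k i f = H.el k i f := by
  rw [← H.el_id, H.el_mul, LinearMap.comp_id]

theorem HomRing.el_mul_idem (H : HomRing (A := A) K T ε) {k i : ι} (f : T k →ₗ[A] T i) :
    H.el k i f * ε (OrderDual.toDual i) = H.el k i f := by
  rw [← H.el_id, H.el_mul, LinearMap.id_comp]

theorem HomRing.mem_P (H : HomRing (A := A) K T ε) {x : R} {i : ι} :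
    x ∈ P ε (OrderDual.toDual i) ↔
      x * ε (OrderDual.toDual i) = x := by
  constructor
  · intro h
    exact mul_eq_of_mem_span (H.complete.idem _) h
  · intro h
    exact Submodule.mem_span_singleton.2 ⟨x, h⟩

theorem HomRing.el_mem_P (H : HomRing (A := A) K T ε) {k i : ι} (f : T k →ₗ[A] T i) :
    H.el k i f ∈ P ε (OrderDual.toDual i) :=
  H.mem_P.2 (H.el_mul_idem f)

/-- A homomorphism `T(k) → T(i)`, as an element of `P(i)`. -/
def HomRing.pel (H : HomRing (A := A) K T ε) {k i : ι} (f : T k →ₗ[A] T i) : P ε (OrderDual.toDual i) :=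
  ⟨H.el k i f, H.el_mem_P f⟩

theorem HomRing.smul_eq_pel (H : HomRing (A := A) K T ε) {k i : ι} (x : P ε (OrderDual.toDual i)) :
    ε (OrderDual.toDual k) • x = H.pel (H.cmp x.1 k i) := by
  refine Subtype.ext ?_
  change ε (OrderDual.toDual k) * x.1 = H.el k i (H.cmp x.1 k i)
  rw [← H.idem_mul_idem, mul_assoc, H.mem_P.1 x.2]

theorem HomRing.el_smul_pel (H : HomRing (A := A) K T ε) {k m i : ι} (f : T k →ₗ[A] T m) (g : T m →ₗ[A] T i) :
    H.el k m f • H.pel g = H.pel (g.comp f) :=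
  Subtype.ext (H.el_mul f g)

theorem HomRing.sum_smul (H : HomRing (A := A) K T ε) {M : Type*} [AddCommGroup M] [Module R M]
    (x : M) : ∑ k : ι, ε (OrderDual.toDual k) • x = x := by
  rw [← Finset.sum_smul]
  have := H.complete.complete
  have h2 : ∑ k : ι, ε (OrderDual.toDual k) = 1 := by
    rw [← this]
    exact Fintype.sum_equiv OrderDual.toDual _ _ fun _ => rfl
  rw [h2, one_smul]

/-- A decomposition N ⊕ N' writes the identity of T(i) as f + f' with f in N and f' in N'. Since f'
f = f f' lies in both, it vanishes, so f is an idempotent endomorphism of T(i). -/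
theorem HomRing.isIndecomposable (H : HomRing (A := A) K T ε) {i : ι} (h : IsIndecomposable A (T i)) :
    IsIndecomposable R (P ε (OrderDual.toDual i)) := by
  have := h.1
  have hgen : ∀ N : Submodule R (P ε (OrderDual.toDual i)),
      H.pel (LinearMap.id : T i →ₗ[A] T i) ∈ N → N = ⊤ := by
    intro N hN
    rw [eq_top_iff, ← span_projGen, Submodule.span_singleton_le_iff_mem,
      ← show H.pel (LinearMap.id : T i →ₗ[A] T i) = projGen ε (OrderDual.toDual i) from
        Subtype.ext (H.el_id i)]
    exact hN
  have hinj : Function.Injective (fun f : T i →ₗ[A] T i => H.pel f) := fun f g hfg =>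
    H.el_injective i i (congrArg Subtype.val hfg)
  refine ⟨⟨H.pel (LinearMap.id : T i →ₗ[A] T i), 0, fun h0 => ?_⟩, fun N N' hN => ?_⟩
  · have h1 : (LinearMap.id : T i →ₗ[A] T i) = 0 := hinj (h0.trans (by
      exact (Subtype.ext (map_zero (H.el i i)).symm)))
    obtain ⟨y, hy⟩ := exists_ne (0 : T i)
    exact hy (LinearMap.congr_fun h1 y)
  · obtain ⟨n, hn, n', hn', hsum⟩ := Submodule.mem_sup.1
      (show H.pel (LinearMap.id : T i →ₗ[A] T i) ∈ N ⊔ N' by rw [hN.sup_eq_top]; trivial)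
    have hsum' := congrArg (ε (OrderDual.toDual i) • ·) hsum
    simp only [smul_add] at hsum'
    rw [H.smul_eq_pel n, H.smul_eq_pel n'] at hsum'
    rw [show ε (OrderDual.toDual i) • H.pel (LinearMap.id : T i →ₗ[A] T i) =
      H.pel (LinearMap.id : T i →ₗ[A] T i) from Subtype.ext (H.idem_mul_el _)] at hsum'
    have hf : H.pel (H.cmp n.1 i i) ∈ N := by
      rw [← H.smul_eq_pel]; exact N.smul_mem _ hn
    have hf' : H.pel (H.cmp n'.1 i i) ∈ N' := by
      rw [← H.smul_eq_pel]; exact N'.smul_mem _ hn'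
    generalize H.cmp n.1 i i = f at hf hsum'
    generalize H.cmp n'.1 i i = f' at hf' hsum'
    have hadd : f + f' = LinearMap.id := hinj (Subtype.ext (by
      change H.el i i (f + f') = _
      rw [map_add]
      exact congrArg Subtype.val hsum'))
    have hf'e : f' = LinearMap.id - f := eq_sub_of_add_eq' hadd
    have hzero : H.pel (f'.comp f) = 0 := by
      refine (Submodule.disjoint_def.1 hN.disjoint) _ ?_ ?_
      · have : f'.comp f = f.comp f' := by
          rw [hf'e, LinearMap.sub_comp, LinearMap.comp_sub, LinearMap.id_comp, LinearMap.comp_id]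
        rw [this, ← H.el_smul_pel]
        exact N.smul_mem _ hf
      · rw [← H.el_smul_pel]
        exact N'.smul_mem _ hf'
    have hcomp : f'.comp f = 0 := hinj (hzero.trans (Subtype.ext (map_zero (H.el i i)).symm))
    have hff : ∀ y, f (f y) = f y := by
      intro y
      have := LinearMap.congr_fun hcomp y
      rw [hf'e] at this
      change f y - f (f y) = 0 at this
      exact (sub_eq_zero.1 this).symm
    have hcompl : IsCompl (LinearMap.range f) (LinearMap.ker f) := by
      constructor
      · rw [Submodule.disjoint_def]
        rintro _ ⟨y, rfl⟩ hy
        rw [← hff]; exact hy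
      · rw [codisjoint_iff, eq_top_iff]
        rintro y -
        rw [← add_sub_cancel (f y) y]
        refine Submodule.add_mem_sup ⟨y, rfl⟩ ?_
        rw [LinearMap.mem_ker, map_sub, hff, sub_self]
    rcases h.2 _ _ hcompl with h0 | h0
    · left
      have hf0 : f = 0 := LinearMap.range_eq_bot.1 h0
      rw [hf0, sub_zero] at hf'e
      have htop := hgen N' (hf'e ▸ hf')
      have := hN.inf_eq_bot
      rwa [htop, inf_top_eq] at this
    · right
      have hf1 : f = LinearMap.id := LinearMap.ext fun y => LinearMap.ker_eq_bot.1 h0 (hff y)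
      have htop := hgen N (hf1 ▸ hf)
      have := hN.inf_eq_bot
      rwa [htop, top_inf_eq] at this

/-- By Yoneda, the isomorphism and its inverse come from maps g and g' between T(i) and T(j); g' ∘ g
= id suffices here. -/
theorem HomRing.exists_embedding (H : HomRing (A := A) K T ε) {i j : ι}
    (h : Nonempty (P ε (OrderDual.toDual i) ≃ₗ[R]
      P ε (OrderDual.toDual j))) :
    ∃ f : T i →ₗ[A] T j, Function.Injective f := by
  obtain ⟨φ⟩ := h
  have hidem : ∀ k : ι, ε (OrderDual.toDual k) • H.pel (LinearMap.id : T k →ₗ[A] T k)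
      = H.pel (LinearMap.id : T k →ₗ[A] T k) := fun k => Subtype.ext (H.idem_mul_el _)
  have h1 : φ (H.pel LinearMap.id) = H.pel (H.cmp (φ (H.pel LinearMap.id)).1 i j) := by
    rw [← H.smul_eq_pel, ← map_smul, hidem]
  have h2 : φ.symm (H.pel LinearMap.id) =
      H.pel (H.cmp (φ.symm (H.pel LinearMap.id)).1 j i) := by
    rw [← H.smul_eq_pel, ← map_smul, hidem]
  generalize H.cmp (φ (H.pel LinearMap.id)).1 i j = g at h1
  generalize H.cmp (φ.symm (H.pel LinearMap.id)).1 j i = g' at h2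
  have h3 := congrArg φ.symm h1
  rw [φ.symm_apply_apply, ← LinearMap.id_comp g, ← H.el_smul_pel, map_smul, h2,
    H.el_smul_pel] at h3
  have h4 : g'.comp g = LinearMap.id := (H.el_injective i i (congrArg Subtype.val h3)).symm
  exact ⟨g, Function.LeftInverse.injective (g := g') fun y => LinearMap.congr_fun h4 y⟩

end HomRing

/-! ### Homomorphisms in a cyclic family -/

section CyclicHom

variable {K : Type*} [Field K] {A : Type*} [Ring A] [Algebra K A] [Module.Finite K A] {ι : Type*}
  [Fintype ι] [PartialOrder ι] {e : ι → A} {b : ι}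
  {T : ι → Type*} [∀ i, AddCommGroup (T i)] [∀ i, Module K (T i)] [∀ i, Module A (T i)]
  [∀ i, IsScalarTower K A (T i)] (D : CyclicFamily K e b T)

theorem CyclicFamily.exists_smul (i : ι) (z : T i) : ∃ a : A, a • D.x i = z :=
  Submodule.mem_span_singleton.1 (by rw [D.span]; trivial)

theorem CyclicFamily.hom_ext {i : ι} {M : Type*} [AddCommGroup M] [Module A M]
    {f g : T i →ₗ[A] M} (h : f (D.x i) = g (D.x i)) : f = g := by
  refine LinearMap.ext fun z => ?_
  obtain ⟨a, rfl⟩ := D.exists_smul i z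
  rw [map_smul, map_smul, h]

open Classical in
/-- The element of `T(i)` which corresponds to the generator of `T(m)`, for `m ≤ i`. -/
def CyclicFamily.y (m i : ι) : T i := if h : m ≤ i then (D.mem i m h).choose else 0

variable {m i k : ι}

theorem CyclicFamily.u_y (h : m ≤ i) : D.u i (D.y m i) = D.u m (D.x m) := by
  rw [CyclicFamily.y, dif_pos h]
  exact (D.mem i m h).choose_spec

theorem CyclicFamily.y_self : D.y i i = D.x i := D.inj i (D.u_y le_rfl)

theorem CyclicFamily.idem_y (h : m ≤ i) : e b • D.y m i = D.y m i :=
  D.inj i (by rw [map_smul, D.u_y h, ← map_smul, D.idem])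

theorem CyclicFamily.smul_y (h : m ≤ i) {l : ι} (hl : ¬ l ≤ m) (a : A) :
    e l • a • D.y m i = 0 :=
  D.inj i (by rw [map_smul, map_smul, D.u_y h, ← map_smul, ← map_smul, D.supp m l hl, map_zero,
    map_zero])

open Classical in
/-- The inclusion `T(m) → T(i)`, for `m ≤ i`. -/
def CyclicFamily.incl (m i : ι) : T m →ₗ[A] T i :=
  if h : m ≤ i then (D.lift m i (D.y m i) (D.idem_y h) fun _ hl a => D.smul_y h hl a).choose else 0

theorem CyclicFamily.incl_x (h : m ≤ i) : D.incl m i (D.x m) = D.y m i := by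
  rw [CyclicFamily.incl, dif_pos h]
  exact (D.lift m i (D.y m i) (D.idem_y h) fun _ hl a => D.smul_y h hl a).choose_spec

theorem CyclicFamily.u_incl (h : m ≤ i) (z : T m) : D.u i (D.incl m i z) = D.u m z := by
  obtain ⟨a, rfl⟩ := D.exists_smul m z
  rw [map_smul, map_smul, map_smul, D.incl_x h, D.u_y h]

theorem CyclicFamily.incl_injective (h : m ≤ i) : Function.Injective (D.incl m i) :=
  Function.Injective.of_comp (f := D.u i) (by
    have : D.u i ∘ D.incl m i = D.u m := funext (D.u_incl h)
    rw [this]; exact D.inj m)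

theorem CyclicFamily.exists_quo (h : m ≤ k) : ∃ f : T k →ₗ[A] T m, f (D.x k) = D.x m :=
  D.lift k m (D.x m) (D.idem m) fun l hl _ => D.supp m l (fun h' => hl (h'.trans h)) _

open Classical in
/-- The projection `T(k) → T(m)`, for `m ≤ k`. -/
def CyclicFamily.quo (k m : ι) : T k →ₗ[A] T m :=
  if h : m ≤ k then (D.exists_quo h).choose else 0

theorem CyclicFamily.quo_x (h : m ≤ k) : D.quo k m (D.x k) = D.x m := by
  rw [CyclicFamily.quo, dif_pos h]
  exact (D.exists_quo h).choose_spec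

/-- The composition `T(k) → T(m) → T(i)`. -/
def CyclicFamily.hom (m k i : ι) : T k →ₗ[A] T i := (D.incl m i).comp (D.quo k m)

theorem CyclicFamily.hom_x (hi : m ≤ i) (hk : m ≤ k) : D.hom m k i (D.x k) = D.y m i := by
  rw [CyclicFamily.hom, LinearMap.comp_apply, D.quo_x hk, D.incl_x hi]

theorem CyclicFamily.incl_self : D.incl i i = LinearMap.id :=
  D.hom_ext (by rw [D.incl_x le_rfl, D.y_self]; rfl)

theorem CyclicFamily.quo_self : D.quo i i = LinearMap.id :=
  D.hom_ext (by rw [D.quo_x le_rfl]; rfl)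

theorem CyclicFamily.smul_hom {l : ι} (hl : ¬ l ≤ m) (z : T k) : e l • D.hom m k i z = 0 := by
  rw [CyclicFamily.hom, LinearMap.comp_apply, ← map_smul, D.supp m l hl, map_zero]

theorem CyclicFamily.smul_u (i l : ι) (hl : ¬ l ≤ i) (a : A) : e l • a • D.u i (D.x i) = 0 := by
  rw [← map_smul, ← map_smul, D.supp i l hl, map_zero]

theorem CyclicFamily.exists_smul_u_ne_zero (i : ι) : ∃ a : A, e i • a • D.u i (D.x i) ≠ 0 := by
  obtain ⟨z, hz⟩ := D.self i
  obtain ⟨a, rfl⟩ := D.exists_smul i z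
  refine ⟨a, fun h0 => hz (D.inj i ?_)⟩
  rw [map_smul, map_smul, h0, map_zero]

/-- The maps `T(k) → T(m) → T(i)` with `m ≤ i, k` span `Hom(T(k), T(i))`. -/
theorem CyclicFamily.exists_coeff (f : T k →ₗ[A] T i) : ∃ c : ι → K,
    f = ∑ m, c m • D.hom m k i ∧ (∀ m, c m ≠ 0 → m ≤ i ∧ m ≤ k) ∧
    ∀ Q : ι → Prop, (∀ l m, Q l → l ≤ m → Q m) → (∀ l, Q l → ∀ z, e l • f z = 0) →
      ∀ l, Q l → c l = 0 := by
  obtain ⟨c, hck, hc⟩ := D.coord k (D.u i (f (D.x k)))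
    (by rw [← map_smul, ← map_smul, D.idem])
    (fun l hl a => by
      rw [← map_smul, ← map_smul, ← map_smul, ← map_smul, D.supp k l hl, map_zero, map_zero])
  have hQ : ∀ Q : ι → Prop, (∀ l m, Q l → l ≤ m → Q m) → (∀ l, Q l → ∀ z, e l • f z = 0) →
      ∀ l, Q l → c l = 0 := by
    intro Q hQ1 hQ2 l hl
    refine coeff_eq_zero_of_sum_eq_zero (fun j => D.u j (D.x j)) D.smul_u D.exists_smul_u_ne_zero Q
      (fun l hl a => ?_) hQ1 l hl
    rw [← hc, ← map_smul, ← map_smul, ← map_smul f, hQ2 l hl, map_zero]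
  -- The bound m ≤ i is the vanishing clause for the upper set {l | l ≰ i}, where e_l kills T(i).
  have hsupp : ∀ m, c m ≠ 0 → m ≤ i ∧ m ≤ k := fun m hm =>
    ⟨by_contra fun h => hm (hQ (fun l => ¬ l ≤ i) (fun l m hl hlm h => hl (hlm.trans h))
      (fun l hl z => D.supp i l hl _) m h), by_contra fun h => hm (hck m h)⟩
  refine ⟨c, D.hom_ext (D.inj i ?_), hsupp, hQ⟩
  rw [hc, LinearMap.sum_apply, map_sum]
  refine Finset.sum_congr rfl fun m _ => ?_
  by_cases hm : c m = 0
  · rw [hm, zero_smul, zero_smul, LinearMap.zero_apply, map_zero]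
  · rw [LinearMap.smul_apply, D.hom_x (hsupp m hm).1 (hsupp m hm).2, ← algebraMap_smul A (c m)
      (D.y m i), map_smul, D.u_y (hsupp m hm).1, algebraMap_smul]

end CyclicHom

/-! ### Homomorphisms killed by idempotents -/

section KillSub

variable {K : Type*} [Field K] {A : Type*} [Ring A] [Algebra K A] {ι : Type*} [Fintype ι]
  {T : ι → Type*} [∀ i, AddCommGroup (T i)] [∀ i, Module K (T i)] [∀ i, Module A (T i)]
  [∀ i, IsScalarTower K A (T i)] {R : Type*} [Ring R] [Algebra K R] {ε : ιᵒᵈ → R}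
  (H : HomRing (A := A) K T ε)

theorem HomRing.cmp_el {k i : ι} (f : T k →ₗ[A] T i) : H.cmp (H.el k i f) k i = f :=
  H.el_injective k i (by rw [← H.idem_mul_idem, H.idem_mul_el, H.el_mul_idem])

theorem HomRing.cmp_el_of_ne {k k' i : ι} (h : k' ≠ k) (f : T k →ₗ[A] T i) :
    H.cmp (H.el k i f) k' i = 0 :=
  H.el_injective k' i (by
    rw [← H.idem_mul_idem, ← H.idem_mul_el f, ← mul_assoc,
      H.complete.ortho (fun h' => h (OrderDual.toDual_inj.1 h')), zero_mul, zero_mul, map_zero])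

theorem HomRing.cmp_add (x y : R) (k i : ι) : H.cmp (x + y) k i = H.cmp x k i + H.cmp y k i :=
  H.el_injective k i (by
    rw [map_add, ← H.idem_mul_idem, ← H.idem_mul_idem, ← H.idem_mul_idem, mul_add, add_mul])

theorem HomRing.cmp_zero (k i : ι) : H.cmp 0 k i = 0 :=
  H.el_injective k i (by rw [← H.idem_mul_idem, mul_zero, zero_mul, map_zero])

theorem HomRing.cmp_mul_el (x : R) {m i : ι} (g : T m →ₗ[A] T i) (k : ι) :
    H.cmp (x * H.el m i g) k i = g.comp (H.cmp x k m) :=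
  H.el_injective k i (by
    rw [← H.el_mul, ← H.idem_mul_idem, ← H.idem_mul_idem, mul_assoc, mul_assoc, H.el_mul_idem,
      mul_assoc, H.idem_mul_el, mul_assoc])

theorem HomRing.cmp_mul (r x : R) (k i : ι) :
    H.cmp (r * x) k i = ∑ m, (H.cmp x m i).comp (H.cmp r k m) :=
  H.el_injective k i (by
    have h := H.sum_smul (x * ε (OrderDual.toDual i))
    rw [map_sum, ← H.idem_mul_idem, mul_assoc, mul_assoc r, ← h, Finset.mul_sum, Finset.mul_sum]
    refine Finset.sum_congr rfl fun m _ => ?_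
    rw [← H.el_mul, ← H.idem_mul_idem, ← H.idem_mul_idem, smul_eq_mul]
    simp only [mul_assoc]
    rw [← mul_assoc (ε (OrderDual.toDual m)) (ε (OrderDual.toDual m)), (H.complete.idem _).eq])

theorem HomRing.eq_sum_pel {i : ι} (x : P ε (OrderDual.toDual i)) :
    x = ∑ k, H.pel (H.cmp x.1 k i) := by
  conv_lhs => rw [← H.sum_smul x]
  exact Finset.sum_congr rfl fun k _ => H.smul_eq_pel x

theorem HomRing.pel_sum {k i : ι} {s : Finset ι} (c : ι → K) (f : ι → (T k →ₗ[A] T i)) :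
    H.pel (∑ m ∈ s, c m • f m) = ∑ m ∈ s, c m • H.pel (f m) := by
  refine Subtype.ext ?_
  change H.el k i _ = _
  rw [map_sum, Submodule.coe_sum]
  exact Finset.sum_congr rfl fun m _ => map_smul _ _ _

theorem HomRing.pel_sub {k i : ι} (f g : T k →ₗ[A] T i) : H.pel (f - g) = H.pel f - H.pel g :=
  Subtype.ext (map_sub (H.el k i) f g)

theorem HomRing.pel_smul {k i : ι} (c : K) (f : T k →ₗ[A] T i) : H.pel (c • f) = c • H.pel f :=
  Subtype.ext (map_smul (H.el k i) c f)

/-- For the opposite order, the vertices not below i are the m with i ≰ m, and a map through T(m)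
lies in R ε_m P_R(i). -/
theorem HomRing.pel_mem_stdKer [Module.Finite K R] [PartialOrder ι] {k m i : ι}
    (f : T k →ₗ[A] T m) (g : T m →ₗ[A] T i) (hm : ¬ i ≤ m) :
    H.pel (g.comp f) ∈ stdKer K ε (OrderDual.toDual i) := by
  rw [← H.el_smul_pel]
  refine Submodule.smul_mem _ _ ?_
  have h1 : H.pel g = ε (OrderDual.toDual m) • H.pel g := Subtype.ext (H.idem_mul_el g).symm
  rw [h1]
  exact smul_mem_stdKer (e := ε) K (i := OrderDual.toDual i) (l := OrderDual.toDual m)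
    (fun h => hm (OrderDual.toDual_le_toDual.1 h)) (H.pel g)

/-- The homomorphisms into `T(i)` whose image is killed by the `e_l` with `l ∈ Q`. -/
def killSub (e : ι → A) (i : ι) (Q : ι → Prop) : Submodule R (P ε (OrderDual.toDual i)) where
  carrier := {x | ∀ l, Q l → ∀ k z, e l • H.cmp x.1 k i z = 0}
  zero_mem' l _ k z := by
    rw [Submodule.coe_zero, H.cmp_zero, LinearMap.zero_apply, smul_zero]
  add_mem' {x y} hx hy l hl k z := by
    rw [Submodule.coe_add, H.cmp_add, LinearMap.add_apply, smul_add, hx l hl, hy l hl, add_zero]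
  smul_mem' r x hx l hl k z := by
    rw [show (r • x).1 = r * x.1 from rfl, H.cmp_mul, LinearMap.sum_apply, Finset.smul_sum]
    exact Finset.sum_eq_zero fun m _ => hx l hl m (H.cmp r k m z)

variable (e : ι → A)

theorem pel_mem_killSub {k i : ι} (f : T k →ₗ[A] T i) (Q : ι → Prop) :
    H.pel f ∈ killSub H e i Q ↔ ∀ l, Q l → ∀ z, e l • f z = 0 := by
  constructor
  · intro h l hl z
    have h1 := h l hl k z
    rwa [show (H.pel f).1 = H.el k i f from rfl, H.cmp_el] at h1
  · intro h l hl k' z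
    change e l • H.cmp (H.el k i f) k' i z = 0
    by_cases hk : k' = k
    · subst hk
      rw [H.cmp_el, h l hl]
    · rw [H.cmp_el_of_ne hk, LinearMap.zero_apply, smul_zero]

theorem smul_pel_mem_killSub (x : R) {m i : ι} (g : T m →ₗ[A] T i) (Q : ι → Prop) :
    x • H.pel g ∈ killSub H e i Q ↔ ∀ l, Q l → ∀ k z, e l • g (H.cmp x k m z) = 0 := by
  have h : ∀ k, H.cmp (x • H.pel g).1 k i = g.comp (H.cmp x k m) := fun k =>
    H.cmp_mul_el x g k
  constructor
  · intro h' l hl k z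
    have h1 := h' l hl k z
    rwa [h k] at h1
  · intro h' l hl k z
    rw [h k]
    exact h' l hl k z

end KillSub

/-! ### The Ringel dual of a cyclic family is quasi-hereditary -/

section RingelQuasiHereditary

variable {K : Type*} [Field K] {A : Type*} [Ring A] [Algebra K A] [Module.Finite K A] {ι : Type*}
  [Fintype ι] [PartialOrder ι] {e : ι → A} {b : ι}
  {T : ι → Type*} [∀ i, AddCommGroup (T i)] [∀ i, Module K (T i)] [∀ i, Module A (T i)]
  [∀ i, IsScalarTower K A (T i)] {R : Type*} [Ring R] [Algebra K R] [Module.Finite K R]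
  {ε : ιᵒᵈ → R}

/-- A map through T(l) with i ≰ l is killed by e_i. Conversely e_i f = 0 makes the coefficient of f
at m = i vanish, leaving maps through T(m) with m < i. -/
theorem CyclicFamily.stdKer_eq_killSub (D : CyclicFamily K e b T)
    (H : HomRing (A := A) K T ε) (i : ι) :
    stdKer K ε (OrderDual.toDual i) = killSub H e i (· = i) := by
  apply le_antisymm
  · rw [stdKer_eq, Submodule.span_le]
    rintro _ ⟨l, hl, x, rfl⟩
    have hx := H.smul_eq_pel (k := OrderDual.ofDual l) x
    rw [OrderDual.toDual_ofDual] at hx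
    rw [SetLike.mem_coe, hx, pel_mem_killSub]
    rintro l' hl' z
    rw [← map_smul, D.supp (OrderDual.ofDual l) l' (fun h => hl (hl' ▸ h)), map_zero]
  · intro x hx
    rw [H.eq_sum_pel x]
    refine Submodule.sum_mem _ fun k _ => ?_
    obtain ⟨c, hc, hs, hQ⟩ := D.exists_coeff (H.cmp x.1 k i)
    have hci : c i = 0 := by
      refine hQ (fun l => i ≤ l) (fun l m hl hlm => hl.trans hlm) (fun l hl z => ?_) i le_rfl
      rcases eq_or_lt_of_le hl with rfl | hl
      · exact hx i rfl k z
      · exact D.supp i l hl.not_ge _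
    rw [hc, H.pel_sum]
    refine Submodule.sum_mem _ fun m _ => ?_
    by_cases hm : c m = 0
    · rw [hm, zero_smul]
      exact Submodule.zero_mem _
    · refine Submodule.smul_of_tower_mem _ _ (H.pel_mem_stdKer _ _ fun him => hm ?_)
      rw [le_antisymm (hs m hm).1 him, hci]

/-- The successive quotients of the filtration of `P(i)` by the `killSub H e i Q`. -/
theorem CyclicFamily.killSub_quotient_equiv (D : CyclicFamily K e b T)
    (H : HomRing (A := A) K T ε) {i m : ι}
    (hm : m ≤ i) (Q Q' : ι → Prop) (hQ : ∀ l k, Q l → l ≤ k → Q k)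
    (hQ' : ∀ l, Q l ↔ Q' l ∨ l = m) (hQ'm : ¬ Q' m) (hQ'2 : ∀ l k, Q' l → l ≤ k → Q' k) :
    Nonempty ((killSub H e i Q' ⧸ (killSub H e i Q).submoduleOf (killSub H e i Q'))
      ≃ₗ[R] Std K ε (OrderDual.toDual m)) := by
  have hlm : ∀ l, Q' l → ¬ l ≤ m := fun l hl h => hQ'm (hQ'2 l m hl h)
  -- Composition with the inclusion T(m) → T(i). A composite is moreover killed by e_m exactly when
  -- its first map lies in `stdKer`, which gives the kernel of F.
  let f : P ε (OrderDual.toDual m) →ₗ[R] killSub H e i Q' :=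
    (projMap (ε (OrderDual.toDual m)) (H.pel (D.incl m i))).codRestrict _ (fun x => by
      rw [projMap_apply]
      refine Submodule.smul_mem _ _ ((pel_mem_killSub H e _ _).2 fun l hl z => ?_)
      rw [← map_smul, D.supp m l (hlm l hl), map_zero])
  have hfx : ∀ x, (f x).1 = x.1 • H.pel (D.incl m i) := fun x => rfl
  let F := ((killSub H e i Q).submoduleOf (killSub H e i Q')).mkQ.comp f
  have hker : LinearMap.ker F = stdKer K ε (OrderDual.toDual m) := by
    rw [D.stdKer_eq_killSub H]
    ext x
    have h1 : x ∈ LinearMap.ker F ↔ (f x).1 ∈ killSub H e i Q :=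
      Submodule.Quotient.mk_eq_zero _
    rw [h1, hfx, smul_pel_mem_killSub]
    constructor
    · intro h l hl k z
      exact D.incl_injective hm (by rw [map_smul, h l ((hQ' l).2 (Or.inr hl)), map_zero])
    · intro h l hl k z
      rcases (hQ' l).1 hl with hl | rfl
      · rw [← map_smul, D.supp m l (hlm l hl), map_zero]
      · rw [← map_smul, h l rfl k z, map_zero]
  have hsurj : LinearMap.range F = ⊤ := by
    rw [eq_top_iff]
    rintro w -
    obtain ⟨x, rfl⟩ := Submodule.mkQ_surjective _ w
    rw [← H.sum_smul x, map_sum]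
    refine Submodule.sum_mem _ fun k _ => ?_
    obtain ⟨c, hc, hs, hcQ⟩ := D.exists_coeff (H.cmp x.1.1 k i)
    have hker' : ∀ l, Q' l → ∀ z, e l • H.cmp x.1.1 k i z = 0 := fun l hl z => x.2 l hl k z
    have hc0 := hcQ Q' hQ'2 hker'
    -- Modulo maps killed on Q, only the term through T(m) counts: a term m' not killed by e_m has m
    -- ≤ m', hence lies in Q = Q' ∪ {m}, and the coefficients on Q' are zero.
    refine ⟨c m • H.pel (D.quo k m), ?_⟩
    symm
    rw [← sub_eq_zero, LinearMap.comp_apply, ← map_sub]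
    refine (Submodule.Quotient.mk_eq_zero _).2 ?_
    have h1 : (ε (OrderDual.toDual k) • x - f (c m • H.pel (D.quo k m))).1 =
        H.pel (H.cmp x.1.1 k i - c m • D.hom m k i) := by
      rw [H.pel_sub, ← H.smul_eq_pel, H.pel_smul, CyclicFamily.hom, ← H.el_smul_pel]
      change _ - (c m • (H.pel (D.quo k m)).1) • H.pel (D.incl m i) = _
      rw [smul_assoc]
      rfl
    rw [Submodule.submoduleOf, Submodule.mem_comap, Submodule.subtype_apply, h1, pel_mem_killSub]
    intro l hl z
    rw [LinearMap.sub_apply, smul_sub, LinearMap.smul_apply, smul_comm]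
    rcases (hQ' l).1 hl with hl' | rfl
    · rw [hker' l hl', D.smul_hom (hlm l hl'), smul_zero, sub_zero]
    · classical
      rw [hc, LinearMap.sum_apply, Finset.smul_sum, Finset.sum_eq_single l, LinearMap.smul_apply,
        smul_comm, sub_self]
      · intro m' _ hm'
        rw [LinearMap.smul_apply, smul_comm]
        by_cases h0 : c m' = 0
        · rw [h0, zero_smul]
        · rw [D.smul_hom, smul_zero]
          exact fun h => ((hQ' m').1 (hQ l m' hl h)).elim (fun h' => h0 (hc0 m' h')) hm'
      · exact fun h => absurd (Finset.mem_univ _) h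
  exact ⟨(LinearMap.quotKerEquivOfSurjective F (LinearMap.range_eq_top.1 hsurj)).symm.trans
    (Submodule.quotEquivOfEq _ _ hker)⟩

theorem exists_linear_enumeration (α : Type*) [Fintype α] [PartialOrder α] :
    ∃ σ : Fin (Fintype.card α) ≃ α, ∀ x y, x ≤ y → σ.symm x ≤ σ.symm y := by
  let : Fintype (LinearExtension α) := inferInstanceAs (Fintype α)
  let σ : Fin (Fintype.card α) ≃o LinearExtension α := Fintype.orderIsoFinOfCardEq _ rfl
  exact ⟨σ.toEquiv, fun x y h => σ.symm.monotone (toLinearExtension.monotone h)⟩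

theorem CyclicFamily.exists_filtration (D : CyclicFamily K e b T)
    (H : HomRing (A := A) K T ε) (i : ι) :
    ∃ 𝓕 : Filtration (A := R) (Std K ε) (P ε (OrderDual.toDual i)),
      ∀ j, Nat.card {t : Fin 𝓕.r // 𝓕.label t = OrderDual.toDual j} =
        Nat.card {k : {k // k ≤ i} // k.1 = j} := by
  classical
  obtain ⟨σ, hσ⟩ := exists_linear_enumeration {k // k ≤ i}
  -- Q t is the complement of the first t vertices of a linear extension of {k | k ≤ i}. It is an
  -- upper set, and it loses the vertex σ t on passing to t + 1. Killing all vertices gives 0, and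
  -- killing only those ≰ i gives all of P_R(i).
  let Q : Fin (Fintype.card {k // k ≤ i} + 1) → ι → Prop := fun t l =>
    ¬ ∃ s, s.castSucc < t ∧ (σ s).1 = l
  have hQup : ∀ t l k, Q t l → l ≤ k → Q t k := by
    rintro t l k hl hlk ⟨s, hs, rfl⟩
    refine hl ⟨σ.symm ⟨l, hlk.trans (σ s).2⟩, ?_, by rw [σ.apply_symm_apply]⟩
    refine lt_of_le_of_lt (Fin.castSucc_le_castSucc_iff.2 ?_) hs
    have := hσ ⟨l, hlk.trans (σ s).2⟩ (σ s) hlk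
    rwa [σ.symm_apply_apply] at this
  have hstep : ∀ (t : Fin (Fintype.card {k // k ≤ i})) l,
      Q t.castSucc l ↔ Q t.succ l ∨ l = (σ t).1 := by
    intro t l
    constructor
    · intro h
      by_contra! h'
      obtain ⟨s, hs, rfl⟩ := not_not.1 h'.1
      refine h ⟨s, lt_of_le_of_ne (Fin.castSucc_lt_succ_iff.1 hs) fun hst => h'.2 ?_, rfl⟩
      rw [Fin.castSucc_injective _ hst]
    · rintro (h | rfl) ⟨s, hs, h2⟩
      · exact h ⟨s, hs.trans t.castSucc_lt_succ, h2⟩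
      · rw [σ.injective (Subtype.ext h2)] at hs
        exact lt_irrefl _ hs
  have hnot : ∀ t : Fin (Fintype.card {k // k ≤ i}), ¬ Q t.succ (σ t).1 :=
    fun t h => h ⟨t, t.castSucc_lt_succ, rfl⟩
  refine ⟨⟨_, fun t => killSub H e i (Q t), fun t => OrderDual.toDual (σ t).1, ?_, ?_, ?_, ?_⟩, ?_⟩
  · rw [eq_bot_iff]
    intro x hx
    rw [Submodule.mem_bot, H.eq_sum_pel x]
    refine Finset.sum_eq_zero fun k _ => ?_
    obtain ⟨c, hc, -, hcQ⟩ := D.exists_coeff (H.cmp x.1 k i)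
    have h0 := hcQ (Q 0) (hQup 0) fun l hl z => hx l hl k z
    rw [hc, H.pel_sum]
    exact Finset.sum_eq_zero fun m _ => by
      rw [h0 m (fun ⟨s, hs, _⟩ => absurd hs (Fin.not_lt_zero _)), zero_smul]
  · rw [eq_top_iff]
    intro x _ l hl k z
    refine D.supp i l (fun h => hl ⟨σ.symm ⟨l, h⟩, Fin.castSucc_lt_last _, ?_⟩) _
    rw [σ.apply_symm_apply]
  · intro t x hx l hl k z
    exact hx l ((hstep t l).2 (Or.inl hl)) k z
  · intro t
    exact D.killSub_quotient_equiv H (σ t).2 _ _ (hQup _) (hstep t) (hnot t) (hQup _)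
  · intro j
    exact Nat.card_congr (σ.subtypeEquiv fun t => OrderDual.toDual_inj)

theorem CyclicFamily.good (D : CyclicFamily K e b T)
    (H : HomRing (A := A) K T ε) (i : ι) : IsGood (A := R) (Std K ε) (P ε (OrderDual.toDual i)) :=
  ⟨(D.exists_filtration H i).choose⟩

theorem CyclicFamily.hasMult_one (D : CyclicFamily K e b T)
    (H : HomRing (A := A) K T ε) {i j : ι} (h : j ≤ i) :
    HasMult (A := R) (Std K ε) (P ε (OrderDual.toDual i)) (OrderDual.toDual j) 1 := by
  obtain ⟨𝓕, h𝓕⟩ := D.exists_filtration H i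
  refine ⟨𝓕, (h𝓕 j).trans ?_⟩
  rw [Nat.card_eq_one_iff_exists]
  exact ⟨⟨⟨j, h⟩, rfl⟩, fun k => Subtype.ext (Subtype.ext k.2)⟩

theorem CyclicFamily.hasMult_zero (D : CyclicFamily K e b T)
    (H : HomRing (A := A) K T ε) {i j : ι} (h : ¬ j ≤ i) :
    HasMult (A := R) (Std K ε) (P ε (OrderDual.toDual i)) (OrderDual.toDual j) 0 := by
  obtain ⟨𝓕, h𝓕⟩ := D.exists_filtration H i
  refine ⟨𝓕, (h𝓕 j).trans ?_⟩
  have : IsEmpty {k : {k // k ≤ i} // k.1 = j} := ⟨fun k => h (k.2 ▸ k.1.2)⟩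
  exact Nat.card_of_isEmpty

end RingelQuasiHereditary

/-! ### Socles and injective modules -/

section Socle

variable {A : Type*} [Ring A] {M : Type*} [AddCommGroup M] [Module A M]

theorem soc_eq_span_of_essential {s : M} (hs : s ≠ 0) (h : ∀ x : M, x ≠ 0 → ∃ a : A, a • x = s) :
    IsSimpleModule A (Submodule.span A {s}) ∧ soc A M = Submodule.span A {s} := by
  have hle : ∀ N : Submodule A M, N ≠ ⊥ → Submodule.span A {s} ≤ N := by
    intro N hN
    obtain ⟨x, hx, hx0⟩ := N.ne_bot_iff.1 hN
    obtain ⟨a, ha⟩ := h x hx0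
    rw [Submodule.span_singleton_le_iff_mem, ← ha]
    exact N.smul_mem a hx
  have hatom : IsAtom (Submodule.span A {s}) := by
    refine ⟨fun h0 => hs (Submodule.span_singleton_eq_bot.1 h0), fun N hN => ?_⟩
    by_contra h0
    exact hN.not_ge (hle N h0)
  have hsimple := isSimpleModule_iff_isAtom.2 hatom
  refine ⟨hsimple, le_antisymm (sSup_le fun N hN => ?_) (le_sSup hsimple)⟩
  have hN' := isSimpleModule_iff_isAtom.1 hN
  exact ((hN'.le_iff_eq hatom.1).1 (hle N hN'.1)).ge

variable {K : Type*} [Field K] [Algebra K A] {ι : Type*} {e : ι → A} {i : ι}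

theorem I_apply_mul (φ : I K e i) (x : A) : φ.1 (e i * x) = φ.1 x := (φ.2 x).symm

/-- The functionals in `I(i)` which vanish at an eigenvector `x`. -/
def annSub (K : Type*) [Field K] {A : Type*} [Ring A] [Algebra K A] {ι : Type*} (e : ι → A) (i : ι)
    (x : A) (hx : ∀ a : A, ∃ c : K, x * a = c • x) : Submodule A (I K e i) where
  carrier := {φ | φ.1 x = 0}
  zero_mem' := rfl
  add_mem' {φ ψ} hφ hψ := by
    change (φ.1 + ψ.1) x = 0
    rw [KDual.add_apply, show φ.1 x = 0 from hφ, show ψ.1 x = 0 from hψ, add_zero]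
  smul_mem' a φ hφ := by
    change (a • φ.1) x = 0
    obtain ⟨c, hc⟩ := hx a
    rw [KDual.smul_apply, hc, KDual.map_smul, show φ.1 x = 0 from hφ, mul_zero]

theorem exists_I_apply_eq (he : IsIdempotentElem (e i)) (ψ : A →ₗ[K] K) :
    ∃ φ : I K e i, ∀ a, φ.1 a = ψ (e i * a) :=
  ⟨toI (K := K) (e := e) he ψ (1 : A), fun a => by rw [toI_apply, smul_eq_mul, mul_one]⟩

theorem exists_I_apply_ne_zero (he : IsIdempotentElem (e i)) {x : A} (hx : x ≠ 0)
    (hx1 : e i * x = x) : ∃ φ : I K e i, φ.1 x ≠ 0 := by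
  obtain ⟨ψ, hψ⟩ := not_forall.1 fun h => hx ((Module.forall_dual_apply_eq_zero_iff K (V := A) x).1 h)
  obtain ⟨φ, hφ⟩ := exists_I_apply_eq he ψ
  exact ⟨φ, by rw [hφ, hx1]; exact hψ⟩

/-- It is the kernel of the nonzero linear form φ ↦ φ(x), hence of codimension one. -/
theorem isCoatom_annSub (he : IsIdempotentElem (e i)) {x : A} (hx0 : x ≠ 0) (hx1 : e i * x = x)
    (hx : ∀ a : A, ∃ c : K, x * a = c • x) : IsCoatom (annSub K e i x hx) := by
  constructor
  · intro h
    obtain ⟨φ, hφ⟩ := exists_I_apply_ne_zero (K := K) (e := e) he hx0 hx1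
    exact hφ (show φ ∈ annSub K e i x hx by rw [h]; trivial)
  · intro N hN
    obtain ⟨φ, hφN, hφ⟩ := Set.exists_of_ssubset hN
    have hφ0 : φ.1 x ≠ 0 := hφ
    rw [eq_top_iff]
    rintro ψ -
    have h1 : ψ - (ψ.1 x / φ.1 x) • φ ∈ annSub K e i x hx := by
      change (ψ.1 - (ψ.1 x / φ.1 x) • φ.1) x = 0
      rw [sub_eq_add_neg, ← neg_smul, KDual.add_apply, KDual.ksmul_apply]
      field_simp
      ring
    rw [← sub_add_cancel ψ ((ψ.1 x / φ.1 x) • φ)]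
    exact N.add_mem (hN.le h1) (Submodule.smul_of_tower_mem _ _ hφN)

/-- Finite-dimensional duality for I(i) = D(e_i A): a proper subspace is annihilated by a nonzero
vector of e_i A. -/
theorem exists_annihilated [Module.Finite K A] (he : IsIdempotentElem (e i))
    {N : Submodule A (I K e i)} (hN : N ≠ ⊤) :
    ∃ x : A, x ≠ 0 ∧ e i * x = x ∧ ∀ ψ ∈ N, ψ.1 x = 0 := by
  by_contra! hcon
  refine hN (eq_top_iff.2 ?_)
  rintro φ -
  let L : I K e i →ₗ[K] Module.Dual K A :=
    { toFun φ := (show A →ₗ[K] K from φ.1)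
      map_add' _ _ := rfl
      map_smul' _ _ := rfl }
  let W : Subspace K (Module.Dual K A) := (N.restrictScalars K).map L
  have h1 : L φ ∈ W.dualCoannihilator.dualAnnihilator := by
    rw [Submodule.mem_dualAnnihilator]
    intro y hy
    rw [Submodule.mem_dualCoannihilator] at hy
    have hy0 : e i * y = 0 := by
      by_contra h0
      obtain ⟨ψ, hψ, hψ0⟩ := hcon (e i * y) h0 (by rw [← mul_assoc, he.eq])
      rw [I_apply_mul] at hψ0
      exact hψ0 (hy (L ψ) ⟨ψ, hψ, rfl⟩)
    change φ.1 y = 0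
    rw [← I_apply_mul, hy0, KDual.map_zero]
  rw [Subspace.dualCoannihilator_dualAnnihilator_eq] at h1
  obtain ⟨ψ, hψ, h2⟩ := h1
  have : ψ = φ := Subtype.ext (KDual.ext fun x => LinearMap.congr_fun h2 x)
  exact this ▸ hψ

end Socle

/-! ### Socles in a cyclic family -/

section CyclicSocle

variable {K : Type*} [Field K] {A : Type*} [Ring A] [Algebra K A] [Module.Finite K A] {ι : Type*}
  [Fintype ι] [PartialOrder ι] {e : ι → A} {b : ι}
  {T : ι → Type*} [∀ i, AddCommGroup (T i)] [∀ i, Module K (T i)] [∀ i, Module A (T i)]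
  [∀ i, IsScalarTower K A (T i)]

theorem CyclicFamily.exists_smul_x_ne_zero (D : CyclicFamily K e b T) (i : ι) :
    ∃ a : A, e i • a • D.x i ≠ 0 := by
  obtain ⟨z, hz⟩ := D.self i
  obtain ⟨a, rfl⟩ := D.exists_smul i z
  exact ⟨a, hz⟩

theorem CyclicFamily.x_ne_zero (D : CyclicFamily K e b T) (i : ι) : D.x i ≠ 0 := fun h => by
  obtain ⟨a, ha⟩ := D.exists_smul_x_ne_zero i
  exact ha (by rw [h, smul_zero, smul_zero])

theorem CyclicFamily.le_of_injective (D : CyclicFamily K e b T) {i k : ι} (f : T i →ₗ[A] T k)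
    (hf : Function.Injective f) : i ≤ k := by
  obtain ⟨y, hy⟩ := D.self i
  by_contra h
  exact hy (hf (by rw [map_smul, D.supp k i h, map_zero]))

theorem CyclicFamily.y_ne_zero (D : CyclicFamily K e b T) {m i : ι} (h : m ≤ i) :
    D.y m i ≠ 0 := fun h0 =>
  D.x_ne_zero m (D.inj m (by rw [← D.u_y h, h0, map_zero, map_zero]))

theorem CyclicFamily.eq_smul_y (D : CyclicFamily K e b T) (hb : IsBot b) {i : ι} {w : T i}
    (hw : e b • w = w) (hl : ∀ l, ¬ l ≤ b → ∀ a : A, e l • a • w = 0) :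
    ∃ c : K, w = c • D.y b i := by
  obtain ⟨c, hc, hs⟩ := D.coord b (D.u i w) (by rw [← map_smul, hw]) fun l h a => by
    rw [← map_smul, ← map_smul, hl l h, map_zero]
  refine ⟨c b, D.inj i ?_⟩
  rw [hs, Finset.sum_eq_single b, ← algebraMap_smul A (c b) (D.y b i), map_smul, D.u_y (hb i),
    algebraMap_smul]
  · intro j _ hj
    rw [hc j fun h => hj (le_antisymm h (hb j)), zero_smul]
  · exact fun h => absurd (Finset.mem_univ _) h

/-- T(i) embeds in I(b), so a simple submodule is S(b). It contains a nonzero vector of e_b T(i)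
killed by e_l a for every l ≠ b and a in A, and these vectors are multiples of `D.y b i` by
`CyclicFamily.eq_smul_y`. -/
theorem CyclicFamily.essential (D : CyclicFamily K e b T) (hA : IsBasic K e) (hb : IsBot b) {i : ι}
    [Module.Finite K (T i)] {z : T i} (hz : z ≠ 0) : ∃ a : A, a • z = D.y b i := by
  have : IsArtinian A (T i) := isArtinian_of_tower K inferInstance
  obtain ⟨S, hS, hSz⟩ := (eq_bot_or_exists_atom_le (Submodule.span A {z})).resolve_left
    (fun h => hz (Submodule.span_singleton_eq_bot.1 h))
  have hSs : IsSimpleModule A S := isSimpleModule_iff_isAtom.2 hS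
  have hdet := (I_isDetectedBy (K := K) (e := e) b).of_injective ((D.u i).comp S.subtype)
    ((D.inj i).comp S.injective_subtype)
  have := hSs.nontrivial
  obtain ⟨y, hy0⟩ := exists_ne (0 : S)
  obtain ⟨a, ha⟩ := hdet y hy0
  rw [mul_smul] at ha
  obtain ⟨c, hc⟩ := D.eq_smul_y hb (w := (e b • a • y : S).1)
    (by rw [← Submodule.coe_smul, ← mul_smul, (hA.idem b).eq]) (fun l hl a' => by
      rw [← Submodule.coe_smul, ← Submodule.coe_smul]
      by_contra h0
      have h1 : e l • a' • e b • a • y ≠ 0 := fun h => h0 (by rw [h, Submodule.coe_zero])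
      exact hl (hA.eq_of_simple h1 ha).le)
  have hc0 : c ≠ 0 := by
    rintro rfl
    rw [zero_smul] at hc
    exact ha (Subtype.ext hc)
  have hmem : D.y b i ∈ Submodule.span A {z} := by
    rw [← inv_smul_smul₀ hc0 (D.y b i), ← hc]
    exact Submodule.smul_of_tower_mem _ _ (hSz (e b • a • y : S).2)
  exact Submodule.mem_span_singleton.1 hmem

theorem CyclicFamily.injective_of_apply_y_ne_zero (D : CyclicFamily K e b T) (hA : IsBasic K e)
    (hb : IsBot b) {i : ι} [Module.Finite K (T i)] {M : Type*} [AddCommGroup M] [Module A M]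
    (f : T i →ₗ[A] M) (hf : f (D.y b i) ≠ 0) : Function.Injective f := by
  rw [injective_iff_map_eq_zero]
  intro z hz
  by_contra h0
  obtain ⟨a, ha⟩ := D.essential hA hb h0
  exact hf (by rw [← ha, map_smul, hz, smul_zero])

theorem CyclicFamily.isLocalMod (D : CyclicFamily K e b T) (hA : IsBasic K e) (i : ι)
    [Module.Finite K (T i)] : IsLocalMod A (T i) := by
  have : Module.Finite A (T i) := Module.Finite.of_restrictScalars_finite K A _
  have : Nontrivial (T i) := ⟨D.x i, 0, D.x_ne_zero i⟩
  refine (hA.isLocalMod_proj b).of_surjective (projMap (e b) (D.x i)) ?_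
  rw [← LinearMap.range_eq_top, projMap_range (D.idem i), D.span]

/-- The kernel of T(i) → T(b) is the maximal submodule. If z in N survived, some a z would agree
with the generator modulo this kernel, and the generator would lie in the maximal submodule. -/
theorem CyclicFamily.le_ker_quo (D : CyclicFamily K e b T) (hA : IsBasic K e) (hb : IsBot b) {i : ι}
    [∀ i, Module.Finite K (T i)] {N : Submodule A (T i)} (hN : N ≠ ⊤) :
    N ≤ LinearMap.ker (D.quo i b) := by
  have : Module.Finite A (T i) := Module.Finite.of_restrictScalars_finite K A _
  obtain ⟨J, hJ, hJ'⟩ := (D.isLocalMod hA i).exists_coatom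
  have hker : LinearMap.ker (D.quo i b) ≠ ⊤ := fun h => D.x_ne_zero b (by
    rw [← D.quo_x (hb i)]
    exact LinearMap.mem_ker.1 (h ▸ Submodule.mem_top))
  intro z hz
  by_contra h0
  obtain ⟨a, ha⟩ := D.essential hA hb (z := D.quo i b z) h0
  refine hJ.1 (eq_top_iff.2 ?_)
  rw [← D.span, Submodule.span_singleton_le_iff_mem, ← sub_sub_cancel (a • z) (D.x i)]
  refine J.sub_mem (J.smul_mem _ (hJ' N hN hz)) (hJ' _ hker ?_)
  rw [LinearMap.mem_ker, map_sub, map_smul, ha, D.quo_x (hb i), D.y_self, sub_self]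

/-- I(b) is generated by e_b I(b), and this space is spanned by the θ(j), all of which lie in the
image of T(t). -/
theorem CyclicFamily.u_bijective (D : CyclicFamily K e b T) (hA : IsOneQuasiHereditary K e)
    (hb : IsBot b) {t : ι} (ht : IsTop t) : Function.Bijective (D.u t) := by
  refine ⟨D.inj t, ?_⟩
  rw [← LinearMap.range_eq_top, eq_top_iff, ← (I_isGeneratedBy hA hb b).2, Submodule.span_le]
  intro y hy
  obtain ⟨c, -, hc⟩ := D.coord t y hy fun l hl => absurd (ht l) hl
  rw [hc]
  exact Submodule.sum_mem _ fun j _ => Submodule.smul_of_tower_mem _ _ (D.mem t j (ht j))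

/-- The coefficient of `f : T(k) → T(i)` at the projection `T(k) → T(i)`. -/
theorem CyclicFamily.exists_leading_coeff (D : CyclicFamily K e b T) (hA : IsBasic K e)
    (hb : IsBot b) [∀ i, Module.Finite K (T i)] {k i : ι} (f : T k →ₗ[A] T i) :
    ∃ c : K, (c ≠ 0 → i ≤ k) ∧ (∀ z, e i • f z = c • e i • D.quo k i z) ∧
      ∀ z, D.quo i b (f z) = c • D.quo i b (D.quo k i z) := by
  classical
  obtain ⟨c, hc, hs, -⟩ := D.exists_coeff f
  -- The other terms pass through T(m) with m < i: e_i kills them, and their image is a proper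
  -- submodule of T(i), hence dies in T(b).
  have hlt : ∀ m, m ≠ i → c m ≠ 0 → ¬ i ≤ m := fun m hm hcm h =>
    hm (le_antisymm (hs m hcm).1 h)
  have hii : ∀ z, D.hom i k i z = D.quo k i z := fun z => by
    rw [CyclicFamily.hom, D.incl_self, LinearMap.id_comp]
  refine ⟨c i, fun h => (hs i h).2, fun z => ?_, fun z => ?_⟩
  · rw [hc, LinearMap.sum_apply, Finset.smul_sum, Finset.sum_eq_single i, LinearMap.smul_apply,
      smul_comm, hii]
    · intro m _ hm
      by_cases h0 : c m = 0
      · rw [h0, zero_smul, LinearMap.zero_apply, smul_zero]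
      · rw [LinearMap.smul_apply, smul_comm, D.smul_hom (hlt m hm h0), smul_zero]
    · exact fun h => absurd (Finset.mem_univ _) h
  · rw [hc, LinearMap.sum_apply, map_sum, Finset.sum_eq_single i, LinearMap.smul_apply,
      LinearMap.map_smul_of_tower, hii]
    · intro m _ hm
      by_cases h0 : c m = 0
      · rw [h0, zero_smul, LinearMap.zero_apply, map_zero]
      · rw [LinearMap.smul_apply, LinearMap.map_smul_of_tower]
        have hr : LinearMap.range (D.incl m i) ≠ ⊤ := fun h => by
          obtain ⟨y, hy⟩ := D.self i
          obtain ⟨y, rfl⟩ := LinearMap.range_eq_top.1 h y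
          rw [← map_smul, D.supp m i (hlt m hm h0), map_zero] at hy
          exact hy rfl
        rw [show D.quo i b (D.hom m k i z) = 0 from D.le_ker_quo hA hb hr ⟨D.quo k m z, rfl⟩,
          smul_zero]
    · exact fun h => absurd (Finset.mem_univ _) h

end CyclicSocle

/-! ### The Ringel dual of a cyclic family is quasi-hereditary, continued -/

section RingelBasic

variable {K : Type*} [Field K] {A : Type*} [Ring A] [Algebra K A] [Module.Finite K A] {ι : Type*}
  [Fintype ι] [PartialOrder ι] {e : ι → A} {b : ι}
  {T : ι → Type*} [∀ i, AddCommGroup (T i)] [∀ i, Module K (T i)] [∀ i, Module A (T i)]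
  [∀ i, IsScalarTower K A (T i)] {R : Type*} [Ring R] [Algebra K R] [Module.Finite K R]
  {ε : ιᵒᵈ → R}

theorem CyclicFamily.isBasic (D : CyclicFamily K e b T) (H : HomRing (A := A) K T ε)
    (hT : ∀ i, IsIndecomposable A (T i)) : IsBasic K ε where
  finite := inferInstance
  complete := H.complete
  primitive i := H.isIndecomposable (hT (OrderDual.ofDual i))
  basic i j h := by
    obtain ⟨f, hf⟩ := H.exists_embedding (i := OrderDual.ofDual i) (j := OrderDual.ofDual j) h
    obtain ⟨g, hg⟩ := H.exists_embedding (i := OrderDual.ofDual j) (j := OrderDual.ofDual i)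
      (h.map LinearEquiv.symm)
    exact OrderDual.ofDual_inj.1 (le_antisymm (D.le_of_injective f hf) (D.le_of_injective g hg))

/-- Modulo maps killed by e_i, every T(k) → T(i) is a multiple of the projection, by its leading
coefficient. -/
theorem CyclicFamily.jh_std_ringel (D : CyclicFamily K e b T) (H : HomRing (A := A) K T ε)
    (hA : IsBasic K e) (hb : IsBot b) [∀ i, Module.Finite K (T i)] {i k : ι} (h : i ≤ k) :
    jh K ε (Std K ε (OrderDual.toDual i)) (OrderDual.toDual k) = 1 := by
  rw [jh_eq_edim]
  refine edim_eq_one_of K (H.complete.idem _)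
    (x := (stdKer K ε (OrderDual.toDual i)).mkQ (H.pel (D.quo k i))) ?_ ?_ ?_
  · rw [← map_smul]
    exact congrArg _ (Subtype.ext (H.idem_mul_el _))
  · intro h0
    rw [Submodule.mkQ_apply, Submodule.Quotient.mk_eq_zero, D.stdKer_eq_killSub H,
      pel_mem_killSub] at h0
    obtain ⟨a, ha⟩ := D.exists_smul_x_ne_zero i
    apply ha
    rw [← D.quo_x h, ← map_smul]
    exact h0 i rfl _
  · intro y hy
    obtain ⟨w, rfl⟩ := Submodule.mkQ_surjective _ y
    obtain ⟨c, -, hc, -⟩ := D.exists_leading_coeff hA hb (H.cmp w.1 k i)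
    refine ⟨c, ?_⟩
    rw [← hy, ← map_smul, H.smul_eq_pel, ← sub_eq_zero, ← LinearMap.map_smul_of_tower, ← map_sub,
      Submodule.mkQ_apply, Submodule.Quotient.mk_eq_zero, ← H.pel_smul, ← H.pel_sub,
      D.stdKer_eq_killSub H, pel_mem_killSub]
    rintro l rfl z
    rw [LinearMap.sub_apply, LinearMap.smul_apply, smul_sub, hc, smul_comm c, sub_self]

theorem CyclicFamily.isQuasiHereditary (D : CyclicFamily K e b T) (H : HomRing (A := A) K T ε)
    (hA : IsBasic K e) (hb : IsBot b) [∀ i, Module.Finite K (T i)]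
    (hT : ∀ i, IsIndecomposable A (T i)) : IsQuasiHereditary K ε where
  toIsBasic := D.isBasic H hT
  std_self i := D.jh_std_ringel H hA hb (i := OrderDual.ofDual i) le_rfl
  good i := D.good H (OrderDual.ofDual i)
  mult_zero i j h := D.hasMult_zero H (i := OrderDual.ofDual i) (j := OrderDual.ofDual j) h
  mult_self i := D.hasMult_one H (i := OrderDual.ofDual i) le_rfl

end RingelBasic

/-! ### The Ringel dual of a cyclic family is 1-quasi-hereditary -/

section RingelOne

variable {K : Type*} [Field K] {A : Type*} [Ring A] [Algebra K A] [Module.Finite K A] {ι : Type*}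
  [Fintype ι] [PartialOrder ι] {e : ι → A} {b : ι}
  {T : ι → Type*} [∀ i, AddCommGroup (T i)] [∀ i, Module K (T i)] [∀ i, Module A (T i)]
  [∀ i, IsScalarTower K A (T i)] [∀ i, Module.Finite K (T i)]
  {R : Type*} [Ring R] [Algebra K R] [Module.Finite K R]
  {ε : ιᵒᵈ → R}

/-- The socle is generated by T(t) → T(b) → T(j). A nonzero map T(k) → T(j) has the socle of T(j) in
its image, and T(t) admits maps to T(k) with any prescribed value in e_b T(k), so precomposition
reaches this element. -/
theorem CyclicFamily.soc_ringel (D : CyclicFamily K e b T) (H : HomRing (A := A) K T ε)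
    (hA : IsBasic K e) (hb : IsBot b) (hR : IsBasic K ε) {t : ι} (ht : IsTop t) (j : ι) :
    Nonempty (soc R (P ε (OrderDual.toDual j)) ≃ₗ[R] S ε (OrderDual.toDual t)) := by
  have hidem : ε (OrderDual.toDual t) • H.pel (D.hom b t j) = H.pel (D.hom b t j) :=
    Subtype.ext (H.idem_mul_el _)
  have hne : H.pel (D.hom b t j) ≠ 0 := fun h => by
    have h1 : D.hom b t j = 0 := H.el_injective t j
      ((congrArg Subtype.val h).trans (map_zero (H.el t j)).symm)
    have h2 := LinearMap.congr_fun h1 (D.x t)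
    rw [D.hom_x (hb j) (hb t)] at h2
    exact D.y_ne_zero (hb j) h2
  have hess : ∀ x : P ε (OrderDual.toDual j), x ≠ 0 → ∃ a : R, a • x = H.pel (D.hom b t j) := by
    intro x hx
    obtain ⟨k, hk⟩ : ∃ k, H.cmp x.1 k j ≠ 0 := by
      by_contra! h
      refine hx ?_
      rw [H.eq_sum_pel x]
      refine Finset.sum_eq_zero fun k _ => ?_
      rw [h k]
      exact Subtype.ext (map_zero (H.el k j))
    have hk' : H.cmp x.1 k j (D.x k) ≠ 0 := fun h => hk (D.hom_ext h)
    obtain ⟨a, ha⟩ := D.essential hA hb hk'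
    obtain ⟨g, hg⟩ := D.lift t k (e b • a • D.x k) (by rw [← mul_smul, (hA.idem b).eq])
      fun l hl => absurd (ht l) hl
    refine ⟨H.el t k g * ε (OrderDual.toDual k), ?_⟩
    rw [mul_smul, H.smul_eq_pel, H.el_smul_pel]
    congr 1
    refine D.hom_ext ?_
    rw [LinearMap.comp_apply, hg, map_smul, map_smul, ha, D.idem_y (hb j), D.hom_x (hb j) (hb t)]
  obtain ⟨hs, hsoc⟩ := soc_eq_span_of_essential hne hess
  obtain ⟨φ⟩ := top_equiv_of_smul_ne_zero K (hR.idem (OrderDual.toDual t))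
    (hR.primitive (OrderDual.toDual t))
    (x := (⟨H.pel (D.hom b t j), Submodule.mem_span_singleton_self _⟩ :
      Submodule.span R {H.pel (D.hom b t j)})) (fun h => hne (by
        rw [← hidem]; exact congrArg Subtype.val h))
  exact ⟨(LinearEquiv.ofEq _ _ hsoc).trans φ.symm⟩

theorem HomRing.exists_mul_eq_smul (H : HomRing (A := A) K T ε) {j t : ι} (g : T j →ₗ[A] T t)
    (hg : ∀ k (h : T t →ₗ[A] T k), ∃ c : K, H.el j k (h.comp g) = c • H.el j t g) (r : R) :
    ∃ c : K, H.el j t g * r = c • H.el j t g := by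
  have hk : ∀ k, ∃ c : K, H.el j t g * r * ε (OrderDual.toDual k) = c • H.el j t g := by
    intro k
    obtain ⟨c, hc⟩ := hg k (H.cmp r t k)
    refine ⟨c, ?_⟩
    rw [← hc, ← H.el_mul, ← H.idem_mul_idem, ← H.el_mul_idem g]
    simp only [mul_assoc]
    rw [← mul_assoc (ε (OrderDual.toDual t)) (ε (OrderDual.toDual t)), (H.complete.idem _).eq]
  choose c hc using hk
  refine ⟨∑ k, c k, ?_⟩
  rw [Finset.sum_smul, ← Finset.sum_congr rfl fun k _ => hc k, ← Finset.mul_sum]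
  have h1 := H.sum_smul (1 : R)
  simp only [smul_eq_mul, mul_one] at h1
  rw [h1, mul_one]

/-- A map h out of T(t) either kills its socle or is injective. In the latter case its target is
T(t) and h acts on the socle by a scalar. -/
theorem CyclicFamily.el_hom_mul (D : CyclicFamily K e b T) (H : HomRing (A := A) K T ε)
    (hA : IsBasic K e) (hb : IsBot b) {t : ι} (ht : IsTop t) (j : ι) (r : R) :
    ∃ c : K, H.el j t (D.hom b j t) * r = c • H.el j t (D.hom b j t) := by
  refine H.exists_mul_eq_smul _ (fun k h => ?_) r
  by_cases h0 : h (D.y b t) = 0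
  · refine ⟨0, ?_⟩
    rw [zero_smul, ← map_zero (H.el j k)]
    congr 1
    refine D.hom_ext ?_
    rw [LinearMap.comp_apply, D.hom_x (hb t) (hb j), h0, LinearMap.zero_apply]
  · obtain rfl : k = t := le_antisymm (ht k)
      (D.le_of_injective _ (D.injective_of_apply_y_ne_zero hA hb _ h0))
    obtain ⟨c, hc⟩ := D.eq_smul_y hb (w := h (D.y b k))
      (by rw [← map_smul, D.idem_y (hb k)])
      (fun l hl a => by rw [← map_smul, ← map_smul, D.smul_y (hb k) hl, map_zero])
    refine ⟨c, ?_⟩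
    rw [← map_smul]
    congr 1
    refine D.hom_ext ?_
    rw [LinearMap.comp_apply, LinearMap.smul_apply, D.hom_x (hb k) (hb j), hc]

/-- The right-hand counterpart of `CyclicFamily.soc_ringel`: the kernel of a nonzero f : T(j) → T(k)
lies in that of T(j) → T(b), so T(j) → T(b) → T(t) factors through the image of f and extends to
T(k) because T(t) ≅ I(b) is injective. -/
theorem CyclicFamily.exists_mul_eq (D : CyclicFamily K e b T) (H : HomRing (A := A) K T ε)
    (hA : IsOneQuasiHereditary K e) (hb : IsBot b) {t : ι} (ht : IsTop t) {j : ι} {x : R}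
    (hx0 : x ≠ 0) (hx : ε (OrderDual.toDual j) * x = x) :
    ∃ r : R, x * r = H.el j t (D.hom b j t) := by
  obtain ⟨k, hk⟩ : ∃ k, H.cmp x j k ≠ 0 := by
    by_contra! h
    refine hx0 ?_
    have h1 : ∀ k, x * ε (OrderDual.toDual k) = 0 := fun k => by
      rw [← hx, H.idem_mul_idem, h k, map_zero]
    have h2 := H.sum_smul (1 : R)
    simp only [smul_eq_mul, mul_one] at h2
    rw [← mul_one x, ← h2, Finset.mul_sum]
    exact Finset.sum_eq_zero fun k _ => h1 k
  generalize hf : H.cmp x j k = f at hk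
  have hker : LinearMap.ker f ≤ LinearMap.ker (D.quo j b) :=
    D.le_ker_quo hA.toIsBasic hb fun h => hk (LinearMap.ker_eq_top.1 h)
  obtain ⟨g, hg⟩ := exists_factor_of_surjective f.rangeRestrict f.surjective_rangeRestrict
    ((D.u t).comp (D.hom b j t)) (fun z hz => by
      have h1 : z ∈ LinearMap.ker (D.quo j b) := hker (by
        rw [LinearMap.mem_ker]; exact congrArg Subtype.val hz)
      rw [LinearMap.comp_apply, CyclicFamily.hom, LinearMap.comp_apply, LinearMap.mem_ker.1 h1,
        map_zero, map_zero])
  obtain ⟨F, hF⟩ := I_extend (hA.idem b) (LinearMap.range f).subtype Subtype.val_injective g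
  let u := LinearEquiv.ofBijective (D.u t) (D.u_bijective hA hb ht)
  refine ⟨ε (OrderDual.toDual k) * H.el k t (u.symm.toLinearMap.comp F), ?_⟩
  rw [← mul_assoc, ← hx, H.idem_mul_idem, H.el_mul, hf]
  congr 1
  refine LinearMap.ext fun z => u.injective ?_
  change u (u.symm (F (f z))) = _
  rw [u.apply_symm_apply]
  exact (hF (f.rangeRestrict z)).trans (hg z)

/-- The functionals vanishing at T(j) → T(b) → T(t) form a maximal submodule. It is the only one:
any proper submodule annihilates some nonzero x, hence also a right multiple of x equal to this map.
-/
theorem CyclicFamily.top_ringel (D : CyclicFamily K e b T) (H : HomRing (A := A) K T ε)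
    (hA : IsOneQuasiHereditary K e) (hb : IsBot b) (hR : IsBasic K ε) {t : ι} (ht : IsTop t)
    (j : ι) :
    Nonempty (Top R (I K ε (OrderDual.toDual j)) ≃ₗ[R] S ε (OrderDual.toDual t)) := by
  have hτ1 := H.idem_mul_el (D.hom b j t)
  have hτ2 := H.el_mul_idem (D.hom b j t)
  have hτ0 : H.el j t (D.hom b j t) ≠ 0 := fun h => by
    have h1 : D.hom b j t = 0 := H.el_injective j t (h.trans (map_zero (H.el j t)).symm)
    have h2 := LinearMap.congr_fun h1 (D.x j)
    rw [D.hom_x (hb t) (hb j)] at h2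
    exact D.y_ne_zero (hb t) h2
  have hτ := D.el_hom_mul H hA.toIsBasic hb ht j
  have hco := isCoatom_annSub (K := K) (H.complete.idem _) hτ0 hτ1 hτ
  have hloc : IsLocalMod R (I K ε (OrderDual.toDual j)) := by
    refine ⟨_, hco, fun N hN => ?_⟩
    obtain ⟨x, hx0, hx1, hx⟩ := exists_annihilated (H.complete.idem _) hN.1
    obtain ⟨r, hr⟩ := D.exists_mul_eq H hA hb ht hx0 hx1
    refine ((hN.le_iff_eq hco.1).1 fun ψ hψ => ?_).symm
    change ψ.1 _ = 0
    rw [← hr]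
    exact hx (r • ψ) (N.smul_mem r hψ)
  have hsimple := hloc.isSimpleModule_top
  obtain ⟨φ, hφ⟩ := exists_I_apply_ne_zero (K := K) (H.complete.idem _) hτ0 hτ1
  obtain ⟨θ⟩ := top_equiv_of_smul_ne_zero K (hR.idem (OrderDual.toDual t))
    (hR.primitive (OrderDual.toDual t))
    (x := (Module.jacobson R (I K ε (OrderDual.toDual j))).mkQ φ) (fun h => by
      rw [← map_smul, Submodule.mkQ_apply, Submodule.Quotient.mk_eq_zero,
        hloc.jacobson_eq hco] at h
      change φ.1 (_ * _) = 0 at h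
      rw [hτ2] at h
      exact hφ h)
  exact ⟨θ.symm⟩

/-- As b is greatest in the opposite order, Δ_R(b) = P_R(b). The embedding is composition with T(i)
→ T(b), whose kernel is `stdKer` since e_i and T(i) → T(b) both detect only the leading coefficient.
-/
theorem CyclicFamily.std_embed_ringel (D : CyclicFamily K e b T) (H : HomRing (A := A) K T ε)
    (hA : IsBasic K e) (hb : IsBot b) (i : ι) :
    ∃ f : Std K ε (OrderDual.toDual i) →ₗ[R] Std K ε (OrderDual.toDual b),
      Function.Injective f := by
  let Φ : P ε (OrderDual.toDual i) →ₗ[R] P ε (OrderDual.toDual b) :=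
    projMap (ε (OrderDual.toDual i)) (H.pel (D.quo i b))
  have hbot : stdKer K ε (OrderDual.toDual b) = ⊥ :=
    stdKer_top (K := K) (e := ε) fun l => OrderDual.le_toDual.2 (hb _)
  have hker : ∀ x, Φ x = 0 ↔ x ∈ stdKer K ε (OrderDual.toDual i) := by
    intro x
    have hcmp : ∀ k, H.cmp (Φ x).1 k b = (D.quo i b).comp (H.cmp x.1 k i) := fun k =>
      H.cmp_mul_el x.1 _ k
    rw [D.stdKer_eq_killSub H]
    constructor
    · rintro h l rfl k z
      obtain ⟨c, hc1, hc2, hc3⟩ := D.exists_leading_coeff hA hb (H.cmp x.1 k l)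
      rw [hc2]
      by_cases hc0 : c = 0
      · rw [hc0, zero_smul]
      · have h1 := hc3 (D.x k)
        rw [D.quo_x (hc1 hc0), D.quo_x (hb l), ← LinearMap.comp_apply, ← hcmp, h,
          Submodule.coe_zero, H.cmp_zero, LinearMap.zero_apply] at h1
        exact absurd ((smul_eq_zero.1 h1.symm).resolve_left hc0) (D.x_ne_zero b)
    · intro h
      rw [H.eq_sum_pel (Φ x)]
      refine Finset.sum_eq_zero fun k _ => ?_
      have h0 : H.cmp (Φ x).1 k b = 0 := by
        rw [hcmp]
        obtain ⟨c, hc1, hc2, hc3⟩ := D.exists_leading_coeff hA hb (H.cmp x.1 k i)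
        refine LinearMap.ext fun z => ?_
        rw [LinearMap.comp_apply, hc3]
        by_cases hc0 : c = 0
        · rw [hc0, zero_smul, LinearMap.zero_apply]
        · obtain ⟨a, ha⟩ := D.exists_smul_x_ne_zero i
          have h1 := hc2 (a • D.x k)
          rw [h i rfl, map_smul, D.quo_x (hc1 hc0)] at h1
          exact absurd ((smul_eq_zero.1 h1.symm).resolve_left hc0) ha
      rw [h0]
      exact Subtype.ext (map_zero (H.el k b))
  let Ψ : P ε (OrderDual.toDual i) →ₗ[R] Std K ε (OrderDual.toDual b) :=
    (stdKer K ε (OrderDual.toDual b)).mkQ.comp Φ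
  have hΨ : LinearMap.ker Ψ = stdKer K ε (OrderDual.toDual i) := by
    ext x
    rw [← hker, LinearMap.mem_ker, LinearMap.comp_apply, Submodule.mkQ_apply,
      Submodule.Quotient.mk_eq_zero, hbot, Submodule.mem_bot]
  refine ⟨(stdKer K ε (OrderDual.toDual i)).liftQ Ψ hΨ.ge, ?_⟩
  rw [← LinearMap.ker_eq_bot]
  exact Submodule.ker_liftQ_eq_bot _ _ _ hΨ.le

/-- The surjection is φ ↦ φ(s ·), where s is the inclusion T(b) → T(i). By duality its image
consists of the functionals vanishing on {x | s x = 0}. -/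
theorem CyclicFamily.costd_onto_ringel (D : CyclicFamily K e b T) (H : HomRing (A := A) K T ε)
    (hA : IsBasic K e) (hb : IsBot b) (i : ι) :
    ∃ f : Costd K ε (OrderDual.toDual b) →ₗ[R] Costd K ε (OrderDual.toDual i),
      Function.Surjective f := by
  classical
  generalize hs : H.el b i (D.incl b i) = s
  have hs1 : ε (OrderDual.toDual b) * s = s := by rw [← hs, H.idem_mul_el]
  have hs2 : s * ε (OrderDual.toDual i) = s := by rw [← hs, H.el_mul_idem]
  have hsx : ∀ x l, s * (x * ε (OrderDual.toDual l)) =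
      H.el b l ((H.cmp x i l).comp (D.incl b i)) := fun x l => by
    rw [← H.el_mul, ← H.idem_mul_idem, hs, ← mul_assoc, ← mul_assoc, ← mul_assoc, hs2]
  have hkill : ∀ l, ¬ i ≤ l → ∀ x, s * (x * ε (OrderDual.toDual l)) = 0 := by
    intro l hl x
    rw [hsx, ← map_zero (H.el b l)]
    congr 1
    refine D.hom_ext ?_
    rw [LinearMap.comp_apply, D.incl_x (hb i), LinearMap.zero_apply]
    by_contra h
    exact hl (D.le_of_injective _ (D.injective_of_apply_y_ne_zero hA hb _ h))
  let g : I K ε (OrderDual.toDual b) →ₗ[R] I K ε (OrderDual.toDual i) :=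
    { toFun φ := ⟨(LinearMap.comp (show R →ₗ[K] K from φ.1) (LinearMap.mulLeft K s) : R →ₗ[K] K),
        fun x => by
          change φ.1 (s * x) = φ.1 (s * (ε (OrderDual.toDual i) * x))
          rw [← mul_assoc, hs2]⟩
      map_add' φ ψ := rfl
      map_smul' r φ := Subtype.ext (KDual.ext fun x => by
        change φ.1 (s * x * r) = φ.1 (s * (x * r))
        rw [mul_assoc]) }
  have hg : ∀ φ x, (g φ).1 x = φ.1 (s * x) := fun φ x => rfl
  obtain ⟨f, hf⟩ := exists_costd_map (K := K) (i := OrderDual.toDual i)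
    (g.comp (Costd K ε (OrderDual.toDual b)).subtype) (fun l hl φ => by
      refine Subtype.ext (KDual.ext fun x => ?_)
      change (g φ.1).1 (x * ε l) = 0
      rw [hg, show s * (x * ε l) = 0 from hkill (OrderDual.ofDual l) (fun h => hl h) x,
        KDual.map_zero])
  refine ⟨f, fun ψ => ?_⟩
  have hψ : ∀ m, ¬ i ≤ m → ∀ x y : R, ψ.1.1 (x * ε (OrderDual.toDual m) * y) = 0 := by
    intro m hm x y
    have h1 := congrArg Subtype.val ((mem_costd K).1 ψ.2 (OrderDual.toDual m) (fun h => hm h) y)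
    have h2 := congrArg (fun θ : KDual K R => θ x) h1
    exact h2
  -- The components T(i) → T(k) of such an x kill the socle of T(i). Terms through T(m) with m < i
  -- kill it anyway, so the coefficient at m = i is zero, and ψ vanishes on the remaining terms
  -- because it lies in ∇_R(i).
  have hψ0 : ∀ x, s * x = 0 → ψ.1.1 x = 0 := by
    intro x hx
    have h1 := H.sum_smul (1 : R)
    simp only [smul_eq_mul, mul_one] at h1
    rw [← I_apply_mul, ← mul_one (_ * x), ← h1, Finset.mul_sum]
    rw [show ψ.1.1 (∑ k, ε (OrderDual.toDual i) * x * ε (OrderDual.toDual k)) =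
      ∑ k, ψ.1.1 (ε (OrderDual.toDual i) * x * ε (OrderDual.toDual k)) from
        map_sum (show R →ₗ[K] K from ψ.1.1) _ _]
    refine Finset.sum_eq_zero fun k _ => ?_
    have hxk : (H.cmp x i k) (D.y b i) = 0 := by
      have h2 : H.el b k ((H.cmp x i k).comp (D.incl b i)) = H.el b k 0 := by
        rw [← hsx, ← mul_assoc, hx, zero_mul, map_zero]
      have h3 := LinearMap.congr_fun (H.el_injective b k h2) (D.x b)
      rwa [LinearMap.comp_apply, D.incl_x (hb i)] at h3
    rw [H.idem_mul_idem]
    obtain ⟨c, hc, hcs, -⟩ := D.exists_coeff (H.cmp x i k)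
    have hquo : ∀ m, m ≤ i → m ≠ i → D.quo i m (D.y b i) = 0 := fun m hm hmi => by
      by_contra h
      exact hmi (le_antisymm hm (D.le_of_injective _ (D.injective_of_apply_y_ne_zero hA hb _ h)))
    have hci : c i = 0 := by
      by_contra h0
      rw [hc, LinearMap.sum_apply, Finset.sum_eq_single i, LinearMap.smul_apply, CyclicFamily.hom,
        D.quo_self, LinearMap.comp_id] at hxk
      · exact D.y_ne_zero (hb i) (D.incl_injective (hcs i h0).1
          (((smul_eq_zero.1 hxk).resolve_left h0).trans (map_zero _).symm))
      · intro m _ hm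
        by_cases hcm : c m = 0
        · rw [hcm, zero_smul, LinearMap.zero_apply]
        · rw [LinearMap.smul_apply, CyclicFamily.hom, LinearMap.comp_apply,
            hquo m (hcs m hcm).2 hm, map_zero, smul_zero]
      · exact fun h => absurd (Finset.mem_univ _) h
    rw [hc, map_sum]
    rw [show ψ.1.1 (∑ m, H.el i k (c m • D.hom m i k)) = ∑ m, ψ.1.1 (H.el i k (c m • D.hom m i k))
      from map_sum (show R →ₗ[K] K from ψ.1.1) _ _]
    refine Finset.sum_eq_zero fun m _ => ?_
    rw [map_smul, KDual.map_smul]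
    by_cases hcm : c m = 0
    · rw [hcm, zero_mul]
    · have hm : ¬ i ≤ m := fun h => hcm (le_antisymm (hcs m hcm).2 h ▸ hci)
      rw [CyclicFamily.hom, ← H.el_mul, ← H.el_mul_idem (D.quo i m), hψ m hm, mul_zero]
  have hmem : (show Module.Dual K R from ψ.1.1) ∈ LinearMap.range (LinearMap.mulLeft K s).dualMap := by
    rw [LinearMap.range_dualMap_eq_dualAnnihilator_ker, Submodule.mem_dualAnnihilator]
    exact fun x hx => hψ0 x hx
  obtain ⟨φ₀, hφ₀⟩ := hmem
  obtain ⟨φ, hφ⟩ := exists_I_apply_eq (H.complete.idem (OrderDual.toDual b)) φ₀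
  have htop : Costd K ε (OrderDual.toDual b) = ⊤ :=
    costd_top (K := K) (e := ε) fun l => OrderDual.le_toDual.2 (hb _)
  refine ⟨⟨φ, by rw [htop]; trivial⟩, Subtype.ext (Subtype.ext (KDual.ext fun x => ?_))⟩
  rw [hf, LinearMap.comp_apply, hg]
  change φ.1 (s * x) = _
  rw [hφ, ← mul_assoc, hs1]
  exact LinearMap.congr_fun hφ₀ x

theorem CyclicFamily.isOneQuasiHereditary (D : CyclicFamily K e b T)
    (H : HomRing (A := A) K T ε) (hA : IsOneQuasiHereditary K e) (hb : IsBot b)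
    (hT : ∀ i, IsIndecomposable A (T i)) : IsOneQuasiHereditary K ε where
  toIsQuasiHereditary := D.isQuasiHereditary H hA.toIsBasic hb hT
  exists_bot := hA.exists_top.imp fun t ht => ht.toDual
  exists_top := ⟨OrderDual.toDual b, hb.toDual⟩
  std_jh i j h := D.jh_std_ringel H hA.toIsBasic hb (i := OrderDual.ofDual i)
    (k := OrderDual.ofDual j) h
  proj_mult i j h := D.hasMult_one H (i := OrderDual.ofDual j) (j := OrderDual.ofDual i) h
  soc_proj t ht j := D.soc_ringel H hA.toIsBasic hb (D.isBasic H hT) (t := OrderDual.ofDual t)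
    ht.ofDual (OrderDual.ofDual j)
  top_inj t ht j := D.top_ringel H hA hb (D.isBasic H hT) (t := OrderDual.ofDual t)
    ht.ofDual (OrderDual.ofDual j)
  std_embed t ht i := by
    obtain rfl : t = OrderDual.toDual b := le_antisymm (hb.toDual t) (ht _)
    exact D.std_embed_ringel H hA.toIsBasic hb (OrderDual.ofDual i)
  costd_onto t ht i := by
    obtain rfl : t = OrderDual.toDual b := le_antisymm (hb.toDual t) (ht _)
    exact D.costd_onto_ringel H hA.toIsBasic hb (OrderDual.ofDual i)

end RingelOne

/-! ### Tilting modules are local if the Ringel dual is 1-quasi-hereditary -/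

section Converse

variable {K : Type*} [Field K] {A : Type*} [Ring A] [Algebra K A] [Module.Finite K A] {ι : Type*}
  [Fintype ι] [PartialOrder ι] {e : ι → A} {b : ι}
  {T : ι → Type*} [∀ i, AddCommGroup (T i)] [∀ i, Module K (T i)] [∀ i, Module A (T i)]
  [∀ i, IsScalarTower K A (T i)]
  {R : Type*} [Ring R] [Algebra K R] [Module.Finite K R] {ε : ιᵒᵈ → R}

/-- If y were not a multiple of x, some linear form would vanish at x but not at y, and it would
come from I(j). -/
theorem eq_smul_of_annSub_eq {j : ι} {x y : A} (he : IsIdempotentElem (e j))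
    {hx : ∀ a : A, ∃ c : K, x * a = c • x} {hy : ∀ a : A, ∃ c : K, y * a = c • y}
    (hx1 : e j * x = x) (hy1 : e j * y = y) (h : annSub K e j x hx = annSub K e j y hy) :
    ∃ c : K, y = c • x := by
  by_contra! hcon
  have hmem : y ∉ Submodule.span K {x} := fun hm => by
    obtain ⟨c, hc⟩ := Submodule.mem_span_singleton.1 hm
    exact hcon c hc.symm
  obtain ⟨ψ, hψ, hψx⟩ := Submodule.exists_le_ker_of_notMem hmem
  obtain ⟨φ, hφ⟩ := exists_I_apply_eq (K := K) (e := e) he ψ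
  have h1 : φ ∈ annSub K e j x hx := by
    change φ.1 x = 0
    rw [hφ, hx1]
    exact hψx (Submodule.mem_span_singleton_self x)
  rw [h] at h1
  change φ.1 y = 0 at h1
  rw [hφ, hy1] at h1
  exact hψ h1

/-- A simple quotient `M / N` with `e_b (M / N) ≠ 0` embeds into a module with a socle generator. -/
theorem IsSocGen.exists_map_of_isCoatom (hA : IsBasic K e) {M M' : Type*} [AddCommGroup M]
    [Module A M] [AddCommGroup M'] [Module K M'] [Module A M'] [IsScalarTower K A M'] {s : M'}
    (hs : IsSocGen K e b s) (hM : IsGeneratedBy (e b) M) {N : Submodule A M} (hN : IsCoatom N) :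
    ∃ g : M →ₗ[A] M', LinearMap.ker g = N ∧ ∀ x, ∃ c : K, g x = c • s := by
  have hsimple : IsSimpleModule A (M ⧸ N) := isSimpleModule_iff_isCoatom.2 hN
  obtain ⟨x, hx, hx0⟩ : ∃ x, e b • x = x ∧ N.mkQ x ≠ 0 := by
    by_contra! hcon
    have h0 := hM.eq_zero N.mkQ hcon
    have h1 := N.ker_mkQ
    rw [h0, LinearMap.ker_zero] at h1
    exact hN.1 h1.symm
  obtain ⟨hss, -⟩ := soc_eq_span_of_essential hs.ne_zero hs.essential
  obtain ⟨φ⟩ := top_equiv_of_smul_ne_zero K (hA.idem b) (hA.primitive b) (x := N.mkQ x)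
    (by rwa [← map_smul, hx])
  obtain ⟨θ⟩ := top_equiv_of_smul_ne_zero K (hA.idem b) (hA.primitive b)
    (x := (⟨s, Submodule.mem_span_singleton_self s⟩ : Submodule.span A {s}))
    (fun h => hs.ne_zero (by rw [← hs.smul_self]; exact congrArg Subtype.val h))
  refine ⟨(Submodule.span A {s}).subtype.comp ((φ.symm.trans θ).toLinearMap.comp N.mkQ), ?_,
    fun y => ?_⟩
  · ext y
    rw [LinearMap.mem_ker, LinearMap.comp_apply, Submodule.subtype_apply, ZeroMemClass.coe_eq_zero,
      LinearMap.comp_apply, LinearEquiv.coe_coe, LinearEquiv.map_eq_zero_iff, Submodule.mkQ_apply,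
      Submodule.Quotient.mk_eq_zero]
  · obtain ⟨a, ha⟩ := Submodule.mem_span_singleton.1 ((φ.symm.trans θ) (N.mkQ y)).2
    obtain ⟨c, hc⟩ := hs.exists_smul a
    exact ⟨c, by rw [← hc, ha]; rfl⟩

theorem isLocalMod_of_ringel (H : HomRing (A := A) K T ε) (hA : IsOneQuasiHereditary K e)
    (hb : IsBot b) (hT : ∀ i, IsTiltingSummand K e i (T i)) (hR : IsOneQuasiHereditary K ε) (j : ι) :
    IsLocalMod A (T j) := by
  have hfin : ∀ i, Module.Finite K (T i) := fun i => (hT i).finite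
  have : Module.Finite A (T j) := Module.Finite.of_restrictScalars_finite K A _
  have := (hT j).indecomposable.1
  obtain ⟨t, ht⟩ := hA.exists_top
  obtain ⟨φ⟩ := (hT t).equiv_proj hA hb ht
  obtain ⟨s₀, hs₀⟩ := exists_isSocGen_proj hA hb b
  have hs := hs₀.map_equiv φ
  generalize φ s₀ = s at hs
  have hgen := (hT j).isGeneratedBy hA hb
  have heig : ∀ g : T j →ₗ[A] T t, (∀ x, ∃ c : K, g x = c • s) →
      -- Postcomposing g with h : T(t) → T(k) gives zero if h kills the socle generator s. Otherwise
      -- h is injective, the support of T(k) forces k = t, and h s is a multiple of s.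
      ∀ r : R, ∃ c : K, H.el j t g * r = c • H.el j t g := by
    intro g hg r
    refine H.exists_mul_eq_smul g (fun k h => ?_) r
    by_cases h0 : h s = 0
    · refine ⟨0, ?_⟩
      rw [zero_smul, ← map_zero (H.el j k)]
      congr 1
      refine LinearMap.ext fun x => ?_
      obtain ⟨c, hc⟩ := hg x
      rw [LinearMap.comp_apply, hc, LinearMap.map_smul_of_tower, h0, smul_zero,
        LinearMap.zero_apply]
    · have hinj := hs.injective h h0
      obtain rfl : k = t := by
        by_contra hkt
        have hz := (edim_eq_zero_iff K (M := T t) (e t)).2 fun x => hinj (by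
          rw [map_smul, (hT k).smul_eq_zero (fun h' => hkt (le_antisymm (ht k) h')), map_zero])
        rw [show edim K (e t) (T t) = 1 from (hT t).jh_self] at hz
        exact one_ne_zero hz
      obtain ⟨a, ha⟩ := hs.essential _ h0
      obtain ⟨c, hc⟩ := hs.exists_smul a
      rw [← map_smul, hc, LinearMap.map_smul_of_tower] at ha
      have hc0 : c ≠ 0 := by
        rintro rfl
        exact hs.ne_zero (by rw [← ha, zero_smul])
      refine ⟨c⁻¹, ?_⟩
      rw [← map_smul]
      congr 1
      refine LinearMap.ext fun x => ?_
      obtain ⟨d, hd⟩ := hg x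
      rw [LinearMap.comp_apply, LinearMap.smul_apply, hd, LinearMap.map_smul_of_tower,
        smul_comm c⁻¹, ← ha, inv_smul_smul₀ hc0]
      rw [ha]
  -- The only consequence of (a) that is needed: I_R(j) has a unique maximal submodule, by condition
  -- (3) for R, where t is the least vertex.
  have hloc := (I_isGeneratedBy hR ht.toDual (OrderDual.toDual j)).1
  have hle : ∀ N N' : Submodule A (T j), IsCoatom N → IsCoatom N' → N ≤ N' := by
    intro N N' hN hN'
    obtain ⟨g, hgk, hg⟩ := hs.exists_map_of_isCoatom hA.toIsBasic hgen hN
    obtain ⟨g', hgk', hg'⟩ := hs.exists_map_of_isCoatom hA.toIsBasic hgen hN'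
    have hne : ∀ f : T j →ₗ[A] T t, IsCoatom (LinearMap.ker f) → H.el j t f ≠ 0 := by
      intro f hf h0
      rw [H.el_injective j t (h0.trans (map_zero (H.el j t)).symm), LinearMap.ker_zero] at hf
      exact hf.1 rfl
    have h1 := isCoatom_annSub (K := K) (H.complete.idem _) (hne g (hgk ▸ hN)) (H.idem_mul_el g)
      (heig g hg)
    have h2 := isCoatom_annSub (K := K) (H.complete.idem _) (hne g' (hgk' ▸ hN'))
      (H.idem_mul_el g') (heig g' hg')
    obtain ⟨c, hc⟩ := eq_smul_of_annSub_eq (H.complete.idem _) (H.idem_mul_el g)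
      (H.idem_mul_el g') (hloc.unique h1 h2)
    rw [← map_smul] at hc
    rw [← hgk, ← hgk', H.el_injective j t hc]
    intro x hx
    rw [LinearMap.mem_ker, LinearMap.smul_apply, LinearMap.mem_ker.1 hx, smul_zero]
  obtain ⟨N, hN, -⟩ := (eq_top_or_exists_le_coatom (⊥ : Submodule A (T j))).resolve_left bot_ne_top
  exact ⟨N, hN, fun N' hN' => le_antisymm (hle N' N hN' hN) (hle N N' hN hN')⟩

end Converse

end QHAlg

end

theorem mainTheorem5 {K : Type*} [Field K] [IsAlgClosed K] {A : Type*} [Ring A] [Algebra K A]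
    {ι : Type*} [Fintype ι] [PartialOrder ι] (e : ι → A)
    (hA : QHAlg.IsOneQuasiHereditary K e) (b : ι) (hb : IsBot b)
    (T : ι → Type*) [∀ i, AddCommGroup (T i)] [∀ i, Module K (T i)] [∀ i, Module A (T i)]
    [∀ i, IsScalarTower K A (T i)] (hT : ∀ i, QHAlg.IsTiltingSummand K e i (T i)) :
    (QHAlg.IsOneQuasiHereditary K (QHAlg.ringelIdem A T) ↔
      ∀ i, Nonempty (T i ≃ₗ[A] (QHAlg.P e b ⧸ QHAlg.sumProj e b i))) ∧
    (QHAlg.IsOneQuasiHereditary K (QHAlg.ringelIdem A T) ↔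
      ∀ i, QHAlg.IsLocalMod A (T i)) := by
  have := hA.finite
  have hfin : ∀ i, Module.Finite K (T i) := fun i => (hT i).finite
  have hfinR : Module.Finite K (QHAlg.RingelDual A T) := QHAlg.finite_ringelDual K T
  have hac : QHAlg.IsOneQuasiHereditary K (QHAlg.ringelIdem A T) →
      ∀ i, QHAlg.IsLocalMod A (T i) := fun hR =>
    QHAlg.isLocalMod_of_ringel (QHAlg.ringelHomRing K T) hA hb hT hR
  have hcb : (∀ i, QHAlg.IsLocalMod A (T i)) →
      ∀ i, Nonempty (T i ≃ₗ[A] (QHAlg.P e b ⧸ QHAlg.sumProj e b i)) := fun h i =>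
    (hT i).equiv_of_isLocalMod hA hb (h i)
  have hba : (∀ i, Nonempty (T i ≃ₗ[A] (QHAlg.P e b ⧸ QHAlg.sumProj e b i))) →
      QHAlg.IsOneQuasiHereditary K (QHAlg.ringelIdem A T) := fun h => by
    obtain ⟨D⟩ := QHAlg.exists_cyclicFamily hA hb hT h
    exact D.isOneQuasiHereditary (QHAlg.ringelHomRing K T) hA hb fun i => (hT i).indecomposable
  exact ⟨⟨fun h => hcb (hac h), hba⟩, ⟨hac, fun h => hba (hcb h)⟩⟩
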